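/- Let $L\subset\mathbb R^c$ be a lattice of full rank $c$ that is integral, $(x|y)\in\mathbb Z$ for $x,y\in L$, with dual lattice $L^*\supseteq L$. Let $a^i_n$ ($1\le i\le c$, $n\in\mathbb Z$) satisfy $[a^i_m,a^j_n]=m\,\delta_{m,-n}\delta_{ij}$, let $F$ be the Fock space generated by the $a^i_{n}$, $n<0$, and let $\mathcal H=\bigoplus_{\gamma\in L^*}F\otimes|\gamma\rangle$. On it act the modes $H^v_n=\sum_i v_i a^i_n$ of the Cartan currents $H^v(z)=\sum_n H^v_nz^{-n-1}$, $v\in\mathbb C\otimes L=\mathbb C^c$ (with $H^v_0|\gamma\rangle=(v|\gamma)|\gamma\rangle$), the energy operator $L_0=\sum_i\sum_{n>0}a^i_{-n}a^i_n+\frac12\sum_i(a^i_0)^2$, and, for $\alpha\in L$, the vertex operators $$Y(\alpha,z)=\sum_n E^\alpha_nz^{-n-1}=\exp\Big(\sum_{n\ge1}\tfrac{\alpha_{-n}z^n}{n}\Big)\exp\Big(-\sum_{n\ge1}\tfrac{\alpha_nz^{-n}}{n}\Big)e_\alpha z^{\alpha_0},\qquad \alpha_n=H^\alpha_n,\quad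 e_\alpha|\gamma\rangle=\varepsilon(\alpha,\gamma)|\gamma+\alpha\rangle .$$ Here $\varepsilon:L\times L^*\to\{\pm1\}$ is any normalized cocycle ($\varepsilon(0,\gamma)=\varepsilon(\alpha,0)=1$ and $e_\alpha e_{\alpha'}=\varepsilon(\alpha,\alpha')e_{\alpha+\alpha'}$) with $\varepsilon(\alpha,\alpha')=(-1)^{(\alpha|\alpha')+|\alpha|^2|\alpha'|^2}\varepsilon(\alpha',\alpha)$ for $\alpha,\alpha'\in L$. These fields generate the lattice chiral algebra $\mathcal A(L)$, whose irreducible positive energy modules are the subspaces $\mathcal H_\lambda\subset\mathcal H$ with charges in $\lambda+L$, $\lambda\in L^*/L$. Let $\mathcal G_{\mathbb C}$ be the span of the zero modes $H^v_0$ ($v\in\mathbb C\otimes L$) and $E^\alpha_0$ ($\alpha\in L$, $|\alpha|^2=2$) of the dimension 1 currents, with the bilinear form $(H^v_0|H^w_0)=(v|w)$, $(E^\alpha_0|E^{-\alpha}_0)=\varepsilon(\alpha,-\alpha)$ (all other pairings of basis elements vanish), and let $i\mathcal G\subset\mathcal G_{\mathbb C}$ be the real subspace of Hermitian elements, where $(H^v_0)^*=H^{\bar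 v}_0$ and $(E^\alpha_0)^*=\varepsilon(\alpha,-\alpha)E^{-\alpha}_0$. Vectors $v\in\mathbb C\otimes L$ are identified with $H^v_0$. Let $G$ be the group generated by the operators $e^{2\pi ix}$, $x\in i\mathcal G$, on $\mathcal H$. For $x\in\mathcal G_{\mathbb C}$ and $\mathrm{Im}\,\tau>0$, $q=e^{2\pi i\tau}$, put $$\chi_\lambda(\tau,x)=\mathrm{tr}_{\mathcal H_\lambda}\big(q^{L_0-\frac c{24}}e^{2\pi ix}\big),\qquad \chi_\lambda^{x,\beta}(\tau)=q^{\frac12(\beta|\beta)}\chi_\lambda(\tau,x-\tau\beta),$$ all traces being sums over the eigenspaces of $L_0$, on which all these operators act. Let $Q\in L^*$ (the electric charge) and let $\Gamma\subset G$ be a finite subgroup that commutes with the current $H^Q(z)$. Let $b\in\Gamma$ and $\beta\in i\mathcal G$ be such that $b=e^{2\pi i\beta}$, $[\beta,Q]=0$, and the centralizers $\Gamma_b$ of $b$ and $\Gamma_\beta$ of $\beta$ in $\Gamma$ coincide. For every $h\in\Gamma_\beta$ let $\alpha=\alpha_h\in i\mathcal G$ be such that $h=e^{2\pi i\alpha}$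 and $[\alpha,\beta]=[\alpha,Q]=0$. The $\beta$-twisted module $\mathcal H^\beta_\lambda$ is the $\Gamma_\beta$-module $\mathcal H_\lambda$ with energy operator $L_0-\beta+\frac12(\beta|\beta)$ and electric charge operator $H^Q_0-(Q|\beta)$. Let $\rho$ be an irreducible representation of $\Gamma_\beta$ on a finite dimensional complex vector space $V$, with character $\sigma$, let $\lambda\in L^*/L$, and let $$\mathcal H^\beta_{\lambda\sigma}=P_\sigma\mathcal H^\beta_\lambda,\qquad P_\sigma=\frac{\sigma(1)}{|\Gamma_\beta|}\sum_{h\in\Gamma_\beta}\overline{\sigma(h)}\,h .$$ (1) If $\mathcal H^\beta_{\lambda\sigma}\ne0$, then $\sigma$ and $\lambda$ agree on $L^*/L$: for every $\mu\in L^*$ such that the central element $e^{2\pi i\mu}$ of $G$ (which acts on $\mathcal H_\lambda$ as the scalar $e^{2\pi i(\mu|\lambda)}$) lies in $\Gamma_\beta$, one has $\rho(e^{2\pi i\mu})=e^{2\pi i(\mu|\lambda)}\,\mathrm{id}_V$. (2) For $\mathrm{Im}\,\tau>0$ and $\zeta\in\mathbb C$, put $$\chi^\beta_{\lambda,\sigma}(\tau,\zeta)=\frac1{|\Gamma_\beta|}\sum_{h=e^{2\pi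 i\alpha}\in\Gamma_\beta}e^{-2\pi i\zeta(Q|\beta)}\,\chi_\lambda^{\zeta Q+\alpha,\beta}(\tau)\,\overline{\sigma(h)} .$$ Then all operator exponentials involved exist, all traces converge absolutely, $\chi^\beta_{\lambda,\sigma}(\tau,\zeta)$ is the trace of $$q^{L_0-\beta+\frac12(\beta|\beta)-\frac c{24}}\,e^{2\pi i\zeta(H^Q_0-(Q|\beta))}$$ on the multiplicity space $\mathrm{Hom}_{\Gamma_\beta}(V,\mathcal H^\beta_\lambda)$ of $\rho$, and the trace of the same operator on $\mathcal H^\beta_{\lambda\sigma}\cong V\otimes\mathrm{Hom}_{\Gamma_\beta}(V,\mathcal H^\beta_\lambda)$ is $\sigma(1)\,\chi^\beta_{\lambda,\sigma}(\tau,\zeta)$. (3) The characters $\chi_\lambda$ are lattice theta functions: if $x\in\mathcal G_{\mathbb C}$ is conjugate under $G$ to $v\in\mathbb C\otimes L$, then, with $\eta(\tau)=q^{\frac1{24}}\prod_{n\ge1}(1-q^n)$ and absolutely convergent sums, $$\chi_\lambda(\tau,x)=\frac1{\eta(\tau)^c}\sum_{\gamma\in L+\lambda}q^{\frac12(\gamma|\gamma)}e^{2\pi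 i(\gamma|v)} .$$ -/

import Mathlib

noncomputable section

namespace LatticeOrbifold

/-- The Euclidean space of `U(1)^c` charges. -/
abbrev ChargeSpace (c : ℕ) : Type := EuclideanSpace ℝ (Fin c)

/-- The dual lattice `L* = {x | (x|y) ∈ ℤ for all y ∈ L}`. -/
def dualLattice {c : ℕ} (L : Submodule ℤ (ChargeSpace c)) : Submodule ℤ (ChargeSpace c) where
  carrier := {x | ∀ y ∈ L, ∃ k : ℤ, inner ℝ x y = (k : ℝ)}
  add_mem' := by
    intro a b ha hb y hy
    obtain ⟨k, hk⟩ := ha y hy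
    obtain ⟨l, hl⟩ := hb y hy
    exact ⟨k + l, by rw [inner_add_left, hk, hl]; push_cast; ring⟩
  zero_mem' := fun y _ => ⟨0, by simp⟩
  smul_mem' := by
    intro n x hx y hy
    obtain ⟨k, hk⟩ := hx y hy
    refine ⟨n * k, ?_⟩
    rw [← Int.cast_smul_eq_zsmul ℝ n x, real_inner_smul_left, hk]
    push_cast
    ring

/-- `L` is integral: `(x|y) ∈ ℤ` for all `x, y ∈ L`, i.e. `L ⊆ L*`. -/
class IsIntegralLattice {c : ℕ} (L : Submodule ℤ (ChargeSpace c)) : Prop where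
  le_dual : L ≤ dualLattice L

/-- The integer `(x|y)`; it is only used for `x ∈ L`, `y ∈ L*`, where the floor does nothing. -/
def pairing {c : ℕ} (x y : ChargeSpace c) : ℤ := ⌊(inner ℝ x y : ℝ)⌋

section Lattice

variable {c : ℕ} (L : Submodule ℤ (ChargeSpace c))

/-- An element of `L`, seen in `L*`. -/
def toDual [IsIntegralLattice L] (a : L) : dualLattice L := ⟨a.1, IsIntegralLattice.le_dual a.2⟩

/-- The `±1`-valued cocycles `ε(α, γ)`, `α ∈ L`, `γ ∈ L*`, through which `L` is represented on
charged states, `e_α |γ⟩ = ε(α, γ) |γ + α⟩`: `e_α e_α' = ε(α, α') e_{α + α'}`, and on `L` the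
symmetry factor is `(-1)^{(α|α') + |α|²|α'|²}`, which gives the vertex operators of `α, α' ∈ L`
the correct spin-statistics relation (anticommuting iff `|α|²` and `|α'|²` are both odd). -/
structure Cocycle [IsIntegralLattice L] where
  sign : L → dualLattice L → ℤˣ
  cocycle : ∀ (a b : L) (g : dualLattice L),
    sign a (toDual L b + g) * sign b g = sign a (toDual L b) * sign (a + b) g
  zero_left : ∀ g : dualLattice L, sign 0 g = 1
  zero_right : ∀ a : L, sign a 0 = 1
  statistics : ∀ a b : L, sign a (toDual L b) =
    (-1 : ℤˣ) ^ (pairing (a : ChargeSpace c) b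
      + pairing (a : ChargeSpace c) a * pairing (b : ChargeSpace c) b) * sign b (toDual L a)

end Lattice

/-- The pairing of lattice vectors is their inner product. -/
theorem pairing_spec {c : ℕ} {L : Submodule ℤ (ChargeSpace c)} [IsIntegralLattice L] (a b : L) :
    ((pairing (a : ChargeSpace c) b : ℤ) : ℝ) = inner ℝ (a : ChargeSpace c) b := by
  obtain ⟨k, hk⟩ := IsIntegralLattice.le_dual a.2 b.1 b.2
  simp [pairing, hk]

/-- Spin-statistics cocycles exist on every integral lattice. -/
theorem Cocycle.nonempty {c : ℕ} (L : Submodule ℤ (ChargeSpace c)) [DiscreteTopology L]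
    [IsZLattice ℝ L] [IsIntegralLattice L] : Nonempty (Cocycle L) := by
  classical
  have : Module.Free ℤ L := ZLattice.module_free ℝ L
  have : Module.Finite ℤ L := ZLattice.module_finite ℝ L
  have padd : ∀ a b d : L, pairing ((a + b : L) : ChargeSpace c) d
      = pairing (a : ChargeSpace c) d + pairing (b : ChargeSpace c) d := by
    intro a b d
    have : ((pairing ((a + b : L) : ChargeSpace c) d : ℤ) : ℝ)
      = ((pairing (a : ChargeSpace c) d + pairing (b : ChargeSpace c) d : ℤ) : ℝ) := by
      rw [Int.cast_add, pairing_spec, pairing_spec, pairing_spec]; simp [inner_add_left]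
    exact_mod_cast this
  have psymm : ∀ a b : L, pairing (a : ChargeSpace c) b = pairing (b : ChargeSpace c) a := by
    intro a b; simp [pairing, real_inner_comm]
  have padd' : ∀ a b d : L, pairing (d : ChargeSpace c) ((a + b : L) : ChargeSpace c)
      = pairing (d : ChargeSpace c) a + pairing (d : ChargeSpace c) b := by
    intro a b d; rw [psymm, padd, psymm a, psymm b]
  let ip : L →+ L →+ ℤ := AddMonoidHom.mk' (fun a => AddMonoidHom.mk'
    (fun b => pairing (a : ChargeSpace c) b) (fun x y => padd' x y a))
    (fun x y => by ext d; exact padd x y d)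
  have hip : ∀ a b : L, ip a b = pairing (a : ChargeSpace c) b := fun _ _ => rfl
  have ipsymm : ∀ a b : L, ip a b = ip b a := psymm
  let f : L →+ ZMod 2 := AddMonoidHom.mk' (fun a => ((ip a a : ℤ) : ZMod 2)) (fun x y => by
    simp only [map_add, AddMonoidHom.add_apply, Int.cast_add, ipsymm y x]
    have h2 : (2 : ZMod 2) = 0 := rfl
    linear_combination ((ip x y : ℤ) : ZMod 2) * h2)
  obtain ⟨p, hp⟩ := Module.projective_lifting_property
    (Int.castAddHom (ZMod 2)).toIntLinearMap f.toIntLinearMap ZMod.intCast_surjective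
  have hp' : ∀ a, ((p a : ℤ) : ZMod 2) = ((ip a a : ℤ) : ZMod 2) := fun a =>
    LinearMap.congr_fun hp a
  have hpar : ∀ a, (2 : ℤ) ∣ ip a a - p a := fun a => by
    have := (ZMod.intCast_eq_intCast_iff_dvd_sub _ _ 2).1 (hp' a)
    exact_mod_cast this
  have heven : ∀ a, (2 : ℤ) ∣ ip a a + p a * p a := fun a => by
    have h1 := hpar a
    have h2 : (2 : ℤ) ∣ p a * (p a + 1) := (Int.even_mul_succ_self (p a)).two_dvd
    have e : ip a a + p a * p a = ip a a - p a + p a * (p a + 1) := by ring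
    exact e ▸ dvd_add h1 h2
  choose q hq using heven
  let M : LinearMap.BilinMap ℤ L ℤ := LinearMap.mk₂ ℤ (fun a b => ip a b + p a * p b)
    (by intros; simp only [map_add, AddMonoidHom.add_apply]; ring) (by intros; simp [mul_add, mul_assoc])
    (by intros; simp only [map_add]; ring) (by intros; simp [mul_add, mul_left_comm])
  have hM : ∀ a b, M a b = ip a b + p a * p b := fun _ _ => rfl
  let Qm : QuadraticMap ℤ L ℤ :=
    { toFun := q
      toFun_smul := by
        intro n x
        have h1 := hq (n • x)
        have h2 := hq x
        simp only [map_zsmul, AddMonoidHom.smul_apply, smul_eq_mul, map_smul] at h1 ⊢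
        have : 2 * q (n • x) = 2 * (n * n * q x) := by
          rw [← h1]; linear_combination (n * n) * h2
        linarith
      exists_companion' := ⟨M, by
        intro x y
        have h1 := hq (x + y)
        have h2 := hq x
        have h3 := hq y
        simp only [map_add, AddMonoidHom.add_apply, ipsymm y x] at h1
        rw [hM]
        linarith⟩ }
  obtain ⟨N, hN⟩ := LinearMap.BilinMap.toQuadraticMap_surjective Qm
  have hNq : ∀ a, N a a = q a := fun a => congrArg (fun F : QuadraticMap ℤ L ℤ => F a) hN
  have hpol : ∀ a b, N a b + N b a = ip a b + p a * p b := by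
    intro a b
    have h1 := hNq (a + b)
    simp only [map_add, LinearMap.add_apply, hNq] at h1
    have h2 := hq (a + b)
    have h3 := hq a
    have h4 := hq b
    simp only [map_add, AddMonoidHom.add_apply, ipsymm b a] at h2
    linarith
  let L' : AddSubgroup (dualLattice L) :=
    L.toAddSubgroup.comap (dualLattice L).toAddSubgroup.subtype
  let s : dualLattice L → dualLattice L := fun g =>
    if (g : ChargeSpace c) ∈ L then 0 else (QuotientAddGroup.mk (s := L') g).out
  have hs : ∀ g, ((g - s g : dualLattice L) : ChargeSpace c) ∈ L := by
    intro g
    by_cases h : (g : ChargeSpace c) ∈ L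
    · simp [s, h]
    · have h1 : -(QuotientAddGroup.mk (s := L') g).out + g ∈ L' :=
        QuotientAddGroup.eq.1 (Quotient.out_eq' (QuotientAddGroup.mk (s := L') g))
      have h2 : ((-(QuotientAddGroup.mk (s := L') g).out + g : dualLattice L) : ChargeSpace c)
        ∈ L := h1
      simp only [s, h, if_false]
      convert h2 using 2
      abel
  let r : dualLattice L → L := fun g => ⟨((g - s g : dualLattice L) : ChargeSpace c), hs g⟩
  have hmem : ∀ (b : L) (g : dualLattice L),
      ((toDual L b + g : dualLattice L) : ChargeSpace c) ∈ L ↔ (g : ChargeSpace c) ∈ L := by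
    intro b g
    exact Submodule.add_mem_iff_right L b.2
  have hsadd : ∀ (b : L) (g : dualLattice L), s (toDual L b + g) = s g := by
    intro b g
    have : (QuotientAddGroup.mk (s := L') (toDual L b + g)) = QuotientAddGroup.mk (s := L') g := by
      refine QuotientAddGroup.eq.2 ?_
      have : ((-(toDual L b + g) + g : dualLattice L) : ChargeSpace c) ∈ L := by
        have h : ((-(toDual L b + g) + g : dualLattice L) : ChargeSpace c)
          = -(b : ChargeSpace c) := by simp [toDual]
        rw [h]; exact L.neg_mem b.2
      exact this
    simp only [s, hmem, this]
  have hr : ∀ (b : L) (g : dualLattice L), r (toDual L b + g) = b + r g := by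
    intro b g
    apply Subtype.ext
    simp only [r, hsadd]
    simp [toDual]; abel
  have hrd : ∀ b : L, r (toDual L b) = b := by
    intro b
    apply Subtype.ext
    simp [r, s, toDual]
  have hr0 : r 0 = 0 := by
    apply Subtype.ext; simp [r, s]
  refine ⟨⟨fun a g => (-1 : ℤˣ) ^ (N a (r g)), ?_, ?_, ?_, ?_⟩⟩
  · intro a b g
    rw [hr, hrd, ← zpow_add, ← zpow_add]
    congr 1
    simp; ring
  · intro g; simp
  · intro a; simp [hr0]
  · intro a b
    rw [hrd, hrd, ← zpow_add, ← hip, ← hip, ← hip]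
    have h := hpol a b
    obtain ⟨x, hx⟩ := hpar a
    obtain ⟨y, hy⟩ := hpar b
    have : N a b = ip a b + ip a a * ip b b + N b a
        + 2 * (- N b a - x * ip b b - y * p a) := by
      have e1 : ip a a = p a + 2 * x := by linarith
      have e2 : ip b b = p b + 2 * y := by linarith
      rw [e1, e2]; linear_combination h
    rw [this, zpow_add _ _ (2 * _), zpow_mul]
    simp

section Lattice

variable {c : ℕ} (L : Submodule ℤ (ChargeSpace c))

/-- The Fock space of `c` free bosons: polynomials in the creation operators; the variable
`(i, k)` stands for `a^i_{-(k+1)}`, where `[a^i_m, a^j_n] = m δ_{m,-n} δ_{ij}`. -/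
abbrev Fock (c : ℕ) : Type := MvPolynomial (Fin c × ℕ) ℂ

/-- The space `⊕_{γ ∈ L*} Fock ⊗ |γ⟩`, i.e. the direct sum of the modules `H_λ`, `λ ∈ L*/L`. -/
abbrev StateSpace : Type := dualLattice L →₀ Fock c

/-- Linear operators on the state space. -/
abbrev Operator : Type := Module.End ℂ (StateSpace L)

/-- The operator `p ⊗ |γ⟩ ↦ f γ p ⊗ |s γ⟩`. -/
def sectorwise (s : dualLattice L → dualLattice L) (f : dualLattice L → Module.End ℂ (Fock c)) :
    Operator L :=
  Finsupp.lsum ℂ fun g => (Finsupp.lsingle (s g)).comp (f g)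

/-- The Laurent modes `H^v_n` of the Cartan current `H^v(z) = ∑ H^v_n z^{-n-1}`, `v ∈ ℂ ⊗ L`. -/
def cartanMode (v : Fin c → ℂ) : ℤ → Operator L
  | Int.ofNat 0 => sectorwise L id fun g =>
      (∑ i, v i * ((g : ChargeSpace c) i : ℂ)) • LinearMap.id
  | Int.ofNat (k + 1) => sectorwise L id fun _ =>
      ∑ i, (((k : ℂ) + 1) * v i) • (MvPolynomial.pderiv (R := ℂ) (i, k)).toLinearMap
  | Int.negSucc k => sectorwise L id fun _ =>
      LinearMap.mulLeft ℂ (∑ i, MvPolynomial.C (v i) * MvPolynomial.X (i, k))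

/-- The energy operator `L₀ = ∑_{n > 0} ∑_i a^i_{-n} a^i_n + ½ ∑_i (a^i_0)²`: on `p ⊗ |γ⟩` it is
the oscillator number derivation plus `½|γ|²`. -/
def energy : Operator L :=
  sectorwise L id fun g =>
    (MvPolynomial.mkDerivation ℂ fun x : Fin c × ℕ =>
      MvPolynomial.C ((x.2 : ℂ) + 1) * (MvPolynomial.X x : Fock c)).toLinearMap
    + ((inner ℝ (g : ChargeSpace c) (g : ChargeSpace c) / 2 : ℝ) : ℂ) • LinearMap.id

/-- The coefficients `S_k` of `exp (∑_{n ≥ 1} α_{-n} z^n / n) = ∑_k S_k z^k`, through the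
recursion `(k + 1) S_{k+1} = ∑_{j=0}^{k} α_{-(j+1)} S_{k-j}`. -/
def creationSchur {c : ℕ} (a : ChargeSpace c) : ℕ → Fock c
  | 0 => 1
  | k + 1 => MvPolynomial.C (1 / ((k : ℂ) + 1)) * ∑ j : Fin (k + 1),
      (∑ i, MvPolynomial.C (a i : ℂ) * MvPolynomial.X (i, (j : ℕ))) * creationSchur a (k - j)

/-- `exp (-∑_{n ≥ 1} α_n z^{-n} / n)` on the Fock space, as a polynomial in `z⁻¹`: since
`α_n = n ∑_i α_i ∂/∂a^i_{-n}`, it is the translation `a^i_{-n} ↦ a^i_{-n} - α_i z^{-n}`. -/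
def annihilationExp {c : ℕ} (a : ChargeSpace c) : Fock c →ₐ[ℂ] Polynomial (Fock c) :=
  MvPolynomial.aeval fun x =>
    Polynomial.C (MvPolynomial.X x) - Polynomial.C (MvPolynomial.C (a x.1 : ℂ))
      * Polynomial.X ^ (x.2 + 1)

/-- The coefficient of `z^m` in
`exp (∑_{n ≥ 1} α_{-n} z^n / n) exp (-∑_{n ≥ 1} α_n z^{-n} / n)`, on the Fock space. -/
def bosonExp {c : ℕ} (a : ChargeSpace c) (m : ℤ) : Module.End ℂ (Fock c) :=
  (Polynomial.lsum fun k : ℕ =>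
    LinearMap.mulLeft ℂ (if 0 ≤ m + k then creationSchur a (m + k).toNat else 0)).comp
  (annihilationExp a).toLinearMap

variable {L}

/-- The modes `E^α_n` of the charged vertex operator `Y(α, z) = ∑ E^α_n z^{-n-1}`, `α ∈ L`, where
`Y(α, z) = exp (∑_{n ≥ 1} α_{-n} z^n / n) exp (-∑_{n ≥ 1} α_n z^{-n} / n) e_α z^{α_0}`. -/
def vertexMode [IsIntegralLattice L] (ε : Cocycle L) (a : L) (n : ℤ) : Operator L :=
  sectorwise L (fun g => g + toDual L a) fun g =>
    (((ε.sign a g : ℤˣ) : ℤ) : ℂ) • bosonExp (a : ChargeSpace c)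
      (-n - 1 - pairing (a : ChargeSpace c) (g : ChargeSpace c))

variable (L)

/-- The lattice vectors of square length 2, whose vertex operators have dimension 1. -/
def Root : Type := {a : L // inner ℝ (a : ChargeSpace c) (a : ChargeSpace c) = (2 : ℝ)}

/-- The opposite root. -/
def Root.opp {L : Submodule ℤ (ChargeSpace c)} (a : Root L) : Root L :=
  ⟨-a.1, by simpa using a.2⟩

/-- The complexified Lie algebra of zero modes of the dimension 1 currents of `A(L)`:
`(v, x)` stands for `H^v_0 + ∑_{|α|² = 2} x_α E^α_0`. -/
abbrev Currents : Type := (Fin c → ℂ) × (Root L →₀ ℂ)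

/-- The element `H^v_0`, `v ∈ ℂ ⊗ L`. -/
def cartan (v : Fin c → ℂ) : Currents L := (v, 0)

/-- The element `H^v_0` for a real vector `v`. -/
def ofReal (v : ChargeSpace c) : Currents L := cartan L fun i => (v i : ℂ)

variable {L} [IsIntegralLattice L] (ε : Cocycle L)

/-- The operator by which an element of the Lie algebra acts on the state space. -/
def toOperator (x : Currents L) : Operator L :=
  cartanMode L x.1 0 + x.2.sum fun a t => t • vertexMode ε a.1 0

/-- The invariant bilinear form `( | )`: `(H^v|H^w) = (v|w)`, `(E^α|E^{-α}) = ε(α, -α)`. -/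
def form (x y : Currents L) : ℂ :=
  ∑ i, x.1 i * y.1 i
    + x.2.sum fun a t => (((ε.sign a.1 (toDual L a.opp.1) : ℤˣ) : ℤ) : ℂ) * t * y.2 a.opp

/-- The real subspace `i𝒢` of Hermitian elements, where `(E^α_0)* = ε(α, -α) E^{-α}_0`. -/
def IsHermitian (x : Currents L) : Prop :=
  (∀ i, (x.1 i).im = 0) ∧
  ∀ a : Root L, x.2 a.opp =
    (((ε.sign a.1 (toDual L a.opp.1) : ℤˣ) : ℤ) : ℂ) * (starRingEnd ℂ) (x.2 a)

/-- `T = e^A`: every coordinate of `T v` is the sum of the exponential series of `A` on `v`. -/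
def IsExp (A T : Operator L) : Prop :=
  ∀ (v : StateSpace L) (g : dualLattice L) (m : Fin c × ℕ →₀ ℕ),
    HasSum (fun k : ℕ => ((Nat.factorial k : ℂ))⁻¹ * MvPolynomial.coeff m ((A ^ k) v g))
      (MvPolynomial.coeff m (T v g))

open Classical in
/-- The operator `e^A` (and `0` if the exponential series of `A` does not define one). -/
def opExp (A : Operator L) : Operator L :=
  if h : ∃ T, IsExp A T then h.choose else 0

/-- `h = e^{2πi x}`. -/
def IsExpOf (h : (Operator L)ˣ) (x : Currents L) : Prop :=
  IsExp ((2 * Real.pi * Complex.I) • toOperator ε x) h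

/-- The connected group `G` with Lie algebra `𝒢`, generated by the unitary operators `e^{2πi x}`,
`x ∈ i𝒢`, on the sum of all irreducible `A(L)` modules. -/
def gaugeGroup : Subgroup (Operator L)ˣ :=
  Subgroup.closure {h | ∃ x : Currents L, IsHermitian ε x ∧ IsExpOf ε h x}

/-- The centralizer in `Γ` of an operator. -/
def centralizerIn (Γ : Subgroup (Operator L)ˣ) (A : Operator L) : Subgroup (Operator L)ˣ where
  carrier := {h | h ∈ Γ ∧ Commute (h : Operator L) A}
  mul_mem' := fun ha hb => ⟨Γ.mul_mem ha.1 hb.1, by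
    simpa using ha.2.mul_left hb.2⟩
  one_mem' := ⟨Γ.one_mem, by simp⟩
  inv_mem' := fun ha => ⟨Γ.inv_mem ha.1, ha.2.units_inv_left⟩

/-- The centralizer `Γ_β` of `β` in `Γ`. -/
abbrev twistCentralizer (Γ : Subgroup (Operator L)ˣ) (β : Currents L) :
    Subgroup (Operator L)ˣ :=
  centralizerIn Γ (toOperator ε β)

variable (L) in
/-- The irreducible module `H_λ`, spanned by the charges in `λ + L`. -/
def sector (lam : dualLattice L) : Submodule ℂ (StateSpace L) :=
  Finsupp.supported (Fock c) ℂ {g | (g : ChargeSpace c) - (lam : ChargeSpace c) ∈ L}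

variable (L) in
/-- The subspace of energy `w`. -/
def energySpace (w : ℝ) : Submodule ℂ (StateSpace L) :=
  Module.End.eigenspace (energy L) (w : ℂ)

/-- The trace of `A` on an `A`-invariant subspace `W` (and `0` if `W` is not invariant). -/
def traceOn {M : Type*} [AddCommGroup M] [Module ℂ M] (W : Submodule ℂ M)
    (A : Module.End ℂ M) : ℂ :=
  open Classical in
  if h : ∀ x ∈ W, A x ∈ W then LinearMap.trace ℂ W (A.restrict h) else 0

/-- `tr A = t` on a module graded by the energy, with components `W w`: the components are finite
dimensional and invariant, and the sum of the traces over them converges absolutely to `t`. -/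
def HasTrace {M : Type*} [AddCommGroup M] [Module ℂ M] (W : ℝ → Submodule ℂ M)
    (A : Module.End ℂ M) (t : ℂ) : Prop :=
  (∀ w, FiniteDimensional ℂ (W w) ∧ ∀ x ∈ W w, A x ∈ W w) ∧ HasSum (fun w => traceOn (W w) A) t

/-- The operator `q^{L₀ - c/24} e^{2πi x}`. -/
def characterOperator (τ : ℂ) (x : Currents L) : Operator L :=
  opExp ((2 * Real.pi * Complex.I * τ) • (energy L - ((c : ℂ) / 24) • 1)) *
    opExp ((2 * Real.pi * Complex.I) • toOperator ε x)

/-- The character `χ_λ(τ, x) = tr_{H_λ} (q^{L₀ - c/24} e^{2πi x})`. -/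
def latticeCharacter (lam : dualLattice L) (τ : ℂ) (x : Currents L) : ℂ :=
  ∑' w : ℝ, traceOn (sector L lam ⊓ energySpace L w) (characterOperator ε τ x)

/-- The twisted character `χ_λ^{x,β}(τ) = q^{½|β|²} χ_λ(τ, x - τβ)`. -/
def twistedCharacter (lam : dualLattice L) (x β : Currents L) (τ : ℂ) : ℂ :=
  Complex.exp (2 * Real.pi * Complex.I * τ * (form ε β β / 2)) *
    latticeCharacter ε lam τ (x - τ • β)

/-- The energy operator `L₀ - β + ½|β|²` of the `β`-twisted module `H_λ^β` (spectral flow by `β`).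
The underlying space of `H_λ^β`, with the action of `Γ_β`, is that of `H_λ`. -/
def twistedEnergy (β : Currents L) : Operator L :=
  energy L - toOperator ε β + (form ε β β / 2) • 1

/-- The electric charge operator `H^Q_0 - (Q|β)` of the `β`-twisted module. -/
def twistedCharge (Q : ChargeSpace c) (β : Currents L) : Operator L :=
  toOperator ε (ofReal L Q) - (form ε (ofReal L Q) β) • 1

/-- The operator `q^{L₀ - β + ½|β|² - c/24} e^{2πiζ(H^Q_0 - (Q|β))}` of the `β`-twisted module. -/
def twistedCharacterOperator (Q : ChargeSpace c) (β : Currents L) (τ ζ : ℂ) : Operator L :=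
  opExp ((2 * Real.pi * Complex.I * τ) • (twistedEnergy ε β - ((c : ℂ) / 24) • 1)) *
    opExp ((2 * Real.pi * Complex.I * ζ) • twistedCharge ε Q β)

section Projection

variable {K : Subgroup (Operator L)ˣ} {V : Type*} [AddCommGroup V] [Module ℂ V]
  (ρ : Representation ℂ K V)

/-- The projector `P_σ = σ(1)/|K| ∑_{h ∈ K} σ*(h) h`, where `σ` is the character of `ρ`. -/
def projector : Operator L :=
  (ρ.character 1 / (Nat.card K : ℂ)) •
    ∑ᶠ h : K, (starRingEnd ℂ) (ρ.character h) • (h.1 : Operator L)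

/-- The projected module `P_σ H_λ`. -/
def projectedModule (lam : dualLattice L) : Submodule ℂ (StateSpace L) :=
  (sector L lam).map (projector ρ)

/-- The energy `w` part of the space `Hom_K(V, H_λ)` of multiplicities of `ρ` in `H_λ`. -/
def multiplicitySpace (lam : dualLattice L) (w : ℝ) : Submodule ℂ (V →ₗ[ℂ] StateSpace L) where
  carrier := {f | (∀ v, f v ∈ sector L lam ⊓ energySpace L w) ∧
    ∀ (h : K) (v : V), f (ρ h v) = (h.1 : Operator L) (f v)}
  add_mem' := fun hf hg => ⟨fun v => Submodule.add_mem _ (hf.1 v) (hg.1 v), fun h v => by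
    simp [hf.2 h v, hg.2 h v]⟩
  zero_mem' := ⟨fun v => Submodule.zero_mem _, fun h v => by simp⟩
  smul_mem' := fun t f hf => ⟨fun v => Submodule.smul_mem _ t (hf.1 v), fun h v => by
    simp [hf.2 h v]⟩

/-- The action `f ↦ A ∘ f` of an operator on multiplicity spaces. -/
def postcompose (V : Type*) [AddCommGroup V] [Module ℂ V] (A : Operator L) :
    Module.End ℂ (V →ₗ[ℂ] StateSpace L) :=
  LinearMap.compRight ℂ A

/-- `σ` and `λ` agree on `L*/L`: each central element `e^{2πi μ}`, `μ ∈ L*` (which acts on `H_λ`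
by `e^{2πi(μ|λ)}`) that lies in `K` acts in the representation `ρ` by that same scalar. -/
def AgreeOnCenter (lam : dualLattice L) : Prop :=
  ∀ (mu : dualLattice L) (h : K), IsExpOf ε h.1 (ofReal L (mu : ChargeSpace c)) →
    ρ h = Complex.exp (2 * Real.pi * Complex.I *
      ((inner ℝ (mu : ChargeSpace c) (lam : ChargeSpace c) : ℝ) : ℂ)) • LinearMap.id

end Projection

end Lattice

end LatticeOrbifold

end

/-! Energy and charge class modulo `L` are conserved by all zero modes. For a root `a` acting on
charge `γ`, the zero mode of `Y(a, z)` uses the oscillator mode `-1 - (a|γ)`, and half the square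
charge changes by the opposite amount `(a|γ) + 1` (`vertexMode_zero_mem`). Since `L` is discrete and
the form positive definite, the joint spaces of energy and class have finite bases. Operator
exponentials are therefore families of matrix exponentials (`isBasisExp_blockExp`), and `G` acts
block by block.

The analytic point is convergence, because `ζQ + α - τβ` is not Hermitian and its exponential is
unbounded. The zero modes grow at most like the square root of the energy
(`toOperator_mem_energyBounded`). Hence on energy `E` the diagonal entries of `e^{2πi x}` are at
most `exp √(K(E+1))`, which `|q|^E` beats (`hasSum_latticeCharacter`). For a root the growth bound
is an `su(2)` argument. The vertex operators of `a` and `-a` are adjoint on Fock space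
(`fockForm_bosonExp`), and their relevant commutator is a number (`bosonExp_commutator`). So the
norm of one raising step is controlled by that of the next, and a string of such steps stops because
oscillator numbers are nonnegative (`fockNormSq_bosonExp_le`).

The rest is algebra. For `h = e^{2πi α}` in `Γ_β` the exponentials of `α`, `β`, `Q` and `L₀`
commute, so `h` times the twisted operator is a scalar times `q^{L₀ - c/24} e^{2πi(ζQ + α - τβ)}`
(`mul_untwistedOperator`, `twistedCharacterOperator_eq`). In each finite block, averaging over the
finite group gives the traces on `Hom(V, ·)` and on the image of `P_σ` (`traceOn_equivariantMaps`,
`traceOn_map_isotypicProjection`), and these are summed over the energies. A central `e^{2πi μ}` is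
a scalar on `H_λ` and, by Schur, a scalar in `ρ`; a nonzero vector in the image of `P_σ` forces the
two to agree (`agreeOnCenter`). For the theta functions, conjugation by `G` preserves each finite
trace, and for a Cartan element the diagonal sum factors into a lattice sum and the oscillator
product (`latticeCharacter_cartan`). -/

noncomputable section

namespace LatticeOrbifold

/-! ### Vertex operators on Fock space: commutators with the oscillators. -/

section Fock

open MvPolynomial

variable {c : ℕ}

/-- The creation mode `α_{-(l+1)} = ∑ i, α_i a^i_{-(l+1)}`, as an element of the Fock space. -/
def creationMode (a : ChargeSpace c) (l : ℕ) : Fock c :=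
  ∑ i, C (a i : ℂ) * X (i, l)

/-- The coefficients of `exp (∑ α_{-n} z^n / n)`, extended by zero to negative degrees. -/
def schurInt (a : ChargeSpace c) (j : ℤ) : Fock c :=
  if 0 ≤ j then creationSchur a j.toNat else 0

/-- The oscillator number derivation. -/
def oscNumber (c : ℕ) : Derivation ℂ (Fock c) (Fock c) :=
  mkDerivation ℂ fun x : Fin c × ℕ => C ((x.2 : ℂ) + 1) * (X x : Fock c)

theorem schurInt_of_neg (a : ChargeSpace c) {j : ℤ} (hj : j < 0) : schurInt a j = 0 := by
  simp [schurInt, not_le.2 hj]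

theorem schurInt_natCast (a : ChargeSpace c) (n : ℕ) : schurInt a n = creationSchur a n := by
  simp [schurInt]

theorem schurInt_zero (a : ChargeSpace c) : schurInt a 0 = 1 := by
  simp [schurInt, creationSchur]

theorem creationSchur_succ (a : ChargeSpace c) (n : ℕ) :
    C ((n : ℂ) + 1) * creationSchur a (n + 1)
      = ∑ l ∈ Finset.range (n + 1), creationMode a l * creationSchur a (n - l) := by
  have h : (C ((n : ℂ) + 1) : Fock c) * C (1 / ((n : ℂ) + 1)) = 1 := by
    rw [← C_mul, mul_one_div_cancel (Nat.cast_add_one_ne_zero n), C_1]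
  rw [creationSchur, ← mul_assoc, h, one_mul, ← Fin.sum_univ_eq_sum_range
    (fun l => creationMode a l * creationSchur a (n - l))]
  rfl

/-- Apply `z d/dz` to the exponential. Terms with `l ≥ j` vanish under the extension by zero, so any
range `N ≥ j` will do; this lets recursions in different degrees be written over one range. -/
theorem schurInt_recursion (a : ChargeSpace c) (j : ℤ) (N : ℕ) (hN : j ≤ N) :
    C (j : ℂ) * schurInt a j
      = ∑ l ∈ Finset.range N, creationMode a l * schurInt a (j - 1 - l) := by
  rcases lt_trichotomy j 0 with hj | rfl | hj
  · rw [schurInt_of_neg a hj, mul_zero, Finset.sum_eq_zero]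
    intro l _
    rw [schurInt_of_neg a (by omega), mul_zero]
  · rw [Int.cast_zero, C_0, zero_mul, Finset.sum_eq_zero]
    intro l _
    rw [schurInt_of_neg a (by omega), mul_zero]
  · obtain ⟨n, rfl⟩ : ∃ n : ℕ, j = (n + 1 : ℕ) := ⟨(j - 1).toNat, by omega⟩
    have h := creationSchur_succ a n
    rw [schurInt_natCast, Int.cast_natCast, Nat.cast_succ, h]
    have hsub : Finset.range (n + 1) ⊆ Finset.range N := by
      intro l hl; simp only [Finset.mem_range] at *; omega
    rw [← Finset.sum_subset hsub]
    · refine Finset.sum_congr rfl fun l hl => ?_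
      have : ((n + 1 : ℕ) : ℤ) - 1 - l = ((n - l : ℕ) : ℤ) := by
        simp only [Finset.mem_range] at hl; omega
      rw [this, schurInt_natCast]
    · intro l _ hl
      rw [schurInt_of_neg a (by simp only [Finset.mem_range] at hl; omega), mul_zero]

theorem pderiv_creationMode (a : ChargeSpace c) (i : Fin c) (k l : ℕ) :
    pderiv (i, k) (creationMode a l) = if l = k then C (a i : ℂ) else 0 := by
  classical
  simp only [creationMode, map_sum, pderiv_C_mul, pderiv_X, Pi.single_apply, Prod.mk.injEq]
  by_cases h : l = k <;> simp [h]

theorem oscNumber_X (x : Fin c × ℕ) :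
    oscNumber c (X x) = C ((x.2 : ℂ) + 1) * X x := by
  simp [oscNumber, mkDerivation_X]

theorem oscNumber_C (t : ℂ) : oscNumber c (C t) = 0 := by
  simp [oscNumber]

theorem oscNumber_C_mul (t : ℂ) (p : Fock c) : oscNumber c (C t * p) = C t * oscNumber c p := by
  rw [← smul_eq_C_mul, Derivation.map_smul, smul_eq_C_mul]

theorem oscNumber_X_mul (x : Fin c × ℕ) (p : Fock c) :
    oscNumber c (X x * p) = X x * oscNumber c p + C ((x.2 : ℂ) + 1) * (X x * p) := by
  rw [Derivation.leibniz, oscNumber_X, smul_eq_mul, smul_eq_mul]; ring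

theorem pderiv_X_mul (y x : Fin c × ℕ) (p : Fock c) :
    pderiv y (X x * p) = X x * pderiv y p + C (if x = y then 1 else 0) * p := by
  rw [Derivation.leibniz, smul_eq_mul, smul_eq_mul, mul_comm p]
  by_cases h : x = y
  · subst h; simp
  · simp [h, pderiv_X_of_ne h]

theorem oscNumber_creationMode (a : ChargeSpace c) (l : ℕ) :
    oscNumber c (creationMode a l) = C ((l : ℂ) + 1) * creationMode a l := by
  simp only [creationMode, map_sum, Derivation.leibniz, oscNumber_X, oscNumber_C, smul_eq_mul,
    mul_zero, add_zero, Finset.mul_sum]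
  exact Finset.sum_congr rfl fun i _ => by ring

theorem C_ne_zero_cancel {t : ℂ} (ht : t ≠ 0) {p q : Fock c} (h : C t * p = C t * q) : p = q :=
  mul_left_cancel₀ (by simpa using ht) h

/-- Differentiating `exp (∑ α_{-n} z^n / n)` in the variable `a^i_{-(k+1)}` multiplies it by `a_i
z^{k+1} / (k+1)`; compare coefficients of `z^j`. As the coefficients are given by a recursion, the
proof is a strong induction on the degree. -/
theorem pderiv_schurInt (a : ChargeSpace c) (i : Fin c) (k : ℕ) (j : ℤ) :
    C ((k : ℂ) + 1) * pderiv (i, k) (schurInt a j) = C (a i : ℂ) * schurInt a (j - k - 1) := by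
  rcases lt_or_ge j 0 with hj | hj
  · rw [schurInt_of_neg a hj, schurInt_of_neg a (by omega)]; simp
  obtain ⟨n, rfl⟩ := Int.eq_ofNat_of_zero_le hj
  clear hj
  induction n using Nat.strong_induction_on with
  | _ n ih =>
  rcases Nat.eq_zero_or_pos n with rfl | hn
  · rw [Nat.cast_zero, schurInt_zero, schurInt_of_neg a (by omega)]; simp
  -- The recursion computes `n S_n`, so the identity is proved after multiplication by `n`.
  refine C_ne_zero_cancel (t := ((n : ℤ) : ℂ)) (by simpa using hn.ne') ?_
  have ih' : ∀ l : ℕ, C ((k : ℂ) + 1) * pderiv (i, k) (schurInt a ((n : ℤ) - 1 - l))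
      = C (a i : ℂ) * schurInt a ((n : ℤ) - 1 - l - k - 1) := by
    intro l
    rcases lt_or_ge ((n : ℤ) - 1 - l) 0 with h | h
    · rw [schurInt_of_neg a h, schurInt_of_neg a (by omega)]; simp
    · obtain ⟨m, hm⟩ := Int.eq_ofNat_of_zero_le h
      rw [hm]
      exact ih m (by omega)
  have h1 : C ((n : ℤ) : ℂ) * pderiv (i, k) (schurInt a n)
      = ∑ l ∈ Finset.range (n + k + 1), creationMode a l * pderiv (i, k) (schurInt a (n - 1 - l))
        + schurInt a (n - k - 1) * C (a i : ℂ) := by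
    rw [← pderiv_C_mul, schurInt_recursion a n (n + k + 1) (by push_cast; omega), map_sum]
    have : ∀ l : ℕ, pderiv (i, k) (creationMode a l * schurInt a (n - 1 - l))
        = creationMode a l * pderiv (i, k) (schurInt a (n - 1 - l))
          + schurInt a (n - 1 - l) * (if l = k then C (a i : ℂ) else 0) := fun l => by
      rw [Derivation.leibniz, pderiv_creationMode]; rfl
    rw [Finset.sum_congr rfl fun l _ => this l, Finset.sum_add_distrib]
    congr 1
    rw [Finset.sum_eq_single k]
    · rw [if_pos rfl, show (n : ℤ) - 1 - k = n - k - 1 by ring]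
    · intro l _ hl; rw [if_neg hl, mul_zero]
    · intro h; simp at h
  have h2 := schurInt_recursion a (n - k - 1) (n + k + 1) (by push_cast; omega)
  have h3 : C ((k : ℂ) + 1) * ∑ l ∈ Finset.range (n + k + 1),
        creationMode a l * pderiv (i, k) (schurInt a (n - 1 - l))
      = C (a i : ℂ) * ∑ l ∈ Finset.range (n + k + 1),
        creationMode a l * schurInt a (n - k - 1 - 1 - l) := by
    rw [Finset.mul_sum, Finset.mul_sum]
    refine Finset.sum_congr rfl fun l _ => ?_
    rw [mul_left_comm, ih' l, show (n : ℤ) - 1 - l - k - 1 = n - k - 1 - 1 - l by ring,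
      mul_left_comm]
  -- The term `l = k`, where the derivative hits the creation mode, supplies the `k + 1` that
  -- separates `n` from the degree `n - k - 1` of the right-hand side.
  have h4 : (C ((n : ℤ) : ℂ) : Fock c) = C (((n : ℤ) - k - 1 : ℤ) : ℂ) + C ((k : ℂ) + 1) := by
    rw [← C_add]; push_cast; ring_nf
  rw [← h2] at h3
  generalize C (((n : ℤ) - k - 1 : ℤ) : ℂ) = t at *
  generalize C ((n : ℤ) : ℂ) = u at *
  generalize C ((k : ℂ) + 1) = v at *
  generalize C (a i : ℂ) = w at *
  rw [mul_left_comm, h1, mul_add, h3, h4]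
  ring

theorem oscNumber_schurInt (a : ChargeSpace c) (j : ℤ) :
    oscNumber c (schurInt a j) = C (j : ℂ) * schurInt a j := by
  rcases lt_or_ge j 0 with hj | hj
  · rw [schurInt_of_neg a hj]; simp
  obtain ⟨n, rfl⟩ := Int.eq_ofNat_of_zero_le hj
  clear hj
  induction n using Nat.strong_induction_on with
  | _ n ih =>
  rcases Nat.eq_zero_or_pos n with rfl | hn
  · rw [Nat.cast_zero, schurInt_zero]; simp
  refine C_ne_zero_cancel (t := ((n : ℤ) : ℂ)) (by simpa using hn.ne') ?_
  rw [← oscNumber_C_mul, schurInt_recursion a n n le_rfl, map_sum, Finset.mul_sum]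
  refine Finset.sum_congr rfl fun l hl => ?_
  obtain ⟨m, hm⟩ : ∃ m : ℕ, (n : ℤ) - 1 - l = m :=
    ⟨n - 1 - l, by simp only [Finset.mem_range] at hl; omega⟩
  have hC : (C ((n : ℤ) : ℂ) : Fock c) = C ((m : ℤ) : ℂ) + C ((l : ℂ) + 1) := by
    rw [← C_add, show (n : ℤ) = m + (l + 1) by omega]; push_cast; rfl
  rw [Derivation.leibniz, hm, ih m (by omega), oscNumber_creationMode, hC, smul_eq_mul,
    smul_eq_mul]
  generalize C ((m : ℤ) : ℂ) = t
  generalize C ((l : ℂ) + 1) = u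
  ring

/-- The functional `∑ k, f_k z^{-k} ↦ ∑ k, S_{m+k} f_k`. -/
def schurPairing (a : ChargeSpace c) (m : ℤ) : Polynomial (Fock c) →ₗ[ℂ] Fock c :=
  Polynomial.lsum fun k : ℕ => LinearMap.mulLeft ℂ (schurInt a (m + k))

theorem schurPairing_monomial (a : ChargeSpace c) (m : ℤ) (k : ℕ) (f : Fock c) :
    schurPairing a m (Polynomial.monomial k f) = schurInt a (m + k) * f := by
  simp [schurPairing, Polynomial.lsum_apply, Polynomial.sum_monomial_index]

theorem schurPairing_C_mul_X_pow_mul (a : ChargeSpace c) (m : ℤ) (r : ℕ) (f : Fock c)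
    (P : Polynomial (Fock c)) :
    schurPairing a m (Polynomial.C f * Polynomial.X ^ r * P) = f * schurPairing a (m + r) P := by
  induction P using Polynomial.induction_on' with
  | add p q hp hq => rw [mul_add, map_add, map_add, hp, hq, mul_add]
  | monomial n p =>
    rw [Polynomial.C_mul_X_pow_eq_monomial, Polynomial.monomial_mul_monomial,
      schurPairing_monomial, schurPairing_monomial]
    rw [show m + ((r + n : ℕ) : ℤ) = m + r + n by push_cast; ring]
    ring

theorem bosonExp_eq (a : ChargeSpace c) (m : ℤ) (p : Fock c) :
    bosonExp a m p = schurPairing a m (annihilationExp a p) := rfl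

theorem bosonExp_one (a : ChargeSpace c) (m : ℤ) : bosonExp a m 1 = schurInt a m := by
  rw [bosonExp_eq, map_one, ← Polynomial.C_1, ← Polynomial.monomial_zero_left,
    schurPairing_monomial]
  simp

/-- The annihilation exponential translates `X x` by `-a_i z^{-n}`, `n = x.2 + 1`, and the power
`z^{-n}` raises the mode by `n`. Together with `bosonExp_one` this determines every mode, so
identities can be proved by induction from the vacuum. -/
theorem bosonExp_X_mul (a : ChargeSpace c) (m : ℤ) (x : Fin c × ℕ) (p : Fock c) :
    bosonExp a m (X x * p)
      = X x * bosonExp a m p - C (a x.1 : ℂ) * bosonExp a (m + x.2 + 1) p := by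
  rw [bosonExp_eq, map_mul]
  have : annihilationExp a (X x) = Polynomial.C (X x) - Polynomial.C (C (a x.1 : ℂ))
      * Polynomial.X ^ (x.2 + 1) := by simp [annihilationExp]
  rw [this, sub_mul, map_sub, schurPairing_C_mul_X_pow_mul]
  have h := schurPairing_C_mul_X_pow_mul a m 0 (X x) (annihilationExp a p)
  simp only [pow_zero, mul_one, Nat.cast_zero, add_zero] at h
  rw [h, bosonExp_eq, bosonExp_eq]
  push_cast
  rw [add_assoc]

theorem bosonExp_C_mul (a : ChargeSpace c) (m : ℤ) (t : ℂ) (p : Fock c) :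
    bosonExp a m (C t * p) = C t * bosonExp a m p := by
  rw [← smul_eq_C_mul, map_smul, smul_eq_C_mul]

theorem bosonExp_creationMode_mul (a b : ChargeSpace c) (m : ℤ) (l : ℕ) (p : Fock c) :
    bosonExp a m (creationMode b l * p) = creationMode b l * bosonExp a m p
      - C (((∑ i, b i * a i : ℝ)) : ℂ) * bosonExp a (m + l + 1) p := by
  simp only [creationMode, Finset.sum_mul, map_sum, mul_assoc, bosonExp_C_mul, bosonExp_X_mul,
    mul_sub, Finset.sum_sub_distrib]
  congr 1
  rw [Complex.ofReal_sum, map_sum, Finset.sum_mul]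
  refine Finset.sum_congr rfl fun i _ => ?_
  rw [Complex.ofReal_mul, C_mul]; ring

/-- Linear families that are determined by their value on the vacuum. -/
theorem eq_zero_of_vacuum {ι : Type*} (P : ι → Prop) (D : ι → Fock c →ₗ[ℂ] Fock c)
    (h1 : ∀ m, P m → D m 1 = 0)
    (hX : ∀ m, P m → ∀ (x : Fin c × ℕ) (p : Fock c), (∀ n, P n → D n p = 0) → D m (X x * p) = 0)
    (m : ι) (hm : P m) (p : Fock c) : D m p = 0 := by
  induction p using MvPolynomial.induction_on generalizing m with
  | C t => rw [← mul_one (C t), ← smul_eq_C_mul, map_smul, h1 m hm, smul_zero]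
  | add p q hp hq => rw [map_add, hp m hm, hq m hm, add_zero]
  | mul_X p x hp => rw [mul_comm]; exact hX m hm x p fun n hn => hp n hn

/-- Commutator with an annihilation mode. The defect is a family in `m` because multiplying the
argument by a variable shifts the mode: the induction from the vacuum runs over all modes at once.
-/
theorem pderiv_bosonExp (a : ChargeSpace c) (i : Fin c) (k : ℕ) (m : ℤ) (p : Fock c) :
    C ((k : ℂ) + 1) * pderiv (i, k) (bosonExp a m p)
      = bosonExp a m (C ((k : ℂ) + 1) * pderiv (i, k) p)
        + C (a i : ℂ) * bosonExp a (m - k - 1) p := by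
  classical
  let D : ℤ → Fock c →ₗ[ℂ] Fock c := fun m =>
    LinearMap.mulLeft ℂ (C ((k : ℂ) + 1)) ∘ₗ (pderiv (i, k)).toLinearMap ∘ₗ bosonExp a m
    - bosonExp a m ∘ₗ LinearMap.mulLeft ℂ (C ((k : ℂ) + 1)) ∘ₗ (pderiv (i, k)).toLinearMap
    - LinearMap.mulLeft ℂ (C (a i : ℂ)) ∘ₗ bosonExp a (m - k - 1)
  have hD : ∀ m p, D m p = C ((k : ℂ) + 1) * pderiv (i, k) (bosonExp a m p)
      - bosonExp a m (C ((k : ℂ) + 1) * pderiv (i, k) p)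
        - C (a i : ℂ) * bosonExp a (m - k - 1) p := fun _ _ => rfl
  have key : D m p = 0 := by
    refine eq_zero_of_vacuum (fun _ => True) D ?_ ?_ m trivial p
    · intro m _
      rw [hD, bosonExp_one, bosonExp_one, pderiv_schurInt]
      simp
    · intro m _ x p ih
      have e1 := ih m trivial
      have e2 := ih (m + x.2 + 1) trivial
      rw [hD] at e1 e2 ⊢
      rw [show m + (x.2 : ℤ) + 1 - k - 1 = m - k - 1 + x.2 + 1 by ring] at e2
      simp only [bosonExp_C_mul] at e1 e2 ⊢
      rw [bosonExp_X_mul, bosonExp_X_mul, pderiv_X_mul, map_sub, map_add (bosonExp a m), pderiv_X_mul,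
        pderiv_C_mul, bosonExp_X_mul, bosonExp_C_mul]
      linear_combination X x * e1 - C (a x.1 : ℂ) * e2
  rw [hD] at key
  linear_combination key

theorem oscNumber_bosonExp (a : ChargeSpace c) (m : ℤ) (p : Fock c) :
    oscNumber c (bosonExp a m p) = bosonExp a m (oscNumber c p) + C (m : ℂ) * bosonExp a m p := by
  let D : ℤ → Fock c →ₗ[ℂ] Fock c := fun m =>
    (oscNumber c).toLinearMap ∘ₗ bosonExp a m - bosonExp a m ∘ₗ (oscNumber c).toLinearMap
    - LinearMap.mulLeft ℂ (C (m : ℂ)) ∘ₗ bosonExp a m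
  have hD : ∀ m p, D m p = oscNumber c (bosonExp a m p) - bosonExp a m (oscNumber c p)
      - C (m : ℂ) * bosonExp a m p := fun _ _ => rfl
  have key : D m p = 0 := by
    refine eq_zero_of_vacuum (fun _ => True) D ?_ ?_ m trivial p
    · intro m _
      rw [hD, bosonExp_one, oscNumber_schurInt]
      simp
    · intro m _ x p ih
      have e1 := ih m trivial
      have e2 := ih (m + x.2 + 1) trivial
      rw [hD] at e1 e2 ⊢
      rw [bosonExp_X_mul, oscNumber_X_mul, map_sub, map_add (bosonExp a m), oscNumber_X_mul,
        oscNumber_C_mul, bosonExp_X_mul, bosonExp_C_mul, bosonExp_X_mul]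
      have e4 : (C ((m + x.2 + 1 : ℤ) : ℂ) : Fock c) = C (m : ℂ) + C ((x.2 : ℂ) + 1) := by
        rw [← C_add]; push_cast; ring_nf
      rw [e4] at e2
      linear_combination X x * e1 - C (a x.1 : ℂ) * e2
  rw [hD] at key
  linear_combination key

end Fock

/-! ### The contravariant Hermitian form and adjoints of vertex operators. -/

section FockForm

open MvPolynomial

variable {c : ℕ}

/-- The oscillator number of a monomial. -/
def oscDegree (m : Fin c × ℕ →₀ ℕ) : ℕ := Finsupp.weight (fun x : Fin c × ℕ => x.2 + 1) m

theorem oscDegree_add_single (m : Fin c × ℕ →₀ ℕ) (x : Fin c × ℕ) :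
    oscDegree (m + Finsupp.single x 1) = oscDegree m + (x.2 + 1) := by
  simp [oscDegree, map_add, Finsupp.weight_apply]

theorem coeff_oscNumber (p : Fock c) (m : Fin c × ℕ →₀ ℕ) :
    coeff m (oscNumber c p) = (oscDegree m : ℂ) * coeff m p := by
  classical
  induction p using MvPolynomial.induction_on generalizing m with
  | C t =>
    rw [oscNumber_C, coeff_zero, coeff_C]
    split_ifs with h
    · subst h; simp [oscDegree]
    · simp
  | add p q hp hq => rw [map_add, coeff_add, hp, hq, coeff_add, mul_add]
  | mul_X p x hp =>
    rw [mul_comm, oscNumber_X_mul, coeff_add, coeff_C_mul, coeff_X_mul', coeff_X_mul']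
    split_ifs with h
    · have h1 : m - Finsupp.single x 1 + Finsupp.single x 1 = m :=
        tsub_add_cancel_of_le (by
          rw [Finsupp.single_le_iff]; exact Nat.one_le_iff_ne_zero.2 (Finsupp.mem_support_iff.1 h))
      have h2 := oscDegree_add_single (m - Finsupp.single x 1) x
      rw [h1] at h2
      rw [hp, h2]; push_cast; ring
    · simp

theorem coeff_eq_zero_of_oscNumber {p : Fock c} {d : ℂ} (hp : oscNumber c p = C d * p)
    {m : Fin c × ℕ →₀ ℕ} (hm : (oscDegree m : ℂ) ≠ d) : coeff m p = 0 := by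
  have h := congrArg (coeff m) hp
  rw [coeff_oscNumber, coeff_C_mul] at h
  by_contra h0
  exact hm (mul_right_cancel₀ h0 h)

theorem eq_zero_of_oscNumber_neg {p : Fock c} {d : ℤ} (hp : oscNumber c p = C (d : ℂ) * p)
    (hd : d < 0) : p = 0 := by
  ext m
  rw [coeff_zero]
  refine coeff_eq_zero_of_oscNumber hp fun h => ?_
  have : (oscDegree m : ℤ) = d := by exact_mod_cast h
  omega

/-- Only multiples of the vacuum are killed by all annihilation modes. This allows identities to be
proved by induction on the degree, from constant terms and derivatives. -/
theorem eq_zero_of_pderiv {p : Fock c} (h0 : coeff 0 p = 0) (h : ∀ x, pderiv x p = 0) :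
    p = 0 := by
  ext m
  rw [coeff_zero]
  by_cases hm : m = 0
  · rw [hm, h0]
  · obtain ⟨x, hx⟩ := Finsupp.ne_iff.1 hm
    have h1 : m - Finsupp.single x 1 + Finsupp.single x 1 = m :=
      tsub_add_cancel_of_le (by
        rw [Finsupp.single_le_iff]; exact Nat.one_le_iff_ne_zero.2 hx)
    have h2 := congrArg (coeff (m - Finsupp.single x 1)) (h x)
    rw [coeff_pderiv, h1, coeff_zero] at h2
    refine (mul_eq_zero.1 h2).resolve_right ?_
    exact Nat.cast_add_one_ne_zero _

/-- The square norm of a monomial in the contravariant Hermitian form on the Fock space. -/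
def monomialNormSq (m : Fin c × ℕ →₀ ℕ) : ℝ :=
  m.prod fun x n => (n.factorial : ℝ) * ((x.2 : ℝ) + 1) ^ n

theorem monomialNormSq_pos (m : Fin c × ℕ →₀ ℕ) : 0 < monomialNormSq m :=
  Finset.prod_pos fun x _ => by positivity

theorem monomialNormSq_zero : monomialNormSq (0 : Fin c × ℕ →₀ ℕ) = 1 := by
  simp [monomialNormSq]

theorem monomialNormSq_add_single (m : Fin c × ℕ →₀ ℕ) (x : Fin c × ℕ) :
    monomialNormSq (m + Finsupp.single x 1)
      = monomialNormSq m * (((m x : ℝ) + 1) * ((x.2 : ℝ) + 1)) := by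
  classical
  have key : ∀ m' : Fin c × ℕ →₀ ℕ, ∀ s : Finset (Fin c × ℕ), m'.support ⊆ s →
      monomialNormSq m' = ∏ y ∈ s, ((m' y).factorial : ℝ) * ((y.2 : ℝ) + 1) ^ m' y :=
    fun m' s hs => Finsupp.prod_of_support_subset _ hs _ (fun _ _ => by simp)
  have hs : (m + Finsupp.single x 1).support ⊆ insert x m.support := by
    intro y hy
    by_cases h : y = x
    · simp [h]
    · simp only [Finsupp.mem_support_iff, Finsupp.add_apply, Finsupp.single_apply,
        if_neg (Ne.symm h), add_zero] at hy
      simp [hy]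
  rw [key _ _ hs, key m (insert x m.support) (Finset.subset_insert _ _),
    ← Finset.mul_prod_erase _ _ (Finset.mem_insert_self x _),
    ← Finset.mul_prod_erase (insert x m.support) _ (Finset.mem_insert_self x _)]
  have h1 : ∏ y ∈ (insert x m.support).erase x, (((m + Finsupp.single x 1 : Fin c × ℕ →₀ ℕ) y).factorial : ℝ)
        * ((y.2 : ℝ) + 1) ^ (m + Finsupp.single x 1 : Fin c × ℕ →₀ ℕ) y
      = ∏ y ∈ (insert x m.support).erase x, ((m y).factorial : ℝ) * ((y.2 : ℝ) + 1) ^ m y := by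
    refine Finset.prod_congr rfl fun y hy => ?_
    simp [(Finset.ne_of_mem_erase hy).symm]
  rw [h1]
  simp only [Finsupp.add_apply, Finsupp.single_eq_same, Nat.factorial_succ, pow_succ]
  push_cast
  ring

/-- The contravariant Hermitian form on the Fock space. -/
def fockForm (p q : Fock c) : ℂ :=
  ∑ m ∈ p.support, (starRingEnd ℂ) (coeff m p) * (monomialNormSq m : ℂ) * coeff m q

theorem fockForm_eq_sum {p : Fock c} {s : Finset (Fin c × ℕ →₀ ℕ)} (hs : p.support ⊆ s)
    (q : Fock c) : fockForm p q
      = ∑ m ∈ s, (starRingEnd ℂ) (coeff m p) * (monomialNormSq m : ℂ) * coeff m q :=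
  Finset.sum_subset hs fun m _ hm => by rw [notMem_support_iff.1 hm]; simp

theorem fockForm_add_left (p p' q : Fock c) :
    fockForm (p + p') q = fockForm p q + fockForm p' q := by
  classical
  rw [fockForm_eq_sum (support_add (p := p) (q := p')) q,
    fockForm_eq_sum (p := p) Finset.subset_union_left q,
    fockForm_eq_sum (p := p') Finset.subset_union_right q, ← Finset.sum_add_distrib]
  exact Finset.sum_congr rfl fun m _ => by rw [coeff_add, map_add]; ring

theorem fockForm_add_right (p q q' : Fock c) :
    fockForm p (q + q') = fockForm p q + fockForm p q' := by
  simp only [fockForm, coeff_add, mul_add, Finset.sum_add_distrib]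

theorem fockForm_C_mul_left (t : ℂ) (p q : Fock c) :
    fockForm (C t * p) q = (starRingEnd ℂ) t * fockForm p q := by
  have h : (C t * p).support ⊆ p.support := by
    rw [← smul_eq_C_mul]; exact support_smul
  rw [fockForm_eq_sum h, fockForm, Finset.mul_sum]
  exact Finset.sum_congr rfl fun m _ => by rw [coeff_C_mul, map_mul]; ring

theorem fockForm_C_mul_right (t : ℂ) (p q : Fock c) :
    fockForm p (C t * q) = t * fockForm p q := by
  rw [fockForm, fockForm, Finset.mul_sum]
  exact Finset.sum_congr rfl fun m _ => by rw [coeff_C_mul]; ring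

theorem fockForm_sub_left (p p' q : Fock c) :
    fockForm (p - p') q = fockForm p q - fockForm p' q := by
  have h : p - p' = p + C (-1) * p' := by rw [C_neg, C_1]; ring
  rw [h, fockForm_add_left, fockForm_C_mul_left]; simp; ring

theorem fockForm_sub_right (p q q' : Fock c) :
    fockForm p (q - q') = fockForm p q - fockForm p q' := by
  simp only [fockForm, coeff_sub, mul_sub, Finset.sum_sub_distrib]

theorem fockForm_conj (p q : Fock c) : (starRingEnd ℂ) (fockForm p q) = fockForm q p := by
  classical
  rw [fockForm_eq_sum (p := p) Finset.subset_union_left q,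
    fockForm_eq_sum (p := q) (Finset.subset_union_right (s₁ := p.support)) p, map_sum]
  refine Finset.sum_congr rfl fun m _ => ?_
  simp only [map_mul, Complex.conj_conj, Complex.conj_ofReal]
  ring

/-- The square norm in the contravariant form. -/
def fockNormSq (p : Fock c) : ℝ := ∑ m ∈ p.support, monomialNormSq m * ‖coeff m p‖ ^ 2

theorem fockForm_self (p : Fock c) : fockForm p p = (fockNormSq p : ℂ) := by
  rw [fockForm, fockNormSq, Complex.ofReal_sum]
  refine Finset.sum_congr rfl fun m _ => ?_
  push_cast
  rw [← Complex.conj_mul']; ring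

theorem fockNormSq_nonneg (p : Fock c) : 0 ≤ fockNormSq p :=
  Finset.sum_nonneg fun m _ => mul_nonneg (monomialNormSq_pos m).le (sq_nonneg _)

/-- The weights `n! (k+1)^n` in `monomialNormSq` are chosen for this: a creation mode becomes
adjoint to the annihilation mode `(k+1) ∂`. -/
theorem fockForm_X_mul_left (x : Fin c × ℕ) (p q : Fock c) :
    fockForm (X x * p) q = fockForm p (C ((x.2 : ℂ) + 1) * pderiv x q) := by
  rw [fockForm, support_X_mul, Finset.sum_map, fockForm]
  refine Finset.sum_congr rfl fun m _ => ?_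
  rw [addLeftEmbedding_apply, coeff_X_mul, coeff_C_mul, coeff_pderiv, add_comm,
    monomialNormSq_add_single]
  push_cast
  ring

theorem coeff_zero_X_mul' (x : Fin c × ℕ) (p : Fock c) : coeff 0 (X x * p) = 0 := by
  classical
  rw [coeff_X_mul']; simp

theorem coeff_zero_schurInt (a : ChargeSpace c) (j : ℤ) :
    coeff 0 (schurInt a j) = if j = 0 then 1 else 0 := by
  split_ifs with h
  · rw [h, schurInt_zero, coeff_zero_one]
  · refine coeff_eq_zero_of_oscNumber (oscNumber_schurInt a j) ?_
    simp only [oscDegree, map_zero, Nat.cast_zero]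
    exact_mod_cast Ne.symm h

theorem neg_apply_ofReal (a : ChargeSpace c) (i : Fin c) : (((-a) i : ℝ) : ℂ) = -((a i : ℝ) : ℂ) := by
  simp

/-- The vacuum case of `fockForm_bosonExp`, with `bosonExp a m 1` on the left. Multiplying `q` by a
variable amounts on either side to a shift of the mode and a factor `a_i`. -/
theorem fockForm_schurInt (a : ChargeSpace c) (m : ℤ) (q : Fock c) :
    fockForm (schurInt a m) q = coeff 0 (bosonExp (-a) (-m) q) := by
  induction q using MvPolynomial.induction_on generalizing m with
  | C t =>
    have h : fockForm (schurInt a m) 1 = if m = 0 then 1 else 0 := by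
      rw [← fockForm_conj, fockForm, support_one, Finset.sum_singleton, coeff_zero_schurInt,
        monomialNormSq_zero]
      split_ifs <;> simp
    rw [← mul_one (C t), fockForm_C_mul_right, bosonExp_C_mul, coeff_C_mul, bosonExp_one,
      coeff_zero_schurInt, h]
    simp only [neg_eq_zero]
  | add p q hp hq => rw [fockForm_add_right, hp, hq, map_add, coeff_add]
  | mul_X q x hq =>
    have h := fockForm_X_mul_left x q (schurInt a m)
    have h' : C ((x.2 : ℂ) + 1) * pderiv x (schurInt a m)
        = C (a x.1 : ℂ) * schurInt a (m - x.2 - 1) := pderiv_schurInt a x.1 x.2 m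
    replace h := congrArg (starRingEnd ℂ) h
    rw [h', fockForm_conj, fockForm_conj, fockForm_C_mul_left, Complex.conj_ofReal, hq] at h
    rw [mul_comm q, h, bosonExp_X_mul, coeff_sub, coeff_zero_X_mul', coeff_C_mul,
      neg_apply_ofReal, show -(m - (x.2 : ℤ) - 1) = -m + x.2 + 1 by ring]
    ring

/-- Both sides obey the same recursion in `p`: a creation mode crosses the form as an annihilation
mode, and `bosonExp_X_mul` for `a` mirrors `pderiv_bosonExp` for `-a`. -/
theorem fockForm_bosonExp (a : ChargeSpace c) (m : ℤ) (p q : Fock c) :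
    fockForm (bosonExp a m p) q = fockForm p (bosonExp (-a) (-m) q) := by
  induction p using MvPolynomial.induction_on generalizing m q with
  | C t =>
    have h : fockForm (1 : Fock c) (bosonExp (-a) (-m) q) = coeff 0 (bosonExp (-a) (-m) q) := by
      rw [fockForm, support_one, Finset.sum_singleton, monomialNormSq_zero]; simp
    rw [← mul_one (C t), bosonExp_C_mul, fockForm_C_mul_left, fockForm_C_mul_left, bosonExp_one,
      fockForm_schurInt, h]
  | add p p' hp hp' => rw [map_add, fockForm_add_left, hp, hp', fockForm_add_left]
  | mul_X p x hp =>
    have h := pderiv_bosonExp (-a) x.1 x.2 (-m) q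
    rw [Prod.mk.eta] at h
    rw [mul_comm p, bosonExp_X_mul, fockForm_sub_left, fockForm_X_mul_left, fockForm_C_mul_left,
      hp, hp, fockForm_X_mul_left, h, fockForm_add_right, fockForm_C_mul_right, neg_apply_ofReal,
      Complex.conj_ofReal, show -(m + (x.2 : ℤ) + 1) = -m - x.2 - 1 by ring]
    ring

end FockForm

/-! ### The commutator of opposite roots and the resulting norm bound. -/

section Commutator

open MvPolynomial

variable {c : ℕ}

theorem oscNumber_bosonExp_schurInt (a b : ChargeSpace c) (m n : ℤ) :
    oscNumber c (bosonExp a m (schurInt b n))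
      = C ((m + n : ℤ) : ℂ) * bosonExp a m (schurInt b n) := by
  rw [oscNumber_bosonExp, oscNumber_schurInt, bosonExp_C_mul]
  push_cast
  rw [C_add]; ring

theorem coeff_zero_creationMode_mul (a : ChargeSpace c) (l : ℕ) (p : Fock c) :
    coeff 0 (creationMode a l * p) = 0 := by
  rw [creationMode, Finset.sum_mul, coeff_sum]
  refine Finset.sum_eq_zero fun i _ => ?_
  rw [mul_assoc, coeff_C_mul, coeff_zero_X_mul', mul_zero]

/-- The vacuum two-point function of opposite charges: contraction gives `(1 - w/z)^(a|-a) = (1 -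
w/z)^{-2} = ∑ (n+1) (w/z)^n`, since `|a|² = 2`. -/
theorem coeff_zero_bosonExp_schurInt (a : ChargeSpace c) (ha : ∑ i, a i * a i = 2) (n : ℤ) :
    coeff 0 (bosonExp a (-n) (schurInt (-a) n)) = if 0 ≤ n then (n : ℂ) + 1 else 0 := by
  rcases lt_or_ge n 0 with hn | hn
  · rw [schurInt_of_neg _ hn, map_zero, coeff_zero, if_neg (by omega)]
  obtain ⟨n, rfl⟩ := Int.eq_ofNat_of_zero_le hn
  rw [if_pos hn]
  clear hn
  induction n using Nat.strong_induction_on with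
  | _ n ih =>
  rcases Nat.eq_zero_or_pos n with rfl | hn
  · rw [Nat.cast_zero, schurInt_zero, bosonExp_one, coeff_zero_schurInt]; simp
  have h := congrArg (fun p => coeff 0 (bosonExp a (-(n : ℤ)) p))
    (schurInt_recursion (-a) n n le_rfl)
  have hab : ∑ i, (-a) i * a i = -2 := by rw [← ha, ← Finset.sum_neg_distrib]; simp
  have h2 : ∀ l ∈ Finset.range n, coeff 0 (bosonExp a (-(n : ℤ))
      (creationMode (-a) l * schurInt (-a) (n - 1 - l))) = 2 * ((n : ℂ) - l) := by
    intro l hl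
    obtain ⟨m, hm⟩ : ∃ m : ℕ, (n : ℤ) - 1 - l = m :=
      ⟨n - 1 - l, by simp only [Finset.mem_range] at hl; omega⟩
    have hm' : (m : ℂ) + 1 = (n : ℂ) - l := by
      have : (m : ℤ) + 1 = n - l := by omega
      exact_mod_cast congrArg (Int.cast : ℤ → ℂ) this
    rw [bosonExp_creationMode_mul, coeff_sub, coeff_zero_creationMode_mul, coeff_C_mul, hab, hm,
      show -(n : ℤ) + l + 1 = -m by omega, ih m (by omega)]
    push_cast
    rw [hm']; ring
  simp only [bosonExp_C_mul, coeff_C_mul, map_sum, coeff_sum] at h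
  rw [Finset.sum_congr rfl h2, ← Finset.mul_sum, Finset.sum_sub_distrib] at h
  have h3 : 2 * ∑ l ∈ Finset.range n, (l : ℂ) = n * (n - 1) := by
    clear * -
    induction n with
    | zero => simp
    | succ k ih => rw [Finset.sum_range_succ, mul_add, ih]; push_cast; ring
  have hn' : ((n : ℤ) : ℂ) ≠ 0 := by exact_mod_cast hn.ne'
  refine mul_left_cancel₀ hn' ?_
  rw [h, mul_sub, h3]
  simp only [Finset.sum_const, Finset.card_range, nsmul_eq_mul]
  push_cast; ring

/-- The degree `A + B` component of the commutator of the charged vertex operators of opposite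
roots: a constant in degree zero, and a creation mode in positive degree. -/
def commutatorTerm (a : ChargeSpace c) (A B : ℤ) : Fock c :=
  if A + B < 0 then 0 else if A + B = 0 then C (1 - (A : ℂ)) else creationMode a (A + B - 1).toNat

/-- The shifts by 2 come from `z^{α_0}`, evaluated after the other operator has moved the charge by
`a` or `-a`. The left side is homogeneous of degree `A + B`, hence zero in negative degree.
Otherwise constant terms are given by the two-point function and derivatives by induction on the
degree, and `eq_zero_of_pderiv` concludes. -/
theorem commutator_vacuum (a : ChargeSpace c) (ha : ∑ i, a i * a i = 2) (A B : ℤ) :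
    bosonExp a A (schurInt (-a) B) - bosonExp (-a) (B + 2) (schurInt a (A - 2))
      = commutatorTerm a A B := by
  have hosc : oscNumber c (bosonExp a A (schurInt (-a) B)
        - bosonExp (-a) (B + 2) (schurInt a (A - 2)))
      = C ((A + B : ℤ) : ℂ) * (bosonExp a A (schurInt (-a) B)
        - bosonExp (-a) (B + 2) (schurInt a (A - 2))) := by
    rw [map_sub, oscNumber_bosonExp_schurInt, oscNumber_bosonExp_schurInt,
      show B + 2 + (A - 2) = A + B by ring, mul_sub]
  rcases lt_or_ge (A + B) 0 with hd | hd
  · rw [eq_zero_of_oscNumber_neg hosc hd, commutatorTerm, if_pos hd]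
  obtain ⟨d, hd'⟩ := Int.eq_ofNat_of_zero_le hd
  clear hd
  induction d using Nat.strong_induction_on generalizing A B with
  | _ d ih =>
  have ih' : ∀ A' B' : ℤ, A' + B' < d →
      bosonExp a A' (schurInt (-a) B') - bosonExp (-a) (B' + 2) (schurInt a (A' - 2))
        = commutatorTerm a A' B' := by
    intro A' B' h
    have hosc' : oscNumber c (bosonExp a A' (schurInt (-a) B')
          - bosonExp (-a) (B' + 2) (schurInt a (A' - 2)))
        = C ((A' + B' : ℤ) : ℂ) * (bosonExp a A' (schurInt (-a) B')
          - bosonExp (-a) (B' + 2) (schurInt a (A' - 2))) := by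
      rw [map_sub, oscNumber_bosonExp_schurInt, oscNumber_bosonExp_schurInt,
        show B' + 2 + (A' - 2) = A' + B' by ring, mul_sub]
    rcases lt_or_ge (A' + B') 0 with hd | hd
    · rw [eq_zero_of_oscNumber_neg hosc' hd, commutatorTerm, if_pos hd]
    · obtain ⟨d', hd''⟩ := Int.eq_ofNat_of_zero_le hd
      exact ih d' (by omega) A' B' hosc' hd''
  rw [← sub_eq_zero]
  refine eq_zero_of_pderiv ?_ ?_
  · rw [coeff_sub]
    rcases Nat.eq_zero_or_pos d with rfl | hd
    · have e1 : A = -B := by omega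
      subst e1
      have h1 := coeff_zero_bosonExp_schurInt a ha B
      have h2 := coeff_zero_bosonExp_schurInt (-a) (by simpa using ha) (-B - 2)
      rw [neg_neg, show -(-B - 2) = B + 2 by ring] at h2
      have h3 : coeff 0 (commutatorTerm a (-B) B) = 1 + (B : ℂ) := by
        rw [commutatorTerm, if_neg (by omega), if_pos (by omega), coeff_zero_C]
        push_cast; ring
      rw [coeff_sub, h1, h2, h3]
      push_cast
      -- The first product contributes for `B ≥ 0`, the second for `B ≤ -2`; at `B = -1` neither
      -- does, and `1 + B = 0`.
      rcases lt_trichotomy B (-1) with h | rfl | h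
      · rw [if_neg (by omega), if_pos (by omega)]; ring
      · norm_num
      · rw [if_pos (by omega), if_neg (by omega)]; ring
    · rw [coeff_eq_zero_of_oscNumber hosc, commutatorTerm, if_neg (by omega), if_neg (by omega),
        ← mul_one (creationMode _ _), coeff_zero_creationMode_mul, sub_zero]
      simp only [oscDegree, map_zero, Nat.cast_zero]
      rw [hd']
      exact_mod_cast hd.ne
  · rintro ⟨i, k⟩
    have hk : ((k : ℂ) + 1) ≠ 0 := Nat.cast_add_one_ne_zero k
    refine C_ne_zero_cancel hk ?_
    have e1 := ih' (A - k - 1) B (by omega)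
    have e2 := ih' A (B - k - 1) (by omega)
    have e3 : C ((k : ℂ) + 1) * pderiv (i, k) (bosonExp a A (schurInt (-a) B)
        - bosonExp (-a) (B + 2) (schurInt a (A - 2)))
        = C (a i : ℂ) * (commutatorTerm a (A - k - 1) B - commutatorTerm a A (B - k - 1)) := by
      rw [← e1, ← e2, map_sub, mul_sub, pderiv_bosonExp, pderiv_bosonExp, pderiv_schurInt,
        pderiv_schurInt, bosonExp_C_mul, bosonExp_C_mul, neg_apply_ofReal, C_neg,
        show A - 2 - (k : ℤ) - 1 = A - k - 1 - 2 by ring,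
        show B + 2 - (k : ℤ) - 1 = B - k - 1 + 2 by ring]
      ring
    rw [map_sub, mul_sub, e3, mul_zero]
    simp only [commutatorTerm]
    rw [if_neg (show ¬ A + B < 0 by omega)]
    rcases Nat.eq_zero_or_pos d with rfl | hd
    · rw [if_pos (show A - k - 1 + B < 0 by omega), if_pos (show A + (B - k - 1) < 0 by omega),
        if_pos (show A + B = 0 by omega), pderiv_C]
      ring
    · rw [if_neg (show A + B ≠ 0 by omega), pderiv_creationMode]
      -- Only for `d = k + 1` are the two lower commutators in degree zero, where they depend on `A`
      -- separately; their difference is then the constant `k + 1`.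
      rcases lt_trichotomy d (k + 1) with h | h | h
      · rw [if_pos (show A - k - 1 + B < 0 by omega), if_pos (show A + (B - k - 1) < 0 by omega),
          if_neg (by omega)]
        ring
      · rw [if_neg (show ¬ A - k - 1 + B < 0 by omega), if_pos (show A - k - 1 + B = 0 by omega),
          if_neg (show ¬ A + (B - k - 1) < 0 by omega),
          if_pos (show A + (B - k - 1) = 0 by omega), if_pos (by omega), ← C_sub]
        have : 1 - ((A - k - 1 : ℤ) : ℂ) - (1 - (A : ℂ)) = (k : ℂ) + 1 := by push_cast; ring
        rw [this]; ring
      · rw [if_neg (show ¬ A - k - 1 + B < 0 by omega), if_neg (show A - k - 1 + B ≠ 0 by omega),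
          if_neg (show ¬ A + (B - k - 1) < 0 by omega),
          if_neg (show A + (B - k - 1) ≠ 0 by omega), if_neg (by omega),
          show A + (B - k - 1) = A - k - 1 + B by ring]
        ring

/-- In nonnegative degree the commutator is multiplication by its value on the vacuum. In negative
degree it is an annihilation mode, which vanishes on the vacuum but not in general; hence `0 ≤ A +
B`. -/
theorem bosonExp_commutator (a : ChargeSpace c) (ha : ∑ i, a i * a i = 2) (A B : ℤ)
    (hAB : 0 ≤ A + B) (p : Fock c) :
    bosonExp a A (bosonExp (-a) B p) - bosonExp (-a) (B + 2) (bosonExp a (A - 2) p)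
      = commutatorTerm a A B * p := by
  let D : ℤ × ℤ → Fock c →ₗ[ℂ] Fock c := fun n =>
    bosonExp a n.1 ∘ₗ bosonExp (-a) n.2 - bosonExp (-a) (n.2 + 2) ∘ₗ bosonExp a (n.1 - 2)
      - LinearMap.mulLeft ℂ (commutatorTerm a n.1 n.2)
  have hD : ∀ A B p, D (A, B) p = bosonExp a A (bosonExp (-a) B p)
      - bosonExp (-a) (B + 2) (bosonExp a (A - 2) p) - commutatorTerm a A B * p :=
    fun _ _ _ => rfl
  have key : D (A, B) p = 0 := by
    refine eq_zero_of_vacuum (fun n => 0 ≤ n.1 + n.2) D ?_ ?_ (A, B) hAB p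
    · rintro ⟨A, B⟩ _
      rw [hD, bosonExp_one, bosonExp_one, commutator_vacuum a ha, mul_one, sub_self]
    · rintro ⟨A, B⟩ h x p ih
      replace h : 0 ≤ A + B := h
      have e1 := ih (A, B) h
      have e2 := ih (A + x.2 + 1, B) (by simp only; omega)
      have e3 := ih (A, B + x.2 + 1) (by simp only; omega)
      rw [hD] at e1 e2 e3 ⊢
      -- Moving `X x` through the two factors shifts one mode or the other. Both shifted degrees are
      -- positive, where the term depends only on the sum of the modes, so the corrections cancel.
      have e4 : commutatorTerm a (A + x.2 + 1) B = commutatorTerm a A (B + x.2 + 1) := by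
        simp only [commutatorTerm]
        rw [if_neg (by omega), if_neg (by omega), if_neg (by omega), if_neg (by omega)]
        congr 2
        ring
      rw [e4, show A + (x.2 : ℤ) + 1 - 2 = A - 2 + x.2 + 1 by ring] at e2
      rw [show B + (x.2 : ℤ) + 1 + 2 = B + 2 + x.2 + 1 by ring] at e3
      simp only [bosonExp_X_mul, map_sub, bosonExp_C_mul, neg_apply_ofReal, neg_mul, map_neg]
      linear_combination X x * e1 - C (a x.1 : ℂ) * e2 + C (a x.1 : ℂ) * e3
  rw [hD] at key
  linear_combination key

/-- The root `su(2)` in Fock coordinates. On charge `γ` the zero mode uses `m = -1 - (a|γ)`, and the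
next application uses `m - 2`; `e = 4N + (m+1)²` is constant along the string. With spin projection
`M = (a|γ)/2` one has `(m² - 1)/4 = M(M+1)`, so the constant is `j(j+1) - M(M+1)` with the generous
`e/2 + 2` in place of `j(j+1)`. The induction starts beyond the end of the string, where `N < 0`;
`n` bounds the number of steps left. -/
theorem fockNormSq_bosonExp_le (a : ChargeSpace c) (ha : ∑ i, a i * a i = 2) (e : ℤ) (n : ℕ)
    (m N : ℤ) (hm : m + 1 + e < n) (he : 4 * N + (m + 1) ^ 2 = e) (u : Fock c)
    (hu : oscNumber c u = C (N : ℂ) * u) :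
    fockNormSq (bosonExp a m u)
      ≤ ((e : ℝ) / 2 + 2 - ((m : ℝ) ^ 2 - 1) / 4) * fockNormSq u := by
  induction n generalizing m N u with
  | zero =>
    -- For integers, `m + 1 < -e` forces `(m + 1)² > e`.
    have hN : N < 0 := by
      push_cast at hm
      nlinarith
    have : u = 0 := eq_zero_of_oscNumber_neg hu hN
    subst this
    simp [fockNormSq]
  | succ n ih =>
    by_cases hN : N < 0
    · have : u = 0 := eq_zero_of_oscNumber_neg hu hN
      subst this
      simp [fockNormSq]
    push Not at hN
    set y := bosonExp a m u with hy
    set z := bosonExp (-a) (-m) y with hz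
    set κ : ℝ := (e : ℝ) / 2 + 2 - ((m : ℝ) ^ 2 - 1) / 4 with hκ
    -- For `N ≥ 0` one gets `κ ≥ ((m + 2)² + 7) / 4`; the summand 2 in `κ` is there for this.
    have hκpos : 0 < κ := by
      have h1 : (4 * (N : ℝ) + ((m : ℝ) + 1) ^ 2) = e := by exact_mod_cast he
      have h2 : (0 : ℝ) ≤ N := by exact_mod_cast hN
      rw [hκ]
      nlinarith [sq_nonneg ((m : ℝ) + 2)]
    have hyosc : oscNumber c y = C ((N + m : ℤ) : ℂ) * y := by
      rw [hy, oscNumber_bosonExp, hu, bosonExp_C_mul]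
      push_cast
      rw [C_add]; ring
    have hzy : bosonExp a m z = bosonExp (-a) (-(m - 2)) (bosonExp a (m - 2) y)
        + C (1 - (m : ℂ)) * y := by
      have h := bosonExp_commutator a ha m (-m) (by omega) y
      rw [commutatorTerm, if_neg (by omega), if_pos (by omega)] at h
      rw [show -(m - 2) = -m + 2 by ring]
      linear_combination h
    -- Here `z = E* y`, so its square norm is `⟨y, E E* y⟩`. Exchanging the factors costs `1 - m`,
    -- exactly the increment of `κ` from `m - 2` to `m`.
    have h1 : (fockNormSq z : ℂ) = fockNormSq (bosonExp a (m - 2) y) + (1 - m) * fockNormSq y := by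
      rw [← fockForm_self, ← fockForm_self, ← fockForm_self]
      conv_lhs => enter [1]; rw [hz]
      rw [fockForm_bosonExp, neg_neg, neg_neg, hzy, fockForm_add_right, fockForm_C_mul_right,
        ← fockForm_bosonExp]
    have h1' : fockNormSq z = fockNormSq (bosonExp a (m - 2) y) + (1 - m) * fockNormSq y := by
      exact_mod_cast h1
    have h2 := ih (m - 2) (N + m) (by push_cast at hm ⊢; omega) (by rw [← he]; ring) y hyosc
    have h3 : fockNormSq z ≤ κ * fockNormSq y := by
      rw [h1']
      push_cast at h2
      have h4 : κ = (e : ℝ) / 2 + 2 - (((m : ℝ) - 2) ^ 2 - 1) / 4 + (1 - m) := by rw [hκ]; ring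
      rw [h4, add_mul]
      linarith
    -- The bound passes from `E*` to `E`: with `y = E u` and `‖E* y‖² ≤ κ ‖y‖²`, positivity of `‖E*
    -- E u - κ u‖²` gives `κ ‖y‖² ≤ κ² ‖u‖²`.
    have h5 : (fockNormSq (z - C (κ : ℂ) * u) : ℂ)
        = fockNormSq z - 2 * κ * fockNormSq y + κ ^ 2 * fockNormSq u := by
      have h6 : fockForm z u = fockNormSq y := by
        rw [hz, fockForm_bosonExp, neg_neg, neg_neg, ← hy, fockForm_self]
      have h7 : fockForm u z = fockNormSq y := by
        rw [← fockForm_conj, h6, Complex.conj_ofReal]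
      rw [← fockForm_self, fockForm_sub_left, fockForm_sub_right, fockForm_sub_right,
        fockForm_C_mul_left, fockForm_C_mul_right, fockForm_C_mul_right, fockForm_C_mul_left, h6,
        h7, fockForm_self, fockForm_self, Complex.conj_ofReal]
      ring
    have h5' : fockNormSq (z - C (κ : ℂ) * u)
        = fockNormSq z - 2 * κ * fockNormSq y + κ ^ 2 * fockNormSq u := by
      exact_mod_cast h5
    have h8 := fockNormSq_nonneg (z - C (κ : ℂ) * u)
    rw [h5'] at h8
    have h9 : 0 ≤ κ * (κ * fockNormSq u - fockNormSq y) := by nlinarith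
    have h10 := nonneg_of_mul_nonneg_right h9 hκpos
    linarith

end Commutator

/-! ### Operators with finite blocks: exponentials and traces. -/

section Block

open Module

variable {M I Λ : Type*} [AddCommGroup M] [Module ℂ M] (e : Basis I ℂ M) (l : I → Λ)

theorem repr_apply_eq_sum (A : Module.End ℂ M) (v : M) (i : I) :
    e.repr (A v) i = (e.repr v).sum fun k t => t * e.repr (A (e k)) i := by
  conv_lhs => rw [← e.linearCombination_repr v, Finsupp.linearCombination_apply]
  simp [Finsupp.sum, map_sum, Finsupp.finsetSum_apply]

/-- The operators that preserve the span of the basis vectors of each label. -/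
def blockAlgebra : Subalgebra ℂ (Module.End ℂ M) where
  carrier := {A | ∀ i j, e.repr (A (e j)) i ≠ 0 → l i = l j}
  mul_mem' := by
    intro A B hA hB i j h
    rw [Module.End.mul_apply, repr_apply_eq_sum] at h
    obtain ⟨k, hk, hk'⟩ := Finset.exists_ne_zero_of_sum_ne_zero h
    exact (hA i k (right_ne_zero_of_mul hk')).trans (hB k j (left_ne_zero_of_mul hk'))
  add_mem' := by
    intro A B hA hB i j h
    rw [LinearMap.add_apply, map_add, Finsupp.add_apply] at h
    by_cases h1 : e.repr (A (e j)) i = 0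
    · exact hB i j fun h2 => h (by rw [h1, h2, add_zero])
    · exact hA i j h1
  algebraMap_mem' := by
    intro r i j h
    rw [Module.algebraMap_end_apply, map_smul, e.repr_self, Finsupp.smul_apply,
      smul_eq_mul] at h
    by_contra hij
    refine h ?_
    rw [Finsupp.single_eq_of_ne (fun h' => hij (by rw [h'])), mul_zero]

/-- The span of the basis vectors of a given label. -/
def blockSpace (x : Λ) : Submodule ℂ M where
  carrier := {v | ∀ i, e.repr v i ≠ 0 → l i = x}
  add_mem' := by
    intro v w hv hw i h
    rw [map_add, Finsupp.add_apply] at h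
    by_cases h1 : e.repr v i = 0
    · exact hw i fun h2 => h (by rw [h1, h2, add_zero])
    · exact hv i h1
  zero_mem' := fun i h => absurd (by simp) h
  smul_mem' := by
    intro t v hv i h
    rw [map_smul, Finsupp.smul_apply, smul_eq_mul] at h
    exact hv i (right_ne_zero_of_mul h)

variable {e l}

theorem apply_mem_blockSpace {A : Module.End ℂ M} (hA : A ∈ blockAlgebra e l) {x : Λ} {v : M}
    (hv : v ∈ blockSpace e l x) : A v ∈ blockSpace e l x := by
  intro i h
  rw [repr_apply_eq_sum] at h
  obtain ⟨k, hk, hk'⟩ := Finset.exists_ne_zero_of_sum_ne_zero h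
  exact (hA i k (right_ne_zero_of_mul hk')).trans (hv k (left_ne_zero_of_mul hk'))

theorem basis_mem_blockSpace (i : I) : e i ∈ blockSpace e l (l i) := by
  intro j h
  by_contra hij
  exact h (by rw [e.repr_self, Finsupp.single_eq_of_ne fun h' => hij (by rw [h'])])

variable [hl : ∀ x, Fintype {i // l i = x}]

variable (e l) in
/-- The matrix of an operator on the span of the basis vectors of a given label. -/
def blockMatrix (x : Λ) (A : Module.End ℂ M) : Matrix {i // l i = x} {i // l i = x} ℂ :=
  fun i j => e.repr (A (e j)) i

variable (e l) in
/-- The finite sum of the coordinates of a vector over a block. -/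
theorem sum_block_eq {A : Module.End ℂ M} {v : M} {x : Λ} (hv : v ∈ blockSpace e l x) (i : I) :
    e.repr (A v) i = ∑ k : {i // l i = x}, e.repr v k * e.repr (A (e k)) i := by
  classical
  rw [repr_apply_eq_sum, Finsupp.sum]
  have h : (e.repr v).support ⊆ Finset.univ.map (Function.Embedding.subtype fun i => l i = x) := by
    intro k hk
    simpa using hv k (Finsupp.mem_support_iff.1 hk)
  rw [Finset.sum_subset h, Finset.sum_map]
  · rfl
  · intro k _ hk
    rw [Finsupp.notMem_support_iff.1 hk, zero_mul]

variable [DecidableEq I]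

variable (e l) in
/-- The restriction of block operators to a block, as matrices. -/
def blockHom (x : Λ) : blockAlgebra e l →ₐ[ℂ] Matrix {i // l i = x} {i // l i = x} ℂ :=
  AlgHom.ofLinearMap
    { toFun := fun A => blockMatrix e l x A
      map_add' := fun A B => by ext i j; simp [blockMatrix]
      map_smul' := fun t A => by ext i j; simp [blockMatrix] }
    (by
      ext i j
      simp [blockMatrix, Matrix.one_apply, Finsupp.single_apply, Subtype.ext_iff, eq_comm])
    (by
      intro A B
      ext i j
      change e.repr (A.1 (B.1 (e j))) i = _
      have h := apply_mem_blockSpace B.2 (basis_mem_blockSpace (e := e) (l := l) j.1)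
      rw [j.2] at h
      rw [sum_block_eq e l h, Matrix.mul_apply]
      exact Finset.sum_congr rfl fun k _ => mul_comm _ _)

theorem blockHom_apply (x : Λ) (A : blockAlgebra e l) (i j : {i // l i = x}) :
    blockHom e l x A i j = e.repr (A.1 (e j)) i := rfl

omit [DecidableEq I] hl in
theorem block_repr_eq_zero {A : Module.End ℂ M} (hA : A ∈ blockAlgebra e l) {i j : I}
    (h : l i ≠ l j) : e.repr (A (e j)) i = 0 := by
  by_contra h'
  exact h (hA i j h')

/-- Entries between different labels vanish, so the finite matrices carry all the information; this
reduces identities between exponentials to matrix identities. -/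
theorem block_ext {A B : blockAlgebra e l} (h : ∀ x, blockHom e l x A = blockHom e l x B) :
    A = B := by
  apply Subtype.ext
  refine e.ext fun j => e.repr.injective (Finsupp.ext fun i => ?_)
  by_cases hij : l i = l j
  · exact congrFun (congrFun (h (l j)) ⟨i, hij⟩) ⟨j, rfl⟩
  · rw [block_repr_eq_zero A.2 hij, block_repr_eq_zero B.2 hij]

variable (e l) in
/-- The block operator with given blocks. -/
def ofBlocks (N : ∀ x, Matrix {i // l i = x} {i // l i = x} ℂ) : blockAlgebra e l :=
  ⟨e.constr ℂ fun j => ∑ i : {i // l i = l j}, N (l j) i ⟨j, rfl⟩ • e i, by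
    intro i j h
    rw [e.constr_basis, map_sum, Finsupp.finsetSum_apply] at h
    obtain ⟨k, _, hk⟩ := Finset.exists_ne_zero_of_sum_ne_zero h
    rw [map_smul, e.repr_self, Finsupp.smul_apply, smul_eq_mul] at hk
    by_contra hij
    refine right_ne_zero_of_mul hk (Finsupp.single_eq_of_ne fun h' => hij ?_)
    rw [h', k.2]⟩

theorem blockHom_ofBlocks (N : ∀ x, Matrix {i // l i = x} {i // l i = x} ℂ) (x : Λ) :
    blockHom e l x (ofBlocks e l N) = N x := by
  ext i ⟨j, rfl⟩
  rw [blockHom_apply, ofBlocks]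
  simp only [e.constr_basis, map_sum, Finsupp.finsetSum_apply, map_smul, e.repr_self,
    Finsupp.smul_apply, smul_eq_mul]
  rw [Finset.sum_eq_single i]
  · simp
  · intro k _ hk
    rw [Finsupp.single_eq_of_ne (fun h => hk (Subtype.ext h.symm)), mul_zero]
  · simp

/-- `T = e^A`, coordinatewise. -/
def IsBasisExp (e : Basis I ℂ M) (A T : Module.End ℂ M) : Prop :=
  ∀ v i, HasSum (fun k : ℕ => ((Nat.factorial k : ℂ))⁻¹ * e.repr ((A ^ k) v) i) (e.repr (T v) i)

omit [DecidableEq I] in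
theorem IsBasisExp.unique {A T T' : Module.End ℂ M} (h : IsBasisExp e A T)
    (h' : IsBasisExp e A T') : T = T' :=
  LinearMap.ext fun v => e.repr.injective (Finsupp.ext fun i => (h v i).unique (h' v i))

omit [DecidableEq I] in
theorem isBasisExp_of_basis {A T : Module.End ℂ M}
    (h : ∀ j i, HasSum (fun k : ℕ => ((Nat.factorial k : ℂ))⁻¹ * e.repr ((A ^ k) (e j)) i)
      (e.repr (T (e j)) i)) : IsBasisExp e A T := by
  intro v i
  rw [repr_apply_eq_sum]
  have h1 : ∀ k : ℕ, ((Nat.factorial k : ℂ))⁻¹ * e.repr ((A ^ k) v) i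
      = ∑ j ∈ (e.repr v).support, e.repr v j *
        (((Nat.factorial k : ℂ))⁻¹ * e.repr ((A ^ k) (e j)) i) := by
    intro k
    rw [repr_apply_eq_sum, Finsupp.sum, Finset.mul_sum]
    exact Finset.sum_congr rfl fun j _ => by ring
  simp only [h1]
  exact hasSum_sum fun j _ => (h j i).mul_left _

theorem matrix_hasSum_exp {n : Type*} [Fintype n] [DecidableEq n] (N : Matrix n n ℂ) (i j : n) :
    HasSum (fun k : ℕ => ((Nat.factorial k : ℂ))⁻¹ * (N ^ k) i j) (NormedSpace.exp N i j) := by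
  -- The norm is auxiliary: it gives convergence of the series, while the exponential depends only
  -- on the entrywise topology.
  let _ : NormedRing (Matrix n n ℂ) := Matrix.linftyOpNormedRing
  let _ : NormedAlgebra ℂ (Matrix n n ℂ) := Matrix.linftyOpNormedAlgebra
  have h : HasSum (fun k : ℕ => ((Nat.factorial k : ℂ))⁻¹ • N ^ k) (NormedSpace.exp N) :=
    NormedSpace.exp_series_hasSum_exp' N
  have h2 := Pi.hasSum.1 (Pi.hasSum.1 h i) j
  exact h2

variable (e l) in
/-- The exponential of a block operator. -/
def blockExp (A : blockAlgebra e l) : blockAlgebra e l :=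
  ofBlocks e l fun x => NormedSpace.exp (blockHom e l x A)

theorem blockHom_blockExp (A : blockAlgebra e l) (x : Λ) :
    blockHom e l x (blockExp e l A) = NormedSpace.exp (blockHom e l x A) :=
  blockHom_ofBlocks _ _

/-- Powers of a block operator are block operators, so each coordinate series is an entry of a
matrix exponential series inside a block and identically zero across blocks. -/
theorem isBasisExp_blockExp (A : blockAlgebra e l) : IsBasisExp e A.1 (blockExp e l A).1 := by
  refine isBasisExp_of_basis fun j i => ?_
  by_cases hij : l i = l j
  · have h := matrix_hasSum_exp (blockHom e l (l j) A) ⟨i, hij⟩ ⟨j, rfl⟩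
    rw [← blockHom_blockExp] at h
    simp only [← map_pow] at h
    exact h
  · rw [block_repr_eq_zero (blockExp e l A).2 hij]
    have h : ∀ k : ℕ, e.repr ((A.1 ^ k) (e j)) i = 0 := fun k =>
      block_repr_eq_zero (A ^ k).2 hij
    simp [h]

theorem blockExp_add {A B : blockAlgebra e l} (h : Commute A B) :
    blockExp e l (A + B) = blockExp e l A * blockExp e l B := by
  refine block_ext fun x => ?_
  rw [map_mul, blockHom_blockExp, blockHom_blockExp, blockHom_blockExp, map_add,
    Matrix.exp_add_of_commute _ _ (h.map (blockHom e l x))]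

theorem blockExp_semiconj {X A B : blockAlgebra e l} (h : SemiconjBy X A B) :
    SemiconjBy X (blockExp e l A) (blockExp e l B) := by
  refine block_ext fun x => ?_
  rw [map_mul, map_mul, blockHom_blockExp, blockHom_blockExp]
  let _ : NormedRing (Matrix {i // l i = x} {i // l i = x} ℂ) := Matrix.linftyOpNormedRing
  let _ : NormedAlgebra ℂ (Matrix {i // l i = x} {i // l i = x} ℂ) := Matrix.linftyOpNormedAlgebra
  let _ : NormedAlgebra ℚ (Matrix {i // l i = x} {i // l i = x} ℂ) := NormedAlgebra.restrictScalars ℚ ℂ _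
  exact (SemiconjBy.exp_right (h.map (blockHom e l x)))

omit [DecidableEq I] in
theorem IsBasisExp.apply_eigenvector {A T : Module.End ℂ M} (h : IsBasisExp e A T) {v : M} {t : ℂ}
    (hv : A v = t • v) : T v = Complex.exp t • v := by
  refine e.repr.injective (Finsupp.ext fun i => (h v i).unique ?_)
  have h1 : ∀ k : ℕ, (A ^ k) v = t ^ k • v := by
    intro k
    induction k with
    | zero => simp
    | succ k ih => rw [pow_succ', Module.End.mul_apply, ih, map_smul, hv, smul_smul, ← pow_succ]
  simp only [h1, map_smul, Finsupp.smul_apply, smul_eq_mul]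
  have h2 : HasSum (fun k : ℕ => t ^ k / (Nat.factorial k : ℂ)) (Complex.exp t) := by
    rw [Complex.exp_eq_exp_ℂ]; exact NormedSpace.expSeries_div_hasSum_exp t
  have h3 := h2.mul_right (e.repr v i)
  refine h3.congr_fun ?_ 
  intro k
  rw [div_eq_mul_inv]; ring

variable (e l) in
/-- The basis of a block. -/
def blockBasis (x : Λ) : Basis {i // l i = x} ℂ (blockSpace e l x) :=
  Basis.ofEquivFun
    { toFun := fun v i => e.repr v i
      map_add' := fun v w => by ext; simp
      map_smul' := fun t v => by ext; simp
      invFun := fun f => ⟨∑ i, f i • e i, Submodule.sum_mem _ fun i _ =>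
        Submodule.smul_mem _ _ (by
          have h := basis_mem_blockSpace (e := e) (l := l) i.1
          rwa [i.2] at h)⟩
      left_inv := by
        intro v
        refine Subtype.ext (e.repr.injective (Finsupp.ext fun i => ?_))
        have h := sum_block_eq e l (A := 1) v.2 i
        simp only [Module.End.one_apply] at h
        rw [h]
        simp only [map_sum, Finsupp.finsetSum_apply, map_smul, Finsupp.smul_apply, smul_eq_mul]
      right_inv := by
        intro f
        ext i
        simp only [map_sum, Finsupp.finsetSum_apply, map_smul, e.repr_self, Finsupp.smul_apply,
          smul_eq_mul]
        rw [Finset.sum_eq_single i]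
        · simp
        · intro k _ hk
          rw [Finsupp.single_eq_of_ne (fun h => hk (Subtype.ext h.symm)), mul_zero]
        · simp }

omit [DecidableEq I] in
theorem blockBasis_repr (x : Λ) (v : blockSpace e l x) (i : {i // l i = x}) :
    (blockBasis e l x).repr v i = e.repr v.1 i := rfl

theorem blockBasis_apply (x : Λ) (i : {i // l i = x}) :
    ((blockBasis e l x i : blockSpace e l x) : M) = e i := by
  refine e.repr.injective (Finsupp.ext fun k => ?_)
  by_cases hk : l k = x
  · have h := DFunLike.congr_fun ((blockBasis e l x).repr_self i) ⟨k, hk⟩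
    rw [blockBasis_repr] at h
    rw [h, e.repr_self, Finsupp.single_apply, Finsupp.single_apply]
    simp [Subtype.ext_iff]
  · have h : e.repr (blockBasis e l x i : blockSpace e l x) k = 0 := by
      by_contra h; exact hk ((blockBasis e l x i).2 k h)
    rw [h, e.repr_self, Finsupp.single_eq_of_ne (fun h' => hk (by rw [h', i.2]))]

omit [DecidableEq I] in
theorem finiteDimensional_blockSpace (x : Λ) : FiniteDimensional ℂ (blockSpace e l x) := by
  classical
  exact Module.Finite.of_basis (blockBasis e l x)

omit [DecidableEq I] in
theorem traceOn_blockSpace {A : Module.End ℂ M} (hA : A ∈ blockAlgebra e l) (x : Λ) :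
    traceOn (blockSpace e l x) A = ∑ i : {i // l i = x}, e.repr (A (e i)) i := by
  classical
  rw [traceOn, dif_pos fun v hv => apply_mem_blockSpace hA hv,
    LinearMap.trace_eq_matrix_trace ℂ (blockBasis e l x), Matrix.trace]
  refine Finset.sum_congr rfl fun i _ => ?_
  rw [Matrix.diag_apply, LinearMap.toMatrix_apply, blockBasis_repr, LinearMap.coe_restrict_apply,
    blockBasis_apply]

omit [DecidableEq I] in
theorem traceOn_blockSpace_conj {X Y A : Module.End ℂ M} (hX : X ∈ blockAlgebra e l)
    (hY : Y ∈ blockAlgebra e l) (hA : A ∈ blockAlgebra e l) (h : Y * X = 1) (x : Λ) :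
    traceOn (blockSpace e l x) (X * A * Y) = traceOn (blockSpace e l x) A := by
  classical
  rw [traceOn_blockSpace hA,
    traceOn_blockSpace (Subalgebra.mul_mem _ (Subalgebra.mul_mem _ hX hA) hY)]
  change (blockHom e l x (⟨X, hX⟩ * ⟨A, hA⟩ * ⟨Y, hY⟩)).trace = (blockHom e l x ⟨A, hA⟩).trace
  have h1 : (⟨Y, hY⟩ : blockAlgebra e l) * ⟨X, hX⟩ = 1 := Subtype.ext h
  rw [map_mul, Matrix.trace_mul_comm, ← map_mul, ← mul_assoc, h1, one_mul]

end Block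

/-! ### The oscillator partition function and Gaussian lattice sums. -/

section Series

open Filter Topology

variable {c : ℕ}

/-- The finitely supported functions with support in `insert i s`. -/
def supportInsertEquiv {ι : Type*} [DecidableEq ι] {s : Finset ι} {i : ι} (hi : i ∉ s) :
    ℕ × {m : ι →₀ ℕ // m.support ⊆ s} ≃ {m : ι →₀ ℕ // m.support ⊆ insert i s} where
  toFun x := ⟨x.2.1 + Finsupp.single i x.1, fun j hj => by
    by_cases h : j = i
    · simp [h]
    · have : x.2.1 j ≠ 0 := by simpa [Finsupp.single_apply, Ne.symm h] using hj
      exact Finset.mem_insert_of_mem (x.2.2 (Finsupp.mem_support_iff.2 this))⟩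
  invFun m := (m.1 i, ⟨m.1.erase i, fun j hj => by
    rw [Finsupp.support_erase, Finset.mem_erase] at hj
    exact (Finset.mem_insert.1 (m.2 hj.2)).resolve_left hj.1⟩)
  left_inv x := by
    have h : x.2.1 i = 0 := by
      by_contra h; exact hi (x.2.2 (Finsupp.mem_support_iff.2 h))
    refine Prod.ext ?_ (Subtype.ext (Finsupp.ext fun j => ?_))
    · simp [h]
    · by_cases hj : j = i
      · subst hj; simp [h]
      · simp [Finsupp.erase_ne hj]
  right_inv m := by
    refine Subtype.ext (Finsupp.ext fun j => ?_)
    by_cases hj : j = i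
    · subst hj; simp
    · simp [Finsupp.erase_ne hj, Ne.symm hj]

theorem pow_oscDegree_add (q : ℂ) (m : Fin c × ℕ →₀ ℕ) (x : Fin c × ℕ) (n : ℕ) :
    q ^ oscDegree (m + Finsupp.single x n) = (q ^ (x.2 + 1)) ^ n * q ^ oscDegree m := by
  have : oscDegree (m + Finsupp.single x n) = oscDegree m + n * (x.2 + 1) := by
    simp [oscDegree, map_add, Finsupp.weight_apply]
  rw [this, pow_add, mul_comm, ← pow_mul, mul_comm n]

/-- Each mode contributes an independent geometric series in its occupation number; modes are added
one at a time by multiplying absolutely convergent series. -/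
theorem hasSum_pow_oscDegree_finset {q : ℂ} (hq : ‖q‖ < 1) (s : Finset (Fin c × ℕ)) :
    (Summable fun m : {m : Fin c × ℕ →₀ ℕ // m.support ⊆ s} => ‖q ^ oscDegree m.1‖) ∧
    HasSum (fun m : {m : Fin c × ℕ →₀ ℕ // m.support ⊆ s} => q ^ oscDegree m.1)
      (∏ x ∈ s, (1 - q ^ (x.2 + 1))⁻¹) := by
  classical
  induction s using Finset.induction_on with
  | empty =>
    have : Unique {m : Fin c × ℕ →₀ ℕ // m.support ⊆ ∅} :=
      { default := ⟨0, by simp⟩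
        uniq := fun m => Subtype.ext (by
          have := m.2
          rwa [Finset.subset_empty, Finsupp.support_eq_empty] at this) }
    refine ⟨Summable.of_finite, ?_⟩
    have h := hasSum_unique (fun m : {m : Fin c × ℕ →₀ ℕ // m.support ⊆ ∅} => q ^ oscDegree m.1)
    have h0 : (default : {m : Fin c × ℕ →₀ ℕ // m.support ⊆ ∅}).1 = 0 := by
      have := (default : {m : Fin c × ℕ →₀ ℕ // m.support ⊆ ∅}).2
      rwa [Finset.subset_empty, Finsupp.support_eq_empty] at this
    rw [h0] at h
    simpa [oscDegree] using h
  | insert x s hx ih =>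
    have hqx : ‖q ^ (x.2 + 1)‖ < 1 := by
      rw [norm_pow]; exact pow_lt_one₀ (norm_nonneg _) hq (Nat.succ_ne_zero _)
    have h1 := hasSum_geometric_of_norm_lt_one hqx
    have h1n : Summable fun n : ℕ => ‖(q ^ (x.2 + 1)) ^ n‖ := by
      simpa [norm_pow] using summable_geometric_of_lt_one (norm_nonneg _) hqx
    have h2 : Summable fun y : ℕ × {m : Fin c × ℕ →₀ ℕ // m.support ⊆ s} =>
        ‖(q ^ (x.2 + 1)) ^ y.1 * q ^ oscDegree y.2.1‖ :=
      Summable.mul_norm (f := fun n : ℕ => (q ^ (x.2 + 1)) ^ n)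
        (g := fun m : {m : Fin c × ℕ →₀ ℕ // m.support ⊆ s} => q ^ oscDegree m.1) h1n ih.1
    let f : ℕ → ℂ := fun n => (q ^ (x.2 + 1)) ^ n
    let g : {m : Fin c × ℕ →₀ ℕ // m.support ⊆ s} → ℂ := fun m => q ^ oscDegree m.1
    have h3 : HasSum (fun y : ℕ × {m : Fin c × ℕ →₀ ℕ // m.support ⊆ s} => f y.1 * g y.2)
        ((1 - q ^ (x.2 + 1))⁻¹ * ∏ x ∈ s, (1 - q ^ (x.2 + 1))⁻¹) :=
      HasSum.mul (f := f) (g := g) h1 ih.2 (Summable.of_norm h2)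
    have e : ∀ y : ℕ × {m : Fin c × ℕ →₀ ℕ // m.support ⊆ s},
        q ^ oscDegree (supportInsertEquiv hx y).1 = f y.1 * g y.2 :=
      fun y => pow_oscDegree_add q y.2.1 x y.1
    rw [Finset.prod_insert hx]
    constructor
    · rw [← (supportInsertEquiv hx).summable_iff]
      refine h2.congr fun y => ?_
      rw [Function.comp_apply, e]
    · rw [← (supportInsertEquiv hx).hasSum_iff]
      refine h3.congr_fun fun y => ?_
      rw [Function.comp_apply, e]

/-- The box of modes of the first `n` degrees. -/
def modeBox (c n : ℕ) : Finset (Fin c × ℕ) := Finset.univ ×ˢ Finset.range n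

theorem prod_modeBox (q : ℂ) (n : ℕ) : ∏ x ∈ modeBox c n, (1 - q ^ (x.2 + 1))⁻¹
    = ((∏ k ∈ Finset.range n, (1 - q ^ (k + 1))) ^ c)⁻¹ := by
  rw [modeBox, Finset.prod_product]
  simp

theorem tprod_one_sub_pow_ne_zero {q : ℂ} (hq : ‖q‖ < 1) : ∏' n : ℕ, (1 - q ^ (n + 1)) ≠ 0 := by
  have h := tprod_one_add_ne_zero_of_summable (f := fun n : ℕ => -q ^ (n + 1)) ?_ ?_
  · simpa [sub_eq_add_neg] using h
  · intro n hn
    have h1 : q ^ (n + 1) = 1 := by linear_combination -hn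
    have h2 : ‖q‖ ^ (n + 1) < 1 := pow_lt_one₀ (norm_nonneg _) hq (Nat.succ_ne_zero _)
    rw [← norm_pow, h1, norm_one] at h2
    exact lt_irrefl _ h2
  · simpa using (summable_nat_add_iff 1).mpr (summable_geometric_of_lt_one (norm_nonneg _) hq)

theorem tendsto_prod_modeBox {q : ℂ} (hq : ‖q‖ < 1) :
    Tendsto (fun n => ∏ x ∈ modeBox c n, (1 - q ^ (x.2 + 1))⁻¹) atTop
      (𝓝 ((∏' n : ℕ, (1 - q ^ (n + 1))) ^ c)⁻¹) := by
  simp only [prod_modeBox]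
  exact ((ModularForm.multipliable_one_sub_pow hq).hasProd.tendsto_prod_nat.pow c).inv₀
    (pow_ne_zero _ (tprod_one_sub_pow_ne_zero hq))

theorem exists_support_subset_modeBox (m : Fin c × ℕ →₀ ℕ) :
    ∃ n, ∀ n', n ≤ n' → m.support ⊆ modeBox c n' := by
  refine ⟨m.support.sup (fun x => x.2 + 1), fun n' hn' x hx => ?_⟩
  have := Finset.le_sup (f := fun x : Fin c × ℕ => x.2 + 1) hx
  simp only [modeBox, Finset.mem_product, Finset.mem_univ, Finset.mem_range, true_and]
  exact Nat.lt_of_succ_le (this.trans hn')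

/-- A finite set of monomials lies in some box of modes. Its partial sum is at most the box product
at `‖q‖`, and these products converge, hence are bounded. -/
theorem summable_norm_pow_oscDegree {q : ℂ} (hq : ‖q‖ < 1) :
    Summable fun m : Fin c × ℕ →₀ ℕ => ‖q ^ oscDegree m‖ := by
  classical
  have hr : ‖((‖q‖ : ℝ) : ℂ)‖ < 1 := by simpa using hq
  obtain ⟨B, hB⟩ := (tendsto_prod_modeBox (c := c) hr).norm.bddAbove_range
  refine summable_of_sum_le (c := B) (fun _ => norm_nonneg _) fun F => ?_
  obtain ⟨n, hn⟩ : ∃ n, ∀ m ∈ F, m.support ⊆ modeBox c n := by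
    choose N hN using exists_support_subset_modeBox (c := c)
    exact ⟨F.sup N, fun m hm => hN m _ (Finset.le_sup hm)⟩
  refine le_trans ?_ (hB ⟨n, rfl⟩)
  obtain ⟨h1, h2⟩ := hasSum_pow_oscDegree_finset hr (modeBox c n)
  change _ ≤ ‖∏ x ∈ modeBox c n, (1 - ((‖q‖ : ℝ) : ℂ) ^ (x.2 + 1))⁻¹‖
  have h3 : ∀ m : Fin c × ℕ →₀ ℕ, ‖q ^ oscDegree m‖ = (((‖q‖ : ℝ) : ℂ) ^ oscDegree m).re := by
    intro m; rw [norm_pow, ← Complex.ofReal_pow, Complex.ofReal_re]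
  have h4 := Complex.hasSum_re h2
  refine le_trans ?_ (Complex.re_le_norm _)
  have h5 := sum_le_hasSum (F.subtype fun m => m.support ⊆ modeBox c n)
    (fun m _ => by rw [← h3]; exact norm_nonneg _) h4
  refine le_trans (le_of_eq ?_) h5
  rw [Finset.sum_subtype_eq_sum_filter (f := fun m => (((‖q‖ : ℝ) : ℂ) ^ oscDegree m).re),
    Finset.filter_true_of_mem hn]
  exact Finset.sum_congr rfl fun m _ => h3 m

/-- Exhaust the modes by boxes: the box sums tend to the full sum by dominated convergence, and to
the infinite product by `tendsto_prod_modeBox`. -/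
theorem hasSum_pow_oscDegree {q : ℂ} (hq : ‖q‖ < 1) :
    HasSum (fun m : Fin c × ℕ →₀ ℕ => q ^ oscDegree m)
      ((∏' n : ℕ, (1 - q ^ (n + 1))) ^ c)⁻¹ := by
  classical
  have hs := summable_norm_pow_oscDegree (c := c) hq
  rw [hs.of_norm.hasSum_iff]
  refine tendsto_nhds_unique (f := fun n => ∑' m : Fin c × ℕ →₀ ℕ,
    Set.indicator {m | m.support ⊆ modeBox c n} (fun m => q ^ oscDegree m) m) ?_
    ((tendsto_prod_modeBox hq).congr fun n => ?_)
  · refine tendsto_tsum_of_dominated_convergence hs (fun m => ?_) (Eventually.of_forall fun n m => ?_)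
    · obtain ⟨n, hn⟩ := exists_support_subset_modeBox m
      refine tendsto_const_nhds.congr' ?_
      filter_upwards [eventually_ge_atTop n] with n' hn'
      rw [Set.indicator_of_mem]
      exact hn n' hn'
    · by_cases h : m ∈ {m : Fin c × ℕ →₀ ℕ | m.support ⊆ modeBox c n}
      · rw [Set.indicator_of_mem h]
      · rw [Set.indicator_of_notMem h, norm_zero]; exact norm_nonneg _
  · rw [← (hasSum_pow_oscDegree_finset hq (modeBox c n)).2.tsum_eq]
    exact tsum_subtype {m : Fin c × ℕ →₀ ℕ | m.support ⊆ modeBox c n} fun m => q ^ oscDegree m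

/-- The inequality `exp x ≥ x^n / n!` bounds the Gaussian by an inverse power `2n` of the distance,
summable since `2n` exceeds the rank. The possible point `g = -y`, at distance zero, is set aside by
comparing cofinitely. -/
theorem summable_exp_neg_norm_sq (L : Submodule ℤ (ChargeSpace c)) [DiscreteTopology L]
    (y : ChargeSpace c) {t : ℝ} (ht : 0 < t) :
    Summable fun g : L => Real.exp (-t * ‖(g : ChargeSpace c) + y‖ ^ 2) := by
  set n := Module.finrank ℤ L + 1 with hn
  have h1 := ZLattice.summable_norm_sub_inv_pow L (2 * n) (by omega) (-y)
  refine Summable.of_norm_bounded_eventually (h1.mul_left ((n.factorial : ℝ) / t ^ n)) ?_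
  have hfin : {g : L | (g : ChargeSpace c) + y = 0}.Finite := by
    refine Set.Subsingleton.finite fun g hg g' hg' => Subtype.ext ?_
    exact add_right_cancel (hg.trans hg'.symm)
  filter_upwards [hfin.compl_mem_cofinite] with g hg
  have hpos : 0 < ‖(g : ChargeSpace c) + y‖ := norm_pos_iff.2 hg
  rw [sub_neg_eq_add, Real.norm_eq_abs, Real.abs_exp, neg_mul, Real.exp_neg, inv_pow,
    div_mul_eq_mul_div, inv_le_comm₀ (Real.exp_pos _) (by positivity), inv_div, div_eq_mul_inv,
    mul_inv, inv_inv]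
  have h2 := Real.pow_div_factorial_le_exp (t * ‖(g : ChargeSpace c) + y‖ ^ 2) (by positivity) n
  refine le_trans (le_of_eq ?_) h2
  rw [mul_pow, ← pow_mul]
  field_simp

end Series

/-! ### The standard basis of states; conservation of energy and sector. -/

section StateBasis

open MvPolynomial Module

variable {c : ℕ} (L : Submodule ℤ (ChargeSpace c))

/-- Index set of the standard basis of the state space: a charge and a monomial. -/
abbrev StateIndex : Type := dualLattice L × (Fin c × ℕ →₀ ℕ)

/-- The standard basis of the state space. -/
def stateBasis : Basis (StateIndex L) ℂ (StateSpace L) :=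
  (Finsupp.basis fun _ => basisMonomials (Fin c × ℕ) ℂ).reindex (Equiv.sigmaEquivProd _ _)

variable {L}

theorem stateBasis_repr (v : StateSpace L) (i : StateIndex L) :
    (stateBasis L).repr v i = coeff i.2 (v i.1) := by
  rw [stateBasis, Basis.repr_reindex_apply, Finsupp.basis_repr]
  rfl

theorem stateBasis_apply (i : StateIndex L) :
    stateBasis L i = Finsupp.single i.1 (monomial i.2 1) := by
  rw [stateBasis, Basis.reindex_apply, Finsupp.coe_basis, coe_basisMonomials]
  rfl

theorem isBasisExp_iff (A T : Operator L) : IsBasisExp (stateBasis L) A T ↔ IsExp A T := by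
  simp only [IsBasisExp, stateBasis_repr, IsExp, Prod.forall]

theorem sectorwise_single (s : dualLattice L → dualLattice L)
    (f : dualLattice L → Module.End ℂ (Fock c)) (g : dualLattice L) (p : Fock c) :
    sectorwise L s f (Finsupp.single g p) = Finsupp.single (s g) (f g p) := by
  rw [sectorwise, Finsupp.lsum_single]; rfl

theorem sectorwise_apply {s : dualLattice L → dualLattice L} (hs : Function.Injective s)
    (f : dualLattice L → Module.End ℂ (Fock c)) (v : StateSpace L) (g : dualLattice L) :
    sectorwise L s f v (s g) = f g (v g) := by
  classical
  induction v using Finsupp.induction_linear with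
  | zero => simp
  | add v w hv hw => rw [map_add, Finsupp.add_apply, hv, hw, Finsupp.add_apply, map_add]
  | single h p =>
    rw [sectorwise_single]
    by_cases h1 : h = g
    · rw [h1, Finsupp.single_eq_same, Finsupp.single_eq_same]
    · rw [Finsupp.single_eq_of_ne (Ne.symm h1),
        Finsupp.single_eq_of_ne fun h2 => h1 (hs h2).symm, map_zero]

theorem sectorwise_apply_eq_zero {s : dualLattice L → dualLattice L}
    (f : dualLattice L → Module.End ℂ (Fock c)) (v : StateSpace L) {g : dualLattice L}
    (hg : g ∉ Set.range s) : sectorwise L s f v g = 0 := by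
  classical
  induction v using Finsupp.induction_linear with
  | zero => simp
  | add v w hv hw => rw [map_add, Finsupp.add_apply, hv, hw, add_zero]
  | single h p =>
    rw [sectorwise_single, Finsupp.single_apply, if_neg]
    exact fun h1 => hg ⟨h, h1⟩

theorem oscNumber_monomial (m : Fin c × ℕ →₀ ℕ) (t : ℂ) :
    oscNumber c (monomial m t) = C (oscDegree m : ℂ) * monomial m t := by
  classical
  ext m'
  rw [coeff_oscNumber, coeff_C_mul, coeff_monomial]
  split_ifs with h
  · rw [h]
  · simp

/-- The energy of a basis state. -/
def stateEnergy (i : StateIndex L) : ℝ :=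
  oscDegree i.2 + inner ℝ (i.1 : ChargeSpace c) (i.1 : ChargeSpace c) / 2

theorem energy_stateBasis (i : StateIndex L) :
    energy L (stateBasis L i) = (stateEnergy i : ℂ) • stateBasis L i := by
  rw [stateBasis_apply, energy, sectorwise_single, id, LinearMap.add_apply]
  have h : (mkDerivation ℂ fun x : Fin c × ℕ =>
      C ((x.2 : ℂ) + 1) * (X x : Fock c)).toLinearMap (monomial i.2 (1 : ℂ))
      = C (oscDegree i.2 : ℂ) * monomial i.2 1 := oscNumber_monomial i.2 1
  rw [h, LinearMap.smul_apply, LinearMap.id_apply, ← smul_eq_C_mul, ← add_smul,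
    Finsupp.smul_single, stateEnergy]
  push_cast
  rfl

variable (L) in
/-- The class of a charge modulo `L`. -/
abbrev sectorClass (g : dualLattice L) :
    dualLattice L ⧸ Submodule.comap (dualLattice L).subtype L :=
  Submodule.Quotient.mk g

theorem sectorClass_eq_iff {g h : dualLattice L} :
    sectorClass L g = sectorClass L h ↔ (g : ChargeSpace c) - (h : ChargeSpace c) ∈ L := by
  rw [sectorClass, sectorClass, Submodule.Quotient.eq]
  rfl

variable (L) in
/-- The energy and the sector of a basis state. -/
def stateLabel (i : StateIndex L) :
    ℝ × (dualLattice L ⧸ Submodule.comap (dualLattice L).subtype L) :=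
  (stateEnergy i, sectorClass L i.1)

variable (L) in
/-- The operators that preserve energy and sector. -/
abbrev gradedOperators : Subalgebra ℂ (Operator L) := blockAlgebra (stateBasis L) (stateLabel L)

variable (L) in
/-- The part of energy `w` of a sector. -/
abbrev gradedPart (w : ℝ) (lam : dualLattice L) : Submodule ℂ (StateSpace L) :=
  blockSpace (stateBasis L) (stateLabel L) (w, sectorClass L lam)

theorem stateBasis_repr_energy (v : StateSpace L) (i : StateIndex L) :
    (stateBasis L).repr (energy L v) i = stateEnergy i * (stateBasis L).repr v i := by
  classical
  rw [repr_apply_eq_sum, Finsupp.sum]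
  simp only [energy_stateBasis, map_smul, Basis.repr_self, Finsupp.smul_apply, smul_eq_mul]
  rw [Finset.sum_eq_single i]
  · simp [mul_comm]
  · intro k _ hk; simp [Finsupp.single_eq_of_ne hk.symm]
  · intro h; rw [Finsupp.notMem_support_iff.1 h, zero_mul]

theorem sector_inf_energySpace (lam : dualLattice L) (w : ℝ) :
    sector L lam ⊓ energySpace L w = gradedPart L w lam := by
  ext v
  simp only [Submodule.mem_inf, sector, Finsupp.mem_supported', Set.mem_ofPred_eq, energySpace,
    Module.End.mem_eigenspace_iff]
  constructor
  · rintro ⟨h1, h2⟩ i hi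
    have h3 := congrArg (fun u => (stateBasis L).repr u i) h2
    simp only [stateBasis_repr_energy, map_smul, Finsupp.smul_apply, smul_eq_mul] at h3
    refine Prod.ext ?_ (sectorClass_eq_iff.2 ?_)
    · exact_mod_cast mul_right_cancel₀ hi h3
    · by_contra h
      exact hi (by rw [stateBasis_repr, h1 i.1 h, coeff_zero])
  · intro h
    constructor
    · intro g hg
      ext m
      rw [coeff_zero, ← stateBasis_repr v (g, m)]
      by_contra h'
      exact hg (sectorClass_eq_iff.1 (congrArg Prod.snd (h _ h')))
    · refine (stateBasis L).repr.injective (Finsupp.ext fun i => ?_)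
      rw [stateBasis_repr_energy, map_smul, Finsupp.smul_apply, smul_eq_mul]
      by_cases hi : (stateBasis L).repr v i = 0
      · rw [hi, mul_zero, mul_zero]
      · have h1 : stateEnergy i = w := congrArg Prod.fst (h i hi)
        rw [h1]

theorem mem_blockAlgebra_of_eigen {A : Operator L} {μ : StateIndex L → ℂ}
    (h : ∀ i, A (stateBasis L i) = μ i • stateBasis L i) : A ∈ gradedOperators L := by
  intro i j hij
  rw [h, map_smul, Basis.repr_self, Finsupp.smul_apply, smul_eq_mul] at hij
  by_contra hne
  refine right_ne_zero_of_mul hij (Finsupp.single_eq_of_ne fun h' => hne (by rw [h']))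

theorem energy_mem : energy L ∈ gradedOperators L := mem_blockAlgebra_of_eigen energy_stateBasis

theorem cartanMode_zero_stateBasis (v : Fin c → ℂ) (i : StateIndex L) :
    cartanMode L v 0 (stateBasis L i)
      = (∑ k, v k * (((i.1 : ChargeSpace c) k : ℝ) : ℂ)) • stateBasis L i := by
  rw [stateBasis_apply]
  change sectorwise L id _ _ = _
  rw [sectorwise_single, LinearMap.smul_apply, Finsupp.smul_single]
  rfl

theorem cartanMode_zero_mem (v : Fin c → ℂ) : cartanMode L v 0 ∈ gradedOperators L :=
  mem_blockAlgebra_of_eigen (cartanMode_zero_stateBasis v)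

variable [IsIntegralLattice L] (ε : Cocycle L)

omit [IsIntegralLattice L] in
theorem pairing_cast (a : L) (g : dualLattice L) :
    ((pairing (a : ChargeSpace c) (g : ChargeSpace c) : ℤ) : ℝ)
      = inner ℝ (a : ChargeSpace c) (g : ChargeSpace c) := by
  obtain ⟨k, hk⟩ := g.2 a.1 a.2
  rw [real_inner_comm] at hk
  rw [pairing, hk, Int.floor_intCast]

omit [IsIntegralLattice L] in
theorem root_sum_mul_self (a : Root L) :
    ∑ i, (a.1 : ChargeSpace c) i * (a.1 : ChargeSpace c) i = 2 := by
  have h := a.2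
  rw [PiLp.inner_apply] at h
  simpa [pow_two] using h

/-- On charge `g` the oscillator number changes by `-1 - (a|g)`, while `½|g + a|² - ½|g|² = (a|g) +
1` because `|a|² = 2`. The charge moves by an element of `L`, so the class is kept. -/
theorem vertexMode_zero_mem (a : Root L) : vertexMode ε a.1 0 ∈ gradedOperators L := by
  intro i j h
  rw [stateBasis_repr, stateBasis_apply, vertexMode, sectorwise_single, Finsupp.single_apply] at h
  split_ifs at h with h1
  swap
  · simp at h
  rw [LinearMap.smul_apply, coeff_smul] at h
  have h2 := right_ne_zero_of_smul h
  set n : ℤ := -0 - 1 - pairing (a.1 : ChargeSpace c) (j.1 : ChargeSpace c) with hn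
  have h3 : oscNumber c (bosonExp (a.1 : ChargeSpace c) n (monomial j.2 1))
      = C (((oscDegree j.2 : ℤ) + n : ℤ) : ℂ)
        * bosonExp (a.1 : ChargeSpace c) n (monomial j.2 1) := by
    rw [oscNumber_bosonExp, oscNumber_monomial, bosonExp_C_mul]
    push_cast
    rw [C_add]; ring
  have h4 : (oscDegree i.2 : ℤ) = oscDegree j.2 + n := by
    by_contra h5
    refine h2 (coeff_eq_zero_of_oscNumber h3 ?_)
    exact_mod_cast h5
  have h6 : (oscDegree i.2 : ℝ) = oscDegree j.2 + (-1 -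
      inner ℝ ((a.1 : L) : ChargeSpace c) (j.1 : ChargeSpace c)) := by
    rw [← pairing_cast]
    have := congrArg (Int.cast : ℤ → ℝ) h4
    rw [hn] at this
    push_cast at this
    linarith
  have h7 : (i.1 : ChargeSpace c) = j.1 + a.1 := by rw [← h1]; rfl
  refine Prod.ext ?_ (sectorClass_eq_iff.2 ?_)
  · change stateEnergy i = stateEnergy j
    rw [stateEnergy, stateEnergy, h6, h7, inner_add_left, inner_add_right, inner_add_right, a.2,
      real_inner_comm (j.1 : ChargeSpace c) (a.1 : ChargeSpace c)]
    ring
  · rw [h7, add_sub_cancel_left]; exact a.1.2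

theorem toOperator_mem (x : Currents L) : toOperator ε x ∈ gradedOperators L :=
  Subalgebra.add_mem _ (cartanMode_zero_mem _)
    (Subalgebra.sum_mem _ fun a _ => Subalgebra.smul_mem _ (vertexMode_zero_mem ε a) _)

end StateBasis

/-! ### Finiteness of the graded pieces and regrouping of traces by energy. -/

section Fibers

variable {c : ℕ} {L : Submodule ℤ (ChargeSpace c)} [IsIntegralLattice L]

/-- The basis states of the sector `λ + L`. -/
def sectorState (lam : dualLattice L) (y : L × (Fin c × ℕ →₀ ℕ)) : StateIndex L :=
  (toDual L y.1 + lam, y.2)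

theorem sectorState_injective (lam : dualLattice L) : Function.Injective (sectorState lam) := by
  rintro ⟨a, m⟩ ⟨b, n⟩ h
  have h1 : toDual L a + lam = toDual L b + lam := congrArg Prod.fst h
  have h2 : m = n := congrArg Prod.snd h
  refine Prod.ext (Subtype.ext ?_) h2
  exact congrArg (fun g : dualLattice L => (g : ChargeSpace c)) (add_right_cancel h1)

theorem stateLabel_sectorState (lam : dualLattice L) (y : L × (Fin c × ℕ →₀ ℕ)) :
    stateLabel L (sectorState lam y) = (stateEnergy (sectorState lam y), sectorClass L lam) := by
  refine Prod.ext rfl (sectorClass_eq_iff.2 ?_)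
  change (y.1 : ChargeSpace c) + lam - lam ∈ L
  rw [add_sub_cancel_right]; exact y.1.2

theorem exists_sectorState {lam : dualLattice L} {i : StateIndex L} {w : ℝ}
    (h : stateLabel L i = (w, sectorClass L lam)) :
    ∃ y, sectorState lam y = i ∧ stateEnergy (sectorState lam y) = w := by
  have h1 := sectorClass_eq_iff.1 (congrArg Prod.snd h)
  have h2 : sectorState lam (⟨_, h1⟩, i.2) = i :=
    Prod.ext (Subtype.ext (sub_add_cancel _ _)) rfl
  exact ⟨_, h2, by rw [h2]; exact congrArg Prod.fst h⟩

theorem stateEnergy_sectorState (lam : dualLattice L) (y : L × (Fin c × ℕ →₀ ℕ)) :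
    stateEnergy (sectorState lam y)
      = oscDegree y.2 + ‖(y.1 : ChargeSpace c) + lam‖ ^ 2 / 2 := by
  rw [← real_inner_self_eq_norm_sq]; rfl

omit [IsIntegralLattice L] in
theorem stateEnergy_nonneg (i : StateIndex L) : 0 ≤ stateEnergy i :=
  add_nonneg (Nat.cast_nonneg _) (div_nonneg real_inner_self_nonneg zero_le_two)

/-- Energy is oscillator number plus half the square charge, so the sum is the product of a
partition series and a Gaussian sum over the coset. -/
theorem summable_exp_neg_stateEnergy [DiscreteTopology L] (lam : dualLattice L) {t : ℝ}
    (ht : 0 < t) : Summable fun y => Real.exp (-t * stateEnergy (sectorState lam y)) := by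
  have h1 := summable_exp_neg_norm_sq L (lam : ChargeSpace c) (half_pos ht)
  have h2 := summable_norm_pow_oscDegree (c := c) (q := (Real.exp (-t) : ℝ)) (by
    rw [Complex.norm_real, Real.norm_eq_abs, Real.abs_exp, Real.exp_lt_one_iff]; linarith)
  refine (h1.mul_of_nonneg h2 (fun _ => (Real.exp_pos _).le) fun _ => norm_nonneg _).congr
    fun y => ?_
  rw [norm_pow, Complex.norm_real, Real.norm_eq_abs, Real.abs_exp, ← Real.exp_nat_mul,
    ← Real.exp_add, stateEnergy_sectorState]
  congr 1; ring

/-- A summable family tends to zero cofinitely, and on this set the family `exp (-E)` has the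
constant positive value `exp (-w)`. -/
theorem finite_sectorState [DiscreteTopology L] (lam : dualLattice L) (w : ℝ) :
    {y | stateEnergy (sectorState lam y) = w}.Finite := by
  have h := (summable_exp_neg_stateEnergy lam one_pos).tendsto_cofinite_zero
  have h1 := h.eventually (gt_mem_nhds (Real.exp_pos (-1 * w)))
  refine (Filter.eventually_cofinite.1 h1).subset fun y hy => ?_
  simp only [Set.mem_ofPred_eq] at hy ⊢
  rw [hy]
  exact lt_irrefl _

variable [DiscreteTopology L]

instance finite_stateLabel (x : ℝ × (dualLattice L ⧸ Submodule.comap (dualLattice L).subtype L)) :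
    Finite {i // stateLabel L i = x} := by
  obtain ⟨w, κ⟩ := x
  obtain ⟨lam, rfl⟩ := Submodule.Quotient.mk_surjective _ κ
  refine Set.Finite.to_subtype (s := {i | stateLabel L i = (w, sectorClass L lam)})
    (((finite_sectorState lam w).image (sectorState lam)).subset fun i hi => ?_)
  obtain ⟨y, h1, h2⟩ := exists_sectorState hi
  exact ⟨y, h2, h1⟩

instance fintype_stateLabel (x : ℝ × (dualLattice L ⧸ Submodule.comap (dualLattice L).subtype L)) :
    Fintype {i // stateLabel L i = x} := Fintype.ofFinite _

/-- The fibres of the energy on the states of a sector are the bases of its finite blocks, so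
grouping an absolutely convergent diagonal sum by energy gives the sum of the block traces. -/
theorem hasTrace_of_hasSum (lam : dualLattice L) {A : Operator L} (hA : A ∈ gradedOperators L)
    {t : ℂ} (h : HasSum (fun y => (stateBasis L).repr (A (stateBasis L (sectorState lam y)))
      (sectorState lam y)) t) :
    HasTrace (fun w => sector L lam ⊓ energySpace L w) A t := by
  simp only [sector_inf_energySpace]
  refine ⟨fun w => ⟨finiteDimensional_blockSpace _, fun x hx => apply_mem_blockSpace hA hx⟩, ?_⟩
  refine (h.tsum_fiberwise fun y => stateEnergy (sectorState lam y)).congr_fun fun w => ?_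
  rw [traceOn_blockSpace hA]
  have hb : Function.Bijective (fun y : (fun y => stateEnergy (sectorState lam y)) ⁻¹' {w} =>
      (⟨sectorState lam y.1, by rw [stateLabel_sectorState, show stateEnergy _ = w from y.2]⟩ :
        {i // stateLabel L i = (w, sectorClass L lam)})) := by
    constructor
    · intro y y' hyy
      exact Subtype.ext (sectorState_injective lam (congrArg Subtype.val hyy))
    · rintro ⟨i, hi⟩
      obtain ⟨y, h1, h2⟩ := exists_sectorState hi
      exact ⟨⟨y, h2⟩, Subtype.ext h1⟩
  have h1 := (Equiv.ofBijective _ hb).hasSum_iff.2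
    (hasSum_fintype fun i : {i // stateLabel L i = (w, sectorClass L lam)} =>
      (stateBasis L).repr (A (stateBasis L i)) i)
  exact h1.tsum_eq.symm

end Fibers

/-! ### Zero modes grow at most like the square root of the energy. -/

section EnergyBounds

open MvPolynomial Module

variable {c : ℕ} {L : Submodule ℤ (ChargeSpace c)}

theorem fockNormSq_eq_sum {p : Fock c} {s : Finset (Fin c × ℕ →₀ ℕ)} (hs : p.support ⊆ s) :
    fockNormSq p = ∑ m ∈ s, monomialNormSq m * ‖coeff m p‖ ^ 2 :=
  Finset.sum_subset hs fun m _ hm => by rw [notMem_support_iff.1 hm]; simp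

theorem fockNormSq_zero : fockNormSq (0 : Fock c) = 0 := by simp [fockNormSq]

theorem fockNormSq_add_le (p q : Fock c) :
    fockNormSq (p + q) ≤ 2 * fockNormSq p + 2 * fockNormSq q := by
  classical
  rw [fockNormSq_eq_sum (support_add (p := p) (q := q)),
    fockNormSq_eq_sum (p := p) Finset.subset_union_left,
    fockNormSq_eq_sum (p := q) Finset.subset_union_right, Finset.mul_sum, Finset.mul_sum,
    ← Finset.sum_add_distrib]
  refine Finset.sum_le_sum fun m _ => ?_
  have h1 : ‖coeff m (p + q)‖ ^ 2 ≤ 2 * ‖coeff m p‖ ^ 2 + 2 * ‖coeff m q‖ ^ 2 := by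
    rw [coeff_add]
    have h := pow_le_pow_left₀ (norm_nonneg _) (norm_add_le (coeff m p) (coeff m q)) 2
    nlinarith [sq_nonneg (‖coeff m p‖ - ‖coeff m q‖)]
  have h2 := mul_le_mul_of_nonneg_left h1 (monomialNormSq_pos m).le
  linarith

theorem fockNormSq_smul (t : ℂ) (p : Fock c) : fockNormSq (t • p) = ‖t‖ ^ 2 * fockNormSq p := by
  rw [fockNormSq_eq_sum (p := t • p) support_smul, fockNormSq, Finset.mul_sum]
  refine Finset.sum_congr rfl fun m _ => ?_
  rw [coeff_smul, smul_eq_mul, norm_mul]; ring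

theorem le_fockNormSq (p : Fock c) (m : Fin c × ℕ →₀ ℕ) :
    monomialNormSq m * ‖coeff m p‖ ^ 2 ≤ fockNormSq p := by
  classical
  rw [fockNormSq_eq_sum (Finset.subset_insert m p.support)]
  exact Finset.single_le_sum (f := fun m => monomialNormSq m * ‖coeff m p‖ ^ 2)
    (fun m _ => mul_nonneg (monomialNormSq_pos m).le (sq_nonneg _)) (Finset.mem_insert_self _ _)

/-- The square norm on the state space. -/
def stateNormSq (v : StateSpace L) : ℝ := ∑ g ∈ v.support, fockNormSq (v g)

theorem stateNormSq_eq_sum {v : StateSpace L} {s : Finset (dualLattice L)} (hs : v.support ⊆ s) :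
    stateNormSq v = ∑ g ∈ s, fockNormSq (v g) :=
  Finset.sum_subset hs fun g _ hg => by rw [Finsupp.notMem_support_iff.1 hg, fockNormSq_zero]

theorem stateNormSq_add_le (v w : StateSpace L) :
    stateNormSq (v + w) ≤ 2 * stateNormSq v + 2 * stateNormSq w := by
  classical
  rw [stateNormSq_eq_sum (Finsupp.support_add (g₁ := v) (g₂ := w)),
    stateNormSq_eq_sum (v := v) Finset.subset_union_left,
    stateNormSq_eq_sum (v := w) Finset.subset_union_right, Finset.mul_sum, Finset.mul_sum,
    ← Finset.sum_add_distrib]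
  exact Finset.sum_le_sum fun g _ => fockNormSq_add_le _ _

theorem stateNormSq_smul (t : ℂ) (v : StateSpace L) :
    stateNormSq (t • v) = ‖t‖ ^ 2 * stateNormSq v := by
  rw [stateNormSq_eq_sum (v := t • v) Finsupp.support_smul, stateNormSq, Finset.mul_sum]
  exact Finset.sum_congr rfl fun g _ => fockNormSq_smul _ _

theorem le_stateNormSq (v : StateSpace L) (i : StateIndex L) :
    monomialNormSq i.2 * ‖(stateBasis L).repr v i‖ ^ 2 ≤ stateNormSq v := by
  classical
  rw [stateBasis_repr]
  refine (le_fockNormSq _ _).trans ?_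
  rw [stateNormSq_eq_sum (Finset.subset_insert i.1 v.support)]
  exact Finset.single_le_sum (f := fun g => fockNormSq (v g))
    (fun g _ => fockNormSq_nonneg _) (Finset.mem_insert_self _ _)

theorem stateNormSq_stateBasis (i : StateIndex L) :
    stateNormSq (stateBasis L i) = monomialNormSq i.2 := by
  classical
  rw [stateBasis_apply, stateNormSq_eq_sum Finsupp.support_single_subset, Finset.sum_singleton,
    Finsupp.single_eq_same, fockNormSq_eq_sum support_monomial_subset, Finset.sum_singleton]
  simp

/-- Different charges are orthogonal and an injective shift keeps them apart, so the bound may be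
checked one charge at a time. -/
theorem stateNormSq_sectorwise_le {s : dualLattice L → dualLattice L} (hs : Function.Injective s)
    (f : dualLattice L → Module.End ℂ (Fock c)) (v : StateSpace L) (K : ℝ)
    (h : ∀ g, fockNormSq (f g (v g)) ≤ K * fockNormSq (v g)) :
    stateNormSq (sectorwise L s f v) ≤ K * stateNormSq v := by
  classical
  have h1 : (sectorwise L s f v).support ⊆ v.support.map ⟨s, hs⟩ := by
    intro g hg
    rw [Finsupp.mem_support_iff] at hg
    by_contra h2
    refine hg ?_
    by_cases h3 : g ∈ Set.range s
    · obtain ⟨g', rfl⟩ := h3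
      rw [sectorwise_apply hs]
      have : v g' = 0 := by
        by_contra h4
        exact h2 (Finset.mem_map_of_mem ⟨s, hs⟩ (Finsupp.mem_support_iff.2 h4))
      rw [this, map_zero]
    · exact sectorwise_apply_eq_zero f v h3
  rw [stateNormSq_eq_sum h1, Finset.sum_map, stateNormSq, Finset.mul_sum]
  refine Finset.sum_le_sum fun g _ => ?_
  rw [Function.Embedding.coeFn_mk, sectorwise_apply hs]
  exact h g

variable (L) in
/-- The operators whose square norm grows at most linearly with the energy. -/
def energyBounded : Submodule ℂ (Operator L) where
  carrier := {A | ∃ K : ℝ, 0 ≤ K ∧ ∀ x, ∀ u ∈ blockSpace (stateBasis L) (stateLabel L) x,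
    stateNormSq (A u) ≤ K * (x.1 + 1) * stateNormSq u}
  add_mem' := by
    rintro A B ⟨K, hK, hA⟩ ⟨K', hK', hB⟩
    refine ⟨2 * K + 2 * K', by positivity, fun x u hu => ?_⟩
    have h1 := stateNormSq_add_le (A u) (B u)
    have h2 := hA x u hu
    have h3 := hB x u hu
    rw [LinearMap.add_apply]
    nlinarith
  zero_mem' := ⟨0, le_rfl, fun x u _ => by simp [stateNormSq]⟩
  smul_mem' := by
    rintro t A ⟨K, hK, hA⟩
    refine ⟨‖t‖ ^ 2 * K, by positivity, fun x u hu => ?_⟩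
    rw [LinearMap.smul_apply, stateNormSq_smul]
    have h := mul_le_mul_of_nonneg_left (hA x u hu) (sq_nonneg ‖t‖)
    linarith

/-- A nonzero component of a homogeneous vector has a definite oscillator number. -/
theorem exists_oscNumber_component
    {x : ℝ × (dualLattice L ⧸ Submodule.comap (dualLattice L).subtype L)} {u : StateSpace L}
    (hu : u ∈ blockSpace (stateBasis L) (stateLabel L) x) (g : dualLattice L) (hg : u g ≠ 0) :
    ∃ N : ℕ, oscNumber c (u g) = C (N : ℂ) * u g
      ∧ (N : ℝ) + ‖(g : ChargeSpace c)‖ ^ 2 / 2 = x.1 := by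
  have key : ∀ m, coeff m (u g) ≠ 0 →
      (oscDegree m : ℝ) + ‖(g : ChargeSpace c)‖ ^ 2 / 2 = x.1 := by
    intro m hm
    rw [← stateBasis_repr u (g, m)] at hm
    have h := congrArg Prod.fst (hu _ hm)
    rw [← real_inner_self_eq_norm_sq]
    exact h
  obtain ⟨m, hm⟩ := ne_zero_iff.1 hg
  refine ⟨oscDegree m, ?_, key m hm⟩
  ext m'
  rw [coeff_oscNumber, coeff_C_mul]
  by_cases hm' : coeff m' (u g) = 0
  · rw [hm', mul_zero, mul_zero]
  · have h1 := key m hm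
    have h2 := key m' hm'
    have : oscDegree m' = oscDegree m := by
      have : (oscDegree m' : ℝ) = oscDegree m := by linarith
      exact_mod_cast this
    rw [this]

/-- Cauchy-Schwarz, with half the square charge bounded by the energy. -/
theorem cartanMode_mem_energyBounded (v : Fin c → ℂ) : cartanMode L v 0 ∈ energyBounded L := by
  refine ⟨2 * ∑ k, ‖v k‖ ^ 2, by positivity, fun x u hu => ?_⟩
  refine stateNormSq_sectorwise_le Function.injective_id _ u _ fun g => ?_
  by_cases hg : u g = 0
  · rw [hg, map_zero, fockNormSq_zero, mul_zero]
  obtain ⟨N, -, hN⟩ := exists_oscNumber_component hu g hg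
  rw [LinearMap.smul_apply, LinearMap.id_apply, fockNormSq_smul]
  refine mul_le_mul_of_nonneg_right ?_ (fockNormSq_nonneg _)
  have h1 : ‖∑ k, v k * (((g : ChargeSpace c) k : ℝ) : ℂ)‖
      ≤ ∑ k, ‖v k‖ * |(g : ChargeSpace c) k| := by
    refine (norm_sum_le _ _).trans (le_of_eq (Finset.sum_congr rfl fun k _ => ?_))
    rw [norm_mul, Complex.norm_real, Real.norm_eq_abs]
  have h2 := Finset.sum_mul_sq_le_sq_mul_sq Finset.univ (fun k => ‖v k‖)
    fun k => |(g : ChargeSpace c) k|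
  have h3 : ∑ k, |(g : ChargeSpace c) k| ^ 2 = ‖(g : ChargeSpace c)‖ ^ 2 := by
    rw [EuclideanSpace.norm_sq_eq]; rfl
  rw [h3] at h2
  have h4 := pow_le_pow_left₀ (norm_nonneg _) h1 2
  have h5 : (0 : ℝ) ≤ ∑ k, ‖v k‖ ^ 2 := by positivity
  have h6 : (0 : ℝ) ≤ N := Nat.cast_nonneg N
  nlinarith

variable [IsIntegralLattice L] (ε : Cocycle L)

/-- With `P = (a|g)`, `m = -1 - P` and `e = 4N + P²`, the constant of `fockNormSq_bosonExp_le` is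
`2N + P²/4 - P/2 + 2`. The energy is at least `N + P²/4`, since `|a|² = 2`, so three times the
energy plus one suffices. -/
theorem vertexMode_mem_energyBounded (a : Root L) : vertexMode ε a.1 0 ∈ energyBounded L := by
  refine ⟨3, by norm_num, fun x u hu => ?_⟩
  refine stateNormSq_sectorwise_le (add_left_injective _) _ u _ fun g => ?_
  by_cases hg : u g = 0
  · rw [hg, map_zero, fockNormSq_zero, mul_zero]
  obtain ⟨N, hN, hx⟩ := exists_oscNumber_component hu g hg
  rw [LinearMap.smul_apply, fockNormSq_smul]
  have h1 : ‖(((ε.sign a.1 g : ℤˣ) : ℤ) : ℂ)‖ = 1 := by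
    rcases Int.units_eq_one_or (ε.sign a.1 g) with h | h <;> simp [h]
  rw [h1, one_pow, one_mul]
  set P := pairing (a.1 : ChargeSpace c) (g : ChargeSpace c) with hP
  have hP2 : (P : ℝ) ^ 2 ≤ 2 * ‖(g : ChargeSpace c)‖ ^ 2 := by
    have ha : ‖((a.1 : L) : ChargeSpace c)‖ ^ 2 = 2 := by
      rw [← real_inner_self_eq_norm_sq]; exact a.2
    rw [hP, pairing_cast, ← sq_abs]
    refine (pow_le_pow_left₀ (abs_nonneg _) (abs_real_inner_le_norm _ _) 2).trans (le_of_eq ?_)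
    rw [mul_pow, ha]
  set m : ℤ := -0 - 1 - P with hm
  have hm' : (m : ℝ) = -1 - P := by rw [hm]; push_cast; ring
  have h2 := fockNormSq_bosonExp_le (a.1 : ChargeSpace c) (root_sum_mul_self a)
    (4 * N + (m + 1) ^ 2) (m + 1 + (4 * N + (m + 1) ^ 2) + 1).toNat m N
    (by
      have : m + 1 + (4 * N + (m + 1) ^ 2) + 1 ≤
        ((m + 1 + (4 * (N : ℤ) + (m + 1) ^ 2) + 1).toNat : ℤ) := Int.self_le_toNat _
      omega)
    rfl (u g) (by exact_mod_cast hN)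
  refine h2.trans (mul_le_mul_of_nonneg_right ?_ (fockNormSq_nonneg _))
  push_cast
  rw [hm']
  nlinarith [sq_nonneg ((P : ℝ) + 1), Nat.cast_nonneg (α := ℝ) N, sq_nonneg (P : ℝ)]

theorem toOperator_mem_energyBounded (x : Currents L) : toOperator ε x ∈ energyBounded L :=
  Submodule.add_mem _ (cartanMode_mem_energyBounded _)
    (Submodule.sum_mem _ fun a _ => Submodule.smul_mem _ _ (vertexMode_mem_energyBounded ε a))

omit [IsIntegralLattice L] in
-- All powers of `A` keep the energy of the basis vector, so each application costs the same factor
-- `√κ`, and the exponential series is dominated by that of `√κ`.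
theorem exists_norm_diagonal_le {A T : Operator L} (hA : A ∈ gradedOperators L)
    (hb : A ∈ energyBounded L) (hT : IsExp A T) :
    ∃ K : ℝ, 0 ≤ K ∧ ∀ i, ‖(stateBasis L).repr (T (stateBasis L i)) i‖
      ≤ Real.exp (Real.sqrt (K * (stateEnergy i + 1))) := by
  obtain ⟨K, hK, hA'⟩ := hb
  refine ⟨K, hK, fun i => ?_⟩
  set κ := K * (stateEnergy i + 1) with hκ
  have hκ0 : 0 ≤ κ := mul_nonneg hK (by linarith [stateEnergy_nonneg i])
  have h1 : ∀ k : ℕ, (A ^ k) (stateBasis L i) ∈ blockSpace (stateBasis L) (stateLabel L)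
      (stateLabel L i) ∧ stateNormSq ((A ^ k) (stateBasis L i)) ≤ κ ^ k * monomialNormSq i.2 := by
    intro k
    induction k with
    | zero =>
      refine ⟨basis_mem_blockSpace i, ?_⟩
      rw [pow_zero, pow_zero, Module.End.one_apply, stateNormSq_stateBasis, one_mul]
    | succ k ih =>
      rw [pow_succ', Module.End.mul_apply]
      refine ⟨apply_mem_blockSpace hA ih.1, (hA' _ _ ih.1).trans ?_⟩
      rw [pow_succ', mul_assoc κ]
      exact mul_le_mul_of_nonneg_left ih.2 hκ0
  have h2 : ∀ k : ℕ, ‖(stateBasis L).repr ((A ^ k) (stateBasis L i)) i‖ ≤ Real.sqrt κ ^ k := by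
    intro k
    refine (abs_le_of_sq_le_sq' ?_ (pow_nonneg (Real.sqrt_nonneg _) _)).2
    rw [← pow_mul, mul_comm k, pow_mul, Real.sq_sqrt hκ0]
    -- The entry is diagonal, so the weight of the basis vector stands on both sides and cancels.
    have h3 := (le_stateNormSq ((A ^ k) (stateBasis L i)) i).trans (h1 k).2
    have h4 := monomialNormSq_pos i.2
    rw [mul_comm] at h3
    exact le_of_mul_le_mul_right h3 h4
  have h3 := (isBasisExp_iff A T).2 hT (stateBasis L i) i
  have h4 : HasSum (fun k : ℕ => Real.sqrt κ ^ k / (Nat.factorial k : ℝ))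
      (Real.exp (Real.sqrt κ)) := by
    rw [Real.exp_eq_exp_ℝ]; exact NormedSpace.expSeries_div_hasSum_exp _
  refine h3.norm_le_of_bounded h4 fun k => ?_
  rw [norm_mul, norm_inv, Complex.norm_natCast, div_eq_inv_mul]
  exact mul_le_mul_of_nonneg_left (h2 k) (by positivity)

end EnergyBounds

/-! ### Operator exponentials, convergence of characters, theta functions. -/

section Exponentials

open Module

variable {c : ℕ} {L : Submodule ℤ (ChargeSpace c)} [IsIntegralLattice L]

omit [IsIntegralLattice L] in
theorem IsExp.unique {A T T' : Operator L} (h : IsExp A T) (h' : IsExp A T') : T = T' :=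
  ((isBasisExp_iff A T).2 h).unique ((isBasisExp_iff A T').2 h')

omit [IsIntegralLattice L] in
theorem IsExp.opExp_eq {A T : Operator L} (h : IsExp A T) : opExp A = T := by
  have h1 : ∃ T, IsExp A T := ⟨T, h⟩
  rw [opExp, dif_pos h1]
  exact h1.choose_spec.unique h

omit [IsIntegralLattice L] in
theorem IsExp.apply_eigenvector {A T : Operator L} (h : IsExp A T) {v : StateSpace L} {t : ℂ}
    (hv : A v = t • v) : T v = Complex.exp t • v :=
  ((isBasisExp_iff A T).2 h).apply_eigenvector hv

variable [DiscreteTopology L]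

open Classical in
theorem exists_isExp {A : Operator L} (hA : A ∈ gradedOperators L) :
    ∃ T ∈ gradedOperators L, IsExp A T :=
  ⟨(blockExp (stateBasis L) (stateLabel L) ⟨A, hA⟩).1, (blockExp _ _ _).2,
    (isBasisExp_iff _ _).1 (isBasisExp_blockExp (⟨A, hA⟩ : gradedOperators L))⟩

theorem isExp_opExp {A : Operator L} (hA : A ∈ gradedOperators L) : IsExp A (opExp A) := by
  obtain ⟨T, -, hT⟩ := exists_isExp hA
  rwa [hT.opExp_eq]

theorem opExp_mem {A : Operator L} (hA : A ∈ gradedOperators L) : opExp A ∈ gradedOperators L := by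
  obtain ⟨T, hT, hT'⟩ := exists_isExp hA
  rwa [hT'.opExp_eq]

open Classical in
theorem opExp_eq_blockExp {A : Operator L} (hA : A ∈ gradedOperators L) :
    opExp A = (blockExp (stateBasis L) (stateLabel L) ⟨A, hA⟩).1 :=
  IsExp.opExp_eq ((isBasisExp_iff _ _).1 (isBasisExp_blockExp (⟨A, hA⟩ : gradedOperators L)))

theorem opExp_add {A B : Operator L} (hA : A ∈ gradedOperators L) (hB : B ∈ gradedOperators L)
    (h : Commute A B) : opExp (A + B) = opExp A * opExp B := by
  classical
  rw [opExp_eq_blockExp hA, opExp_eq_blockExp hB,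
    opExp_eq_blockExp (Subalgebra.add_mem _ hA hB)]
  have h1 : Commute (⟨A, hA⟩ : gradedOperators L) ⟨B, hB⟩ := Subtype.ext h
  exact congrArg Subtype.val (blockExp_add h1)

theorem opExp_semiconj {X A B : Operator L} (hX : X ∈ gradedOperators L)
    (hA : A ∈ gradedOperators L) (hB : B ∈ gradedOperators L) (h : SemiconjBy X A B) :
    SemiconjBy X (opExp A) (opExp B) := by
  classical
  rw [opExp_eq_blockExp hA, opExp_eq_blockExp hB]
  have h1 : SemiconjBy (⟨X, hX⟩ : gradedOperators L) ⟨A, hA⟩ ⟨B, hB⟩ := Subtype.ext h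
  exact congrArg Subtype.val (blockExp_semiconj h1)

theorem opExp_smul_one (t : ℂ) : opExp (t • (1 : Operator L)) = Complex.exp t • 1 :=
  LinearMap.ext fun v => (isExp_opExp (Subalgebra.smul_mem _ (Subalgebra.one_mem _)
    _)).apply_eigenvector (by simp)

omit [IsIntegralLattice L] [DiscreteTopology L] in
theorem commute_energy {A : Operator L} (hA : A ∈ gradedOperators L) : Commute (energy L) A := by
  refine (stateBasis L).ext fun i => (stateBasis L).repr.injective (Finsupp.ext fun j => ?_)
  rw [Module.End.mul_apply, Module.End.mul_apply, stateBasis_repr_energy, energy_stateBasis,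
    map_smul, map_smul, Finsupp.smul_apply, smul_eq_mul]
  by_cases h : (stateBasis L).repr (A (stateBasis L i)) j = 0
  · rw [h, mul_zero, mul_zero]
  · have h1 : stateEnergy j = stateEnergy i := congrArg Prod.fst (hA j i h)
    rw [h1]

theorem IsExp.mem_gradedOperators {A T : Operator L} (hA : A ∈ gradedOperators L)
    (h : IsExp A T) : T ∈ gradedOperators L := by
  rw [← h.opExp_eq]; exact opExp_mem hA

variable (ε : Cocycle L)

theorem opExp_mul_opExp_neg_one_smul {A : Operator L} (hA : A ∈ gradedOperators L) :
    opExp A * opExp ((-1 : ℂ) • A) = 1 := by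
  have h : A + (-1 : ℂ) • A = (0 : ℂ) • (1 : Operator L) := by
    have h1 : A + (-1 : ℂ) • A = (1 + (-1) : ℂ) • A := by rw [add_smul, one_smul]
    rw [h1, add_neg_cancel, zero_smul, zero_smul]
  have h2 : Commute A ((-1 : ℂ) • A) := by
    rw [Commute, SemiconjBy, mul_smul_comm, smul_mul_assoc]
  rw [← opExp_add hA (Subalgebra.smul_mem _ hA _) h2, h, opExp_smul_one, Complex.exp_zero,
    one_smul]

theorem IsExp.units_inv_mem {A : Operator L} {h : (Operator L)ˣ} (hA : A ∈ gradedOperators L)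
    (hh : IsExp A h) : ((h⁻¹ : (Operator L)ˣ) : Operator L) ∈ gradedOperators L := by
  have h1 := opExp_mul_opExp_neg_one_smul hA
  rw [hh.opExp_eq] at h1
  have h2 : ((h⁻¹ : (Operator L)ˣ) : Operator L) = opExp ((-1 : ℂ) • A) :=
    Units.inv_eq_of_mul_eq_one_right h1
  rw [h2]
  exact opExp_mem (Subalgebra.smul_mem _ hA _)

omit [DiscreteTopology L] in
theorem two_pi_I_smul_mem (x : Currents L) :
    (2 * Real.pi * Complex.I) • toOperator ε x ∈ gradedOperators L :=
  Subalgebra.smul_mem _ (toOperator_mem ε x) _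

/-- Inverses are carried through the induction, because a subalgebra need not contain them; for a
generator `e^A` the inverse is `e^{-A}`. -/
theorem gaugeGroup_mem {g : (Operator L)ˣ} (hg : g ∈ gaugeGroup ε) :
    (g : Operator L) ∈ gradedOperators L ∧
      ((g⁻¹ : (Operator L)ˣ) : Operator L) ∈ gradedOperators L := by
  refine Subgroup.closure_induction (p := fun (g : (Operator L)ˣ) _ =>
    (g : Operator L) ∈ gradedOperators L ∧
      ((g⁻¹ : (Operator L)ˣ) : Operator L) ∈ gradedOperators L) ?_ ?_ ?_ ?_ hg
  · rintro h ⟨x, -, hx⟩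
    exact ⟨IsExp.mem_gradedOperators (two_pi_I_smul_mem ε x) hx,
      IsExp.units_inv_mem (two_pi_I_smul_mem ε x) hx⟩
  · rw [inv_one, Units.val_one]
    exact ⟨(gradedOperators L).one_mem, (gradedOperators L).one_mem⟩
  · rintro g h - - ⟨hg, hg'⟩ ⟨hh, hh'⟩
    rw [mul_inv_rev, Units.val_mul, Units.val_mul]
    exact ⟨(gradedOperators L).mul_mem hg hh, (gradedOperators L).mul_mem hh' hg'⟩
  · rintro g - ⟨hg, hg'⟩
    rw [inv_inv]
    exact ⟨hg', hg⟩

omit [IsIntegralLattice L] [DiscreteTopology L] in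
theorem energyShift_stateBasis (s t : ℂ) (i : StateIndex L) :
    (s • (energy L - t • (1 : Operator L))) (stateBasis L i)
      = (s * (stateEnergy i - t)) • stateBasis L i := by
  rw [LinearMap.smul_apply, LinearMap.sub_apply, energy_stateBasis, LinearMap.smul_apply,
    Module.End.one_apply, ← sub_smul, smul_smul]

omit [IsIntegralLattice L] [DiscreteTopology L] in
theorem energyShift_mem (s t : ℂ) : s • (energy L - t • (1 : Operator L)) ∈ gradedOperators L :=
  mem_blockAlgebra_of_eigen (energyShift_stateBasis s t)

theorem characterOperator_mem (τ : ℂ) (x : Currents L) :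
    characterOperator ε τ x ∈ gradedOperators L :=
  Subalgebra.mul_mem _ (opExp_mem (energyShift_mem _ _))
    (opExp_mem (Subalgebra.smul_mem _ (toOperator_mem ε x) _))

omit [IsIntegralLattice L] [DiscreteTopology L] in
theorem stateBasis_repr_diagonal {D : Operator L} {μ : StateIndex L → ℂ}
    (hD : ∀ i, D (stateBasis L i) = μ i • stateBasis L i) (v : StateSpace L) (i : StateIndex L) :
    (stateBasis L).repr (D v) i = μ i * (stateBasis L).repr v i := by
  classical
  rw [repr_apply_eq_sum, Finsupp.sum]
  simp only [hD, map_smul, Basis.repr_self, Finsupp.smul_apply, smul_eq_mul]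
  rw [Finset.sum_eq_single i]
  · simp [mul_comm]
  · intro k _ hk; simp [Finsupp.single_eq_of_ne hk.symm]
  · intro h; rw [Finsupp.notMem_support_iff.1 h, zero_mul]

theorem opExp_energyShift_stateBasis (s t : ℂ) (i : StateIndex L) :
    opExp (s • (energy L - t • (1 : Operator L))) (stateBasis L i)
      = Complex.exp (s * (stateEnergy i - t)) • stateBasis L i := by
  exact (isExp_opExp (energyShift_mem s t)).apply_eigenvector
    (energyShift_stateBasis s t i)

theorem characterOperator_diagonal (τ : ℂ) (x : Currents L) (i : StateIndex L) :
    (stateBasis L).repr (characterOperator ε τ x (stateBasis L i)) i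
      = Complex.exp (2 * Real.pi * Complex.I * τ * (stateEnergy i - (c : ℂ) / 24))
        * (stateBasis L).repr
          (opExp ((2 * Real.pi * Complex.I) • toOperator ε x) (stateBasis L i)) i := by
  rw [characterOperator, Module.End.mul_apply]
  exact stateBasis_repr_diagonal (opExp_energyShift_stateBasis _ _) _ i

theorem norm_exp_energy (τ : ℂ) (E k : ℝ) :
    ‖Complex.exp (2 * Real.pi * Complex.I * τ * (E - k))‖
      = Real.exp (-(2 * Real.pi * τ.im) * (E - k)) := by
  rw [Complex.norm_exp]
  congr 1
  simp [Complex.mul_re, Complex.mul_im]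

theorem hasSum_latticeCharacter {τ : ℂ} (hτ : 0 < τ.im) (lam : dualLattice L) (x : Currents L) :
    HasSum (fun y => (stateBasis L).repr (characterOperator ε τ x
        (stateBasis L (sectorState lam y))) (sectorState lam y)) (latticeCharacter ε lam τ x) ∧
    HasTrace (fun w => sector L lam ⊓ energySpace L w) (characterOperator ε τ x)
      (latticeCharacter ε lam τ x) := by
  have hA : (2 * Real.pi * Complex.I) • toOperator ε x ∈ gradedOperators L :=
    Subalgebra.smul_mem _ (toOperator_mem ε x) _
  obtain ⟨K, hK, hb⟩ := exists_norm_diagonal_le hA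
    (Submodule.smul_mem _ _ (toOperator_mem_energyBounded ε x)) (isExp_opExp hA)
  -- Since `|q^E| = e^{-2tE}`, half of the decay pays for the growth of `e^{2πi x}` and the other
  -- half for the number of states.
  set t : ℝ := Real.pi * τ.im with ht
  have ht0 : 0 < t := mul_pos Real.pi_pos hτ
  have hsum : Summable (fun y => (stateBasis L).repr (characterOperator ε τ x
        (stateBasis L (sectorState lam y))) (sectorState lam y)) := by
    refine Summable.of_norm_bounded ((summable_exp_neg_stateEnergy lam ht0).mul_left
      (Real.exp (2 * t * (c / 24) + t + K / (4 * t)))) fun y => ?_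
    set i := sectorState lam y
    rw [characterOperator_diagonal, norm_mul]
    have h1 := norm_exp_energy τ (stateEnergy i) (c / 24)
    push_cast at h1
    rw [h1]
    refine (mul_le_mul_of_nonneg_left (hb i) (Real.exp_pos _).le).trans ?_
    rw [← Real.exp_add, ← Real.exp_add]
    refine Real.exp_le_exp.2 ?_
    have hE := stateEnergy_nonneg i
    -- The arithmetic-geometric mean inequality: the product of the two terms on the right is `K (E
    -- + 1) / 4`.
    have h2 : Real.sqrt (K * (stateEnergy i + 1)) ≤ t * (stateEnergy i + 1) + K / (4 * t) := by
      rw [Real.sqrt_le_left (by positivity)]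
      have h3 : (t * (stateEnergy i + 1) + K / (4 * t)) ^ 2 = K * (stateEnergy i + 1)
          + (t * (stateEnergy i + 1) - K / (4 * t)) ^ 2 := by
        field_simp; ring
      rw [h3]
      linarith [sq_nonneg (t * (stateEnergy i + 1) - K / (4 * t))]
    rw [show 2 * Real.pi * τ.im = 2 * t by rw [ht]; ring]
    linarith
  have h1 := hasTrace_of_hasSum lam (characterOperator_mem ε τ x) hsum.hasSum
  have h2 : latticeCharacter ε lam τ x = _ := h1.2.tsum_eq
  rw [h2]
  exact ⟨hsum.hasSum, h1⟩

theorem opExp_cartan_stateBasis (v : Fin c → ℂ) (i : StateIndex L) :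
    opExp ((2 * Real.pi * Complex.I) • toOperator ε (cartan L v)) (stateBasis L i)
      = Complex.exp (2 * Real.pi * Complex.I *
          ∑ k, v k * (((i.1 : ChargeSpace c) k : ℝ) : ℂ)) • stateBasis L i := by
  refine (isExp_opExp (Subalgebra.smul_mem _ (toOperator_mem ε _) _)).apply_eigenvector ?_
  have h : toOperator ε (cartan L v) = cartanMode L v 0 := by
    simp [toOperator, cartan]
  rw [LinearMap.smul_apply, h, cartanMode_zero_stateBasis, smul_smul]

/-- The basis is diagonal for a Cartan element. Summing over the monomials at a fixed charge gives
the same oscillator product for every charge, and the theta series remains. -/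
theorem latticeCharacter_cartan {τ : ℂ} (hτ : 0 < τ.im) (lam : dualLattice L) (v : Fin c → ℂ) :
    HasSum (fun γ : L => 1 / ModularForm.eta τ ^ c *
        (Complex.exp (2 * Real.pi * Complex.I * τ *
          ((inner ℝ ((γ : EuclideanSpace ℝ (Fin c)) + lam)
            ((γ : EuclideanSpace ℝ (Fin c)) + lam) / 2 : ℝ) : ℂ)) *
        Complex.exp (2 * Real.pi * Complex.I *
          ∑ i, (((γ : EuclideanSpace ℝ (Fin c)) + lam) i : ℂ) * v i)))
      (latticeCharacter ε lam τ (cartan L v)) := by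
  set q : ℂ := Complex.exp (2 * Real.pi * Complex.I * τ) with hq
  have hq1 : ‖q‖ < 1 := by
    have h := norm_exp_energy τ 1 0
    simp only [Complex.ofReal_one, Complex.ofReal_zero, sub_zero, mul_one] at h
    rw [hq, h, Real.exp_lt_one_iff]
    nlinarith [Real.pi_pos]
  refine (hasSum_latticeCharacter ε hτ lam (cartan L v)).1.prod_fiberwise fun γ => ?_
  have h1 := (hasSum_pow_oscDegree (c := c) hq1).mul_left
    (Complex.exp (-(2 * Real.pi * Complex.I * τ * ((c : ℂ) / 24))) *
      (Complex.exp (2 * Real.pi * Complex.I * τ *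
          ((inner ℝ ((γ : EuclideanSpace ℝ (Fin c)) + lam)
            ((γ : EuclideanSpace ℝ (Fin c)) + lam) / 2 : ℝ) : ℂ)) *
        Complex.exp (2 * Real.pi * Complex.I *
          ∑ i, (((γ : EuclideanSpace ℝ (Fin c)) + lam) i : ℂ) * v i)))
  -- The shift of `L₀` by `c/24` provides the `c` factors `q^{1/24}` of the eta functions.
  have heta : (1 : ℂ) / ModularForm.eta τ ^ c
      = Complex.exp (-(2 * Real.pi * Complex.I * τ * ((c : ℂ) / 24)))
        * ((∏' n : ℕ, (1 - q ^ (n + 1))) ^ c)⁻¹ := by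
    have h2 : ∀ n, ModularForm.eta_q n τ = q ^ (n + 1) := fun n => by
      rw [ModularForm.eta_q_eq_pow]
    rw [ModularForm.eta, mul_pow, one_div, mul_inv]
    simp only [h2]
    congr 1
    rw [Function.Periodic.qParam, ← Complex.exp_nat_mul, ← Complex.exp_neg]
    congr 1
    push_cast
    ring
  rw [heta, mul_right_comm]
  refine h1.congr_fun fun m => ?_
  rw [characterOperator_diagonal, opExp_cartan_stateBasis, map_smul, Basis.repr_self,
    Finsupp.smul_apply, Finsupp.single_eq_same, smul_eq_mul, mul_one, hq, ← Complex.exp_nat_mul,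
    ← Complex.exp_add, ← Complex.exp_add, ← Complex.exp_add, ← Complex.exp_add]
  congr 1
  have h3 : ∑ k, v k * ((((sectorState lam (γ, m)).1 : ChargeSpace c) k : ℝ) : ℂ)
      = ∑ i, (((γ : EuclideanSpace ℝ (Fin c)) + lam) i : ℂ) * v i :=
    Finset.sum_congr rfl fun k _ => mul_comm _ _
  have h4 : ((stateEnergy (sectorState lam (γ, m)) : ℝ) : ℂ) = (oscDegree m : ℂ)
      + ((inner ℝ ((γ : EuclideanSpace ℝ (Fin c)) + lam)
            ((γ : EuclideanSpace ℝ (Fin c)) + lam) / 2 : ℝ) : ℂ) := by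
    change (((oscDegree m : ℝ) + inner ℝ ((γ : EuclideanSpace ℝ (Fin c)) + lam)
            ((γ : EuclideanSpace ℝ (Fin c)) + lam) / 2 : ℝ) : ℂ) = _
    push_cast; rfl
  rw [h3, h4]
  ring

/-- The gauge group preserves the blocks and commutes with the energy, so `g` conjugates the
character operators and leaves each finite trace unchanged. The series agree term by term, and
convergence is not needed. -/
theorem latticeCharacter_conj (lam : dualLattice L) (τ : ℂ) (x y : Currents L)
    {g : (Operator L)ˣ} (hg : g ∈ gaugeGroup ε)
    (h : toOperator ε x = (g : Operator L) * toOperator ε y * ((g⁻¹ : (Operator L)ˣ) :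
          Operator L)) :
    latticeCharacter ε lam τ x = latticeCharacter ε lam τ y := by
  obtain ⟨h1, h2⟩ := gaugeGroup_mem ε hg
  have h3 : SemiconjBy (g : Operator L) ((2 * Real.pi * Complex.I) • toOperator ε y)
      ((2 * Real.pi * Complex.I) • toOperator ε x) := by
    rw [SemiconjBy, h, mul_smul_comm, smul_mul_assoc, Units.inv_mul_cancel_right]
  have h4 := opExp_semiconj h1 (Subalgebra.smul_mem _ (toOperator_mem ε y) _)
    (Subalgebra.smul_mem _ (toOperator_mem ε x) _) h3
  have h5 : SemiconjBy (g : Operator L) (characterOperator ε τ y) (characterOperator ε τ x) := by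
    refine SemiconjBy.mul_right ?_ h4
    refine opExp_semiconj h1 (energyShift_mem _ _) (energyShift_mem _ _) ?_
    have h6 : Commute (g : Operator L) (energy L) := (commute_energy h1).symm
    have h7 : Commute (g : Operator L) (energy L - ((c : ℂ) / 24) • (1 : Operator L)) := by
      refine LinearMap.ext fun v => ?_
      have h8 := LinearMap.congr_fun h6.eq v
      simp only [Module.End.mul_apply, LinearMap.sub_apply, LinearMap.smul_apply,
        Module.End.one_apply, map_sub, map_smul] at h8 ⊢
      rw [h8]
    rw [SemiconjBy, mul_smul_comm, smul_mul_assoc, h7.eq]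
  have h6 : characterOperator ε τ x = g * characterOperator ε τ y * (g⁻¹ : (Operator L)ˣ) := by
    rw [h5.eq, Units.mul_inv_cancel_right]
  rw [latticeCharacter, latticeCharacter, h6]
  refine tsum_congr fun w => ?_
  rw [sector_inf_energySpace]
  exact traceOn_blockSpace_conj h1 h2 (characterOperator_mem ε τ y) (Units.inv_mul g) _

end Exponentials

/-! ### Traces on invariant subspaces, images of projections and spaces of maps. -/

section TraceOn

variable {M : Type*} [AddCommGroup M] [Module ℂ M]

theorem traceOn_eq {N : Submodule ℂ M} {A : Module.End ℂ M} (h : ∀ x ∈ N, A x ∈ N) :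
    traceOn N A = LinearMap.trace ℂ N (A.restrict h) := by
  rw [traceOn, dif_pos h]

/-- The trace over an invariant subspace is linear in the operator. -/
theorem exists_traceOn_eq (N : Submodule ℂ M) : ∃ φ : Module.End ℂ M →ₗ[ℂ] ℂ,
    ∀ A : Module.End ℂ M, (∀ x ∈ N, A x ∈ N) → traceOn N A = φ A := by
  -- A projection `q` onto `N` turns the trace of the restriction into the trace of `q A` on `N`, an
  -- expression linear in `A` on the whole endomorphism algebra.
  obtain ⟨q, hq⟩ := LinearMap.exists_leftInverse_of_injective N.subtype N.ker_subtype
  refine ⟨(LinearMap.trace ℂ N).comp ((LinearMap.compRight ℂ q).comp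
    (LinearMap.lcomp ℂ M N.subtype)), fun A hA => ?_⟩
  rw [traceOn_eq hA]
  refine congrArg (LinearMap.trace ℂ N) (LinearMap.ext fun x => ?_)
  exact (LinearMap.congr_fun hq ⟨A x, hA x x.2⟩).symm

theorem traceOn_sum_smul {ι : Type*} (s : Finset ι) {N : Submodule ℂ M} (a : ι → ℂ)
    (A : ι → Module.End ℂ M) (hA : ∀ i, ∀ x ∈ N, A i x ∈ N) :
    traceOn N (∑ i ∈ s, a i • A i) = ∑ i ∈ s, a i * traceOn N (A i) := by
  obtain ⟨φ, hφ⟩ := exists_traceOn_eq N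
  rw [hφ _ fun x hx => by
    rw [LinearMap.sum_apply]
    exact N.sum_mem fun i _ => N.smul_mem _ (hA i x hx), map_sum]
  refine Finset.sum_congr rfl fun i _ => ?_
  rw [hφ _ (hA i), map_smul, smul_eq_mul]

/-- Cyclicity of the trace: on `N` the operator `P T` factors through `P N`, and the factors
composed in the other order give `T` on `P N`, where `P` is the identity. -/
theorem traceOn_map_projection {N : Submodule ℂ M} [FiniteDimensional ℂ N]
    {P T : Module.End ℂ M} (hP : ∀ x ∈ N, P x ∈ N) (hT : ∀ x ∈ N, T x ∈ N) (hPP : P * P = P)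
    (hTP : Commute T P) : traceOn (N.map P) T = traceOn N (P * T) := by
  have hle : N.map P ≤ N := Submodule.map_le_iff_le_comap.2 hP
  have : FiniteDimensional ℂ (N.map P) := Submodule.finiteDimensional_of_le hle
  have hT' : ∀ x ∈ N.map P, T x ∈ N.map P := by
    rintro _ ⟨x, hx, rfl⟩
    exact ⟨T x, hT x hx, (LinearMap.congr_fun hTP.eq x).symm⟩
  rw [traceOn_eq hT', traceOn_eq (A := P * T) fun x hx => hP _ (hT x hx)]
  let P' : N →ₗ[ℂ] N.map P := P.restrict fun x hx => ⟨x, hx, rfl⟩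
  let T' : N →ₗ[ℂ] N := T.restrict hT
  let i : N.map P →ₗ[ℂ] N := Submodule.inclusion hle
  have h1 : (P * T).restrict (fun x hx => hP _ (hT x hx)) = i ∘ₗ (P' ∘ₗ T') := rfl
  rw [h1, LinearMap.trace_comp_comm']
  refine congrArg _ (LinearMap.ext fun x => Subtype.ext ?_)
  obtain ⟨x, y, hy, rfl⟩ := x
  change T (P y) = P (T (P y))
  have h2 := LinearMap.congr_fun hTP.eq (P y)
  have h3 := LinearMap.congr_fun hPP y
  simp only [Module.End.mul_apply] at h2 h3
  rw [← h2, h3]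

theorem trace_restrict_of_isProj {p : Submodule ℂ M} [FiniteDimensional ℂ M]
    {P T : Module.End ℂ M} (hP : LinearMap.IsProj p P) (hT : ∀ x ∈ p, T x ∈ p) :
    LinearMap.trace ℂ p (T.restrict hT) = LinearMap.trace ℂ M (T * P) := by
  let P' : M →ₗ[ℂ] p := P.codRestrict p hP.map_mem
  have h1 : T * P = (T ∘ₗ p.subtype) ∘ₗ P' := rfl
  rw [h1, LinearMap.trace_comp_comm']
  refine congrArg _ (LinearMap.ext fun x => Subtype.ext ?_)
  exact (hP.map_id _ (hT x x.2)).symm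

/-- Under `Hom(V, W) = V* ⊗ W` the map is the transpose of `B` tensored with `A`. -/
theorem trace_hom {V W : Type*} [AddCommGroup V] [Module ℂ V] [FiniteDimensional ℂ V]
    [AddCommGroup W] [Module ℂ W] [FiniteDimensional ℂ W] (A : Module.End ℂ W)
    (B : Module.End ℂ V) :
    LinearMap.trace ℂ (V →ₗ[ℂ] W) (LinearMap.compRight ℂ A ∘ₗ LinearMap.lcomp ℂ W B)
      = LinearMap.trace ℂ W A * LinearMap.trace ℂ V B := by
  have h : LinearMap.compRight ℂ A ∘ₗ LinearMap.lcomp ℂ W B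
      = (dualTensorHomEquiv ℂ V W).conj (TensorProduct.map (Module.Dual.transpose B) A) := by
    refine LinearMap.ext fun f => ?_
    obtain ⟨t, rfl⟩ := (dualTensorHomEquiv ℂ V W).surjective f
    rw [LinearEquiv.conj_apply_apply, LinearEquiv.symm_apply_apply]
    induction t with
    | zero => simp
    | add x y hx hy => simp only [map_add, hx, hy]
    | tmul φ w => ext v; simp [Module.Dual.transpose_apply]
  rw [h, LinearMap.trace_conj', LinearMap.trace_tensorProduct', LinearMap.trace_transpose',
    mul_comm]

end TraceOn

/-! ### Characters of a finite group: unitarity, Schur's lemma, convolution. -/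

section Characters

open Representation

variable {K V : Type*} [Group K] [Fintype K] [AddCommGroup V] [Module ℂ V]
  [FiniteDimensional ℂ V] (ρ : Representation ℂ K V)

open scoped ComplexOrder in
/-- The character of a finite group takes conjugate values on inverse elements. -/
theorem star_character (g : K) : (starRingEnd ℂ) (ρ.character g) = ρ.character g⁻¹ := by
  classical
  let b := Module.finBasis ℂ V
  let R : K → Matrix _ _ ℂ := fun k => LinearMap.toMatrix b b (ρ k)
  have hR : ∀ k, ρ.character k = (R k).trace := fun k => LinearMap.trace_eq_matrix_trace ℂ b _
  have hmul : ∀ k l, R (k * l) = R k * R l := fun k l => by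
    simp only [R, map_mul, LinearMap.toMatrix_mul]
  have h1 : R 1 = 1 := by simp [R]
  -- Averaging gives an invariant Hermitian form, positive definite because of the term `k = 1`.
  -- Each `R g` is unitary for it, so the conjugate transpose of `R g` is similar to `R g⁻¹`.
  let H := ∑ k, (R k).conjTranspose * R k
  have hH : IsUnit H := by
    refine Matrix.PosDef.isUnit ?_
    have h2 : H = (R 1).conjTranspose * R 1
        + ∑ k ∈ Finset.univ.erase 1, (R k).conjTranspose * R k :=
      (Finset.add_sum_erase _ _ (Finset.mem_univ 1)).symm
    rw [h2, h1, Matrix.conjTranspose_one, one_mul]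
    exact Matrix.PosDef.one.add_posSemidef
      (Matrix.posSemidef_sum _ fun k _ => Matrix.posSemidef_conjTranspose_mul_self _)
  have hHg : H * R g⁻¹ = (R g).conjTranspose * H := by
    simp only [H]
    rw [Finset.sum_mul, Finset.mul_sum, ← Equiv.sum_comp (Equiv.mulRight g)]
    refine Finset.sum_congr rfl fun k _ => ?_
    rw [Equiv.coe_mulRight, mul_assoc, ← hmul, mul_inv_cancel_right, hmul,
      Matrix.conjTranspose_mul, mul_assoc]
  rw [hR, hR, starRingEnd_apply, ← Matrix.trace_conjTranspose]
  obtain ⟨u, hu⟩ := hH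
  have h3 : (R g).conjTranspose = u * (R g⁻¹ * (u⁻¹ : (Matrix _ _ ℂ)ˣ)) := by
    rw [← mul_assoc, hu, hHg, ← hu, Units.mul_inv_cancel_right]
  rw [h3, Matrix.trace_mul_comm, Units.inv_mul_cancel_right]

omit [Fintype K] in
/-- Schur's lemma. -/
theorem eq_smul_one_of_commute [ρ.IsIrreducible] {f : Module.End ℂ V}
    (hf : ∀ k, Commute f (ρ k)) : ∃ s : ℂ, f = s • 1 := by
  let F : IntertwiningMap ρ ρ := ⟨f, fun k => (hf k).eq⟩
  obtain ⟨s, hs⟩ :=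
    (IsIrreducible.algebraMap_intertwiningMap_bijective_of_isAlgClosed (ρ := ρ)).2 F
  refine ⟨s, ?_⟩
  have h := congrArg IntertwiningMap.toLinearMap hs
  rw [← show F.toLinearMap = f from rfl, ← h]
  rfl

omit [Fintype K] in
theorem character_one_ne_zero [ρ.IsIrreducible] : ρ.character 1 ≠ 0 := by
  rw [char_one, Nat.cast_ne_zero]
  intro h
  have h0 : Subsingleton V := Module.finrank_zero_iff.1 h
  have h1 : (⊥ : Subrepresentation ρ) = ⊤ := by
    ext v
    simp [Subsingleton.elim v 0]
  exact bot_ne_top h1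

theorem card_ne_zero : (Nat.card K : ℂ) ≠ 0 := Nat.cast_ne_zero.2 Nat.card_pos.ne'

/-- The sum commutes with `ρ`, as characters are class functions, so it is a scalar by Schur;
orthonormality of characters gives its trace. -/
theorem sum_character_inv_smul [ρ.IsIrreducible] :
    ∑ k, ρ.character k⁻¹ • ρ k = ((Nat.card K : ℂ) / ρ.character 1) • 1 := by
  obtain ⟨s, hs⟩ := eq_smul_one_of_commute ρ (f := ∑ k, ρ.character k⁻¹ • ρ k) fun g => by
    rw [Commute, SemiconjBy, Finset.sum_mul, Finset.mul_sum,
      ← Equiv.sum_comp (MulAut.conj g).toEquiv]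
    refine Finset.sum_congr rfl fun k _ => ?_
    have h1 : (MulAut.conj g).toEquiv k = g * k * g⁻¹ := rfl
    have h2 : (g * k * g⁻¹)⁻¹ = g * k⁻¹ * g⁻¹ := by group
    rw [h1, h2, char_conj, smul_mul_assoc, mul_smul_comm, ← map_mul, ← map_mul,
      inv_mul_cancel_right]
  rw [hs]
  have h1 := congrArg (LinearMap.trace ℂ V) hs
  let _ : Invertible (Nat.card K : ℂ) := invertibleOfNonzero card_ne_zero
  have h2 := char_orthonormal ρ ρ
  rw [if_pos ⟨Representation.Equiv.refl ρ⟩] at h2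
  rw [map_sum, map_smul, LinearMap.trace_one, ← char_one ρ] at h1
  simp only [map_smul, smul_eq_mul] at h1
  have h3 : ∑ k, ρ.character k⁻¹ * LinearMap.trace ℂ V (ρ k) = Nat.card K := by
    rw [inv_mul_eq_one₀ card_ne_zero] at h2
    rw [h2]
    exact Finset.sum_congr rfl fun k _ => mul_comm _ _
  rw [← h3, h1, mul_div_cancel_right₀ _ (character_one_ne_zero ρ)]

/-- The convolution identity of irreducible characters. -/
theorem sum_character_mul_character [ρ.IsIrreducible] (g : K) :
    ∑ k, ρ.character k⁻¹ * ρ.character (k * g)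
      = (Nat.card K : ℂ) / ρ.character 1 * ρ.character g := by
  have h := congrArg (fun f => LinearMap.trace ℂ V (f * ρ g)) (sum_character_inv_smul ρ)
  simp only [Finset.sum_mul, map_sum, smul_mul_assoc, map_smul, smul_eq_mul, ← map_mul,
    one_mul] at h
  exact h

end Characters

/-! ### Isotypic projections and multiplicity spaces. -/

section Multiplicity

open Representation

variable {K V M : Type*} [Group K] [Fintype K] [AddCommGroup V] [Module ℂ V]
  [FiniteDimensional ℂ V] [AddCommGroup M] [Module ℂ M] (ρ : Representation ℂ K V)
  (π : Representation ℂ K M)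

/-- The projection to the isotypic component. -/
def isotypicProjection : Module.End ℂ M :=
  (ρ.character 1 / (Nat.card K : ℂ)) • ∑ k, ρ.character k⁻¹ • π k

/-- Multiplying the two sums convolves the character with itself, which by
`sum_character_mul_character` only rescales it; the prefactor `σ(1)/|K|` compensates. -/
theorem isotypicProjection_mul_self [ρ.IsIrreducible] :
    isotypicProjection ρ π * isotypicProjection ρ π = isotypicProjection ρ π := by
  have h : (∑ k, ρ.character k⁻¹ • π k) * (∑ k, ρ.character k⁻¹ • π k)
      = ((Nat.card K : ℂ) / ρ.character 1) • ∑ k, ρ.character k⁻¹ • π k := by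
    rw [Finset.sum_mul]
    have h1 : ∀ k, (ρ.character k⁻¹ • π k) * ∑ l, ρ.character l⁻¹ • π l
        = ∑ m, (ρ.character k⁻¹ * ρ.character (k * m⁻¹)) • π m := fun k => by
      rw [Finset.mul_sum, ← Equiv.sum_comp (Equiv.mulLeft k⁻¹)]
      refine Finset.sum_congr rfl fun m _ => ?_
      rw [Equiv.coe_mulLeft, smul_mul_assoc, mul_smul_comm, smul_smul, ← map_mul,
        mul_inv_cancel_left, mul_inv_rev, inv_inv, char_mul_comm]
    simp only [h1]
    rw [Finset.sum_comm, Finset.smul_sum]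
    refine Finset.sum_congr rfl fun m _ => ?_
    rw [← Finset.sum_smul, sum_character_mul_character, smul_smul]
  rw [isotypicProjection, smul_mul_assoc, mul_smul_comm, h, smul_smul, smul_smul]
  congr 1
  have h1 := character_one_ne_zero ρ
  have h2 := card_ne_zero (K := K)
  field_simp

omit [FiniteDimensional ℂ V] in
-- Translating the summation variable by `h` moves `h` into the character, where it comes out as its
-- scalar `s`.
theorem isotypicProjection_mul_of_scalar {h : K} {s : ℂ} (hs : ρ h = s • 1) :
    isotypicProjection ρ π * π h = s • isotypicProjection ρ π := by
  rw [isotypicProjection, smul_mul_assoc, smul_comm s]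
  congr 1
  rw [Finset.sum_mul, Finset.smul_sum, ← Equiv.sum_comp (Equiv.mulRight h⁻¹)]
  refine Finset.sum_congr rfl fun k _ => ?_
  rw [Equiv.coe_mulRight, smul_mul_assoc, ← map_mul, inv_mul_cancel_right, mul_inv_rev, inv_inv,
    smul_smul]
  congr 1
  rw [character, map_mul, hs, smul_mul_assoc, one_mul, map_smul, smul_eq_mul, character]

variable {π} {N : Submodule ℂ M} (hN : ∀ k, ∀ x ∈ N, π k x ∈ N)

include hN in
omit [FiniteDimensional ℂ V] in
theorem isotypicProjection_mem {x : M} (hx : x ∈ N) : isotypicProjection ρ π x ∈ N := by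
  rw [isotypicProjection, LinearMap.smul_apply, LinearMap.sum_apply]
  exact N.smul_mem _ (N.sum_mem fun k _ => N.smul_mem _ (hN k x hx))

omit [FiniteDimensional ℂ V] in
theorem commute_isotypicProjection {T : Module.End ℂ M} (hT : ∀ k, Commute T (π k)) :
    Commute T (isotypicProjection ρ π) :=
  (Commute.sum_right _ _ _ fun k _ => (hT k).smul_right _).smul_right _

include hN in
theorem traceOn_map_isotypicProjection [ρ.IsIrreducible] [FiniteDimensional ℂ N]
    {T : Module.End ℂ M} (hT : ∀ x ∈ N, T x ∈ N) (hTπ : ∀ k, Commute T (π k)) :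
    traceOn (N.map (isotypicProjection ρ π)) T = ρ.character 1 *
      ((Nat.card K : ℂ)⁻¹ * ∑ k, ρ.character k⁻¹ * traceOn N (π k * T)) := by
  rw [traceOn_map_projection (fun x hx => isotypicProjection_mem ρ hN hx) hT
    (isotypicProjection_mul_self ρ π) (commute_isotypicProjection ρ hTπ), isotypicProjection,
    smul_mul_assoc, Finset.sum_mul, Finset.smul_sum]
  simp only [smul_mul_assoc, smul_smul]
  rw [traceOn_sum_smul _ _ (fun k => π k * T) fun k x hx => hN k _ (hT x hx), ← mul_assoc, Finset.mul_sum]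
  refine Finset.sum_congr rfl fun k _ => ?_
  rw [div_eq_mul_inv, mul_assoc]

variable (π N) in
/-- The equivariant maps into an invariant subspace. -/
def equivariantMaps : Submodule ℂ (V →ₗ[ℂ] M) where
  carrier := {f | (∀ v, f v ∈ N) ∧ ∀ k v, f (ρ k v) = π k (f v)}
  add_mem' := fun hf hg => ⟨fun v => N.add_mem (hf.1 v) (hg.1 v), fun k v => by
    simp [hf.2 k v, hg.2 k v]⟩
  zero_mem' := ⟨fun v => N.zero_mem, fun k v => by simp⟩
  smul_mem' := fun t f hf => ⟨fun v => N.smul_mem t (hf.1 v), fun k v => by simp [hf.2 k v]⟩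

/-- A representation restricted to an invariant subspace. -/
def restrictRepresentation : Representation ℂ K N where
  toFun k := (π k).restrict (hN k)
  map_one' := by ext; simp
  map_mul' := fun k l => by ext; simp

/-- Equivariant maps into an invariant subspace, as invariants. -/
def equivariantMapsEquiv :
    equivariantMaps ρ π N ≃ₗ[ℂ] (linHom ρ (restrictRepresentation hN)).invariants where
  toFun f := ⟨f.1.codRestrict N f.2.1, fun k => by
    ext v
    change π k (f.1 (ρ k⁻¹ v)) = f.1 v
    rw [← f.2.2, ← Module.End.mul_apply, ← map_mul, mul_inv_cancel, map_one,
      Module.End.one_apply]⟩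
  map_add' _ _ := rfl
  map_smul' _ _ := rfl
  invFun f := ⟨N.subtype ∘ₗ f.1, fun v => (f.1 v).2, fun k v => by
    have h := congrArg Subtype.val (LinearMap.congr_fun (f.2 k) (ρ k v))
    change π k (f.1 (ρ k⁻¹ (ρ k v))) = f.1 (ρ k v) at h
    rw [← Module.End.mul_apply, ← map_mul, inv_mul_cancel, map_one,
      Module.End.one_apply] at h
    exact h.symm⟩
  left_inv _ := rfl
  right_inv _ := rfl

include hN in
omit [Fintype K] in
theorem finiteDimensional_equivariantMaps [FiniteDimensional ℂ N] :
    FiniteDimensional ℂ (equivariantMaps ρ π N) :=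
  Module.Finite.equiv (equivariantMapsEquiv ρ hN).symm

omit [Fintype K] [FiniteDimensional ℂ V] in
theorem compRight_mem_equivariantMaps {T : Module.End ℂ M} (hT : ∀ x ∈ N, T x ∈ N)
    (hTπ : ∀ k, Commute T (π k)) {f : V →ₗ[ℂ] M} (hf : f ∈ equivariantMaps ρ π N) :
    LinearMap.compRight ℂ T f ∈ equivariantMaps ρ π N :=
  ⟨fun v => hT _ (hf.1 v), fun k v => by
    change T (f (ρ k v)) = π k (T (f v))
    rw [hf.2]
    exact LinearMap.congr_fun (hTπ k).eq (f v)⟩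

include hN in
-- Equivariant maps are the invariants of `Hom(V, N)`, the image of the averaging projection. The
-- trace is thus the average over `k` of the traces of `f ↦ T π(k) f ρ(k⁻¹)`, which `trace_hom`
-- evaluates.
theorem traceOn_equivariantMaps [FiniteDimensional ℂ N] {T : Module.End ℂ M}
    (hT : ∀ x ∈ N, T x ∈ N) (hTπ : ∀ k, Commute T (π k)) :
    traceOn (equivariantMaps ρ π N) (LinearMap.compRight ℂ T)
      = (Nat.card K : ℂ)⁻¹ * ∑ k, ρ.character k⁻¹ * traceOn N (π k * T) := by
  let _ : Invertible (Fintype.card K : ℂ) := invertibleOfNonzero (by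
    rw [Fintype.card_eq_nat_card]; exact card_ne_zero)
  let πN := restrictRepresentation hN
  let TN : Module.End ℂ N := T.restrict hT
  let S : Module.End ℂ (V →ₗ[ℂ] N) := LinearMap.compRight ℂ TN
  have hS : ∀ f ∈ (linHom ρ πN).invariants, S f ∈ (linHom ρ πN).invariants := by
    intro f hf k
    ext v
    have h := congrArg (fun x : N => T x) (LinearMap.congr_fun (hf k) v)
    change T (π k (f (ρ k⁻¹ v))) = T (f v) at h
    change π k (T (f (ρ k⁻¹ v))) = T (f v)
    rw [← h]
    exact (LinearMap.congr_fun (hTπ k).eq _).symm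
  rw [traceOn_eq fun f hf => compRight_mem_equivariantMaps ρ hT hTπ hf,
    ← LinearMap.trace_conj' (N := (linHom ρ πN).invariants) _ (equivariantMapsEquiv ρ hN)]
  have h1 : (equivariantMapsEquiv ρ hN).conj ((LinearMap.compRight ℂ T).restrict
      fun f hf => compRight_mem_equivariantMaps ρ hT hTπ hf) = S.restrict hS := rfl
  rw [h1, trace_restrict_of_isProj (isProj_averageMap (linHom ρ πN)) hS, averageMap,
    GroupAlgebra.average, map_smul, map_sum, mul_smul_comm, map_smul, Finset.mul_sum, map_sum,
    smul_eq_mul, invOf_eq_inv, Fintype.card_eq_nat_card]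
  congr 1
  refine Finset.sum_congr rfl fun k _ => ?_
  rw [asAlgebraHom_of]
  have h2 : S * linHom ρ πN k
      = LinearMap.compRight ℂ (TN * πN k) ∘ₗ LinearMap.lcomp ℂ N (ρ k⁻¹) := rfl
  rw [h2, trace_hom, mul_comm, traceOn_eq (A := π k * T) fun x hx => hN k _ (hT x hx)]
  congr 2
  ext x
  exact LinearMap.congr_fun (hTπ k).eq x

end Multiplicity

/-! ### Linearity of the action of the currents. -/

section Linearity

variable {c : ℕ} {L : Submodule ℤ (ChargeSpace c)}

theorem cartanMode_zero_add (v w : Fin c → ℂ) :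
    cartanMode L (v + w) 0 = cartanMode L v 0 + cartanMode L w 0 := by
  refine (stateBasis L).ext fun i => ?_
  rw [LinearMap.add_apply, cartanMode_zero_stateBasis, cartanMode_zero_stateBasis,
    cartanMode_zero_stateBasis, ← add_smul, ← Finset.sum_add_distrib]
  simp only [Pi.add_apply, add_mul]

theorem cartanMode_zero_smul (t : ℂ) (v : Fin c → ℂ) :
    cartanMode L (t • v) 0 = t • cartanMode L v 0 := by
  refine (stateBasis L).ext fun i => ?_
  rw [LinearMap.smul_apply, cartanMode_zero_stateBasis, cartanMode_zero_stateBasis, smul_smul,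
    Finset.mul_sum]
  simp only [Pi.smul_apply, smul_eq_mul, mul_assoc]

variable [IsIntegralLattice L] (ε : Cocycle L)

theorem toOperator_add (x y : Currents L) :
    toOperator ε (x + y) = toOperator ε x + toOperator ε y := by
  classical
  let F : Root L → ℂ → Operator L := fun a t => t • vertexMode ε a.1 0
  have h : (x.2 + y.2).sum F = x.2.sum F + y.2.sum F :=
    Finsupp.sum_add_index' (fun _ => zero_smul _ _) (fun _ _ _ => add_smul _ _ _)
  change cartanMode L (x.1 + y.1) 0 + (x.2 + y.2).sum F
    = cartanMode L x.1 0 + x.2.sum F + (cartanMode L y.1 0 + y.2.sum F)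
  rw [h, cartanMode_zero_add, add_add_add_comm]

theorem toOperator_smul (t : ℂ) (x : Currents L) :
    toOperator ε (t • x) = t • toOperator ε x := by
  let F : Root L → ℂ → Operator L := fun a t => t • vertexMode ε a.1 0
  have h : (t • x.2).sum F = t • x.2.sum F := by
    refine (Finsupp.sum_smul_index' (h := F) fun _ => zero_smul _ _).trans ?_
    rw [Finsupp.smul_sum]
    exact Finset.sum_congr rfl fun a _ => smul_assoc _ _ _
  change cartanMode L (t • x.1) 0 + (t • x.2).sum F = t • (cartanMode L x.1 0 + x.2.sum F)
  rw [h, cartanMode_zero_smul, smul_add]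

theorem toOperator_cartan (v : Fin c → ℂ) : toOperator ε (cartan L v) = cartanMode L v 0 := by
  simp [toOperator, cartan]

end Linearity

/-! ### Sectors and the central elements of the gauge group. -/

section Sectors

variable {c : ℕ} {L : Submodule ℤ (ChargeSpace c)}

theorem mem_sector_iff {lam : dualLattice L} {v : StateSpace L} : v ∈ sector L lam ↔
    ∀ i, (stateBasis L).repr v i ≠ 0 → sectorClass L i.1 = sectorClass L lam := by
  rw [sector, Finsupp.mem_supported']
  constructor
  · intro h i hi
    by_contra h'
    exact hi (by rw [stateBasis_repr, h i.1 fun h1 => h' (sectorClass_eq_iff.2 h1),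
      MvPolynomial.coeff_zero])
  · intro h g hg
    ext m
    rw [MvPolynomial.coeff_zero, ← stateBasis_repr v (g, m)]
    by_contra h'
    exact hg (sectorClass_eq_iff.1 (h _ h'))

theorem apply_mem_sector {A : Operator L} (hA : A ∈ gradedOperators L) {lam : dualLattice L}
    {v : StateSpace L} (hv : v ∈ sector L lam) : A v ∈ sector L lam := by
  have h : sector L lam
      = blockSpace (stateBasis L) (fun i => sectorClass L i.1) (sectorClass L lam) := by
    ext v; exact mem_sector_iff
  rw [h] at hv ⊢
  exact apply_mem_blockSpace (fun i j hij => congrArg Prod.snd (hA i j hij)) hv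

theorem apply_mem_sector_inf_energySpace {A : Operator L} (hA : A ∈ gradedOperators L)
    {lam : dualLattice L} {w : ℝ} : ∀ v ∈ sector L lam ⊓ energySpace L w,
      A v ∈ sector L lam ⊓ energySpace L w := by
  rw [sector_inf_energySpace]
  exact fun v hv => apply_mem_blockSpace hA hv

/-- Vectors of `L*` pair integrally with the difference `g - λ ∈ L`, so the phase depends only on
the class. -/
theorem phase_eq (mu : dualLattice L) {g lam : dualLattice L}
    (h : sectorClass L g = sectorClass L lam) :
    Complex.exp (2 * Real.pi * Complex.I *
        ((inner ℝ (mu : ChargeSpace c) (g : ChargeSpace c) : ℝ) : ℂ))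
      = Complex.exp (2 * Real.pi * Complex.I *
        ((inner ℝ (mu : ChargeSpace c) (lam : ChargeSpace c) : ℝ) : ℂ)) := by
  obtain ⟨k, hk⟩ := mu.2 _ (sectorClass_eq_iff.1 h)
  have h1 : inner ℝ (mu : ChargeSpace c) (g : ChargeSpace c)
      = inner ℝ (mu : ChargeSpace c) (lam : ChargeSpace c) + k := by
    rw [← hk, inner_sub_right]; ring
  rw [h1, Complex.ofReal_add, mul_add, Complex.exp_add, Complex.ofReal_intCast,
    mul_comm (2 * Real.pi * Complex.I) (k : ℂ), Complex.exp_int_mul_two_pi_mul_I, mul_one]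

variable [IsIntegralLattice L] (ε : Cocycle L)

/-- The action of a central element `e^{2πi μ}` on the basis states. -/
theorem IsExpOf.apply_stateBasis {mu : dualLattice L} {h : (Operator L)ˣ}
    (hh : IsExpOf ε h (ofReal L (mu : ChargeSpace c))) (i : StateIndex L) :
    (h : Operator L) (stateBasis L i) = Complex.exp (2 * Real.pi * Complex.I *
        ((inner ℝ (mu : ChargeSpace c) (i.1 : ChargeSpace c) : ℝ) : ℂ)) • stateBasis L i := by
  refine IsExp.apply_eigenvector hh ?_
  rw [LinearMap.smul_apply, ofReal, toOperator_cartan, cartanMode_zero_stateBasis, smul_smul,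
    PiLp.inner_apply]
  congr 2
  push_cast
  refine Finset.sum_congr rfl fun k _ => ?_
  simp [mul_comm]

theorem IsExpOf.apply_sector {mu lam : dualLattice L} {h : (Operator L)ˣ}
    (hh : IsExpOf ε h (ofReal L (mu : ChargeSpace c))) {v : StateSpace L}
    (hv : v ∈ sector L lam) :
    (h : Operator L) v = Complex.exp (2 * Real.pi * Complex.I *
        ((inner ℝ (mu : ChargeSpace c) (lam : ChargeSpace c) : ℝ) : ℂ)) • v := by
  refine (stateBasis L).repr.injective (Finsupp.ext fun i => ?_)
  rw [stateBasis_repr_diagonal (hh.apply_stateBasis ε), map_smul, Finsupp.smul_apply, smul_eq_mul]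
  by_cases hi : (stateBasis L).repr v i = 0
  · rw [hi, mul_zero, mul_zero]
  · rw [phase_eq mu (mem_sector_iff.1 hv i hi)]

/-- The central element is a scalar on each sector, and graded operators preserve sectors. -/
theorem IsExpOf.commute {mu : dualLattice L} {h : (Operator L)ˣ}
    (hh : IsExpOf ε h (ofReal L (mu : ChargeSpace c))) {A : Operator L}
    (hA : A ∈ gradedOperators L) : Commute (h : Operator L) A := by
  refine (stateBasis L).ext fun i => ?_
  have h1 : stateBasis L i ∈ sector L i.1 := by
    rw [mem_sector_iff]
    intro j hj
    rw [Module.Basis.repr_self] at hj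
    by_contra h'
    exact hj (Finsupp.single_eq_of_ne fun h2 => h' (by rw [h2]))
  rw [Module.End.mul_apply, Module.End.mul_apply, hh.apply_sector ε (apply_mem_sector hA h1),
    hh.apply_stateBasis ε, map_smul]

end Sectors

/-! ### The group action on states and the agreement of `σ` and `λ`. -/

section Action

variable {c : ℕ} {L : Submodule ℤ (ChargeSpace c)} (K : Subgroup (Operator L)ˣ)

/-- The representation of a group of operators on the state space. -/
def stateRepresentation : Representation ℂ K (StateSpace L) :=
  (Units.coeHom (Operator L)).comp K.subtype

variable {K} {V : Type*} [AddCommGroup V] [Module ℂ V] [FiniteDimensional ℂ V]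
  (ρ : Representation ℂ K V)

theorem stateRepresentation_apply (h : K) : stateRepresentation K h = (h.1 : Operator L) := rfl

theorem projector_eq [Fintype K] : projector ρ = isotypicProjection ρ (stateRepresentation K) := by
  rw [projector, finsum_eq_sum_of_fintype, isotypicProjection]
  simp only [star_character]
  rfl

variable (hK : ∀ h : K, (h.1 : Operator L) ∈ gradedOperators L)

include hK in
-- The group preserves energy, hence so does the projector. A homogeneous vector `P v` equals `P (P
-- v)`, so it is the image of a homogeneous vector of the sector.
theorem projectedModule_inf_energySpace [Fintype K] [ρ.IsIrreducible] (lam : dualLattice L)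
    (w : ℝ) : projectedModule ρ lam ⊓ energySpace L w
      = (sector L lam ⊓ energySpace L w).map
        (isotypicProjection ρ (stateRepresentation K)) := by
  have hN : ∀ k, ∀ v ∈ sector L lam, stateRepresentation K k v ∈ sector L lam :=
    fun k v hv => apply_mem_sector (hK k) hv
  have hN' : ∀ k, ∀ v ∈ sector L lam ⊓ energySpace L w,
      stateRepresentation K k v ∈ sector L lam ⊓ energySpace L w :=
    fun k v hv => apply_mem_sector_inf_energySpace (hK k) v hv
  rw [projectedModule, projector_eq]
  refine le_antisymm ?_ (le_inf (Submodule.map_mono inf_le_left) ?_)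
  · rintro _ ⟨⟨v, hv, rfl⟩, hw⟩
    exact ⟨_, ⟨isotypicProjection_mem ρ hN hv, hw⟩,
      LinearMap.congr_fun (isotypicProjection_mul_self ρ (stateRepresentation K)) v⟩
  · rintro _ ⟨v, hv, rfl⟩
    exact (isotypicProjection_mem ρ hN' hv).2

include hK in
-- A central `k` is a scalar `s` in `ρ` by Schur, so `P k = s P`; on the sector `k` is the phase
-- `e^{2πi(μ|λ)}`. Evaluating both on a vector with `P v ≠ 0` identifies the scalars.
theorem agreeOnCenter [IsIntegralLattice L] [Finite K] (ε : Cocycle L) [ρ.IsIrreducible]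
    {lam : dualLattice L} (h : projectedModule ρ lam ≠ ⊥) : AgreeOnCenter ε ρ lam := by
  have := Fintype.ofFinite K
  intro mu k hk
  obtain ⟨s, hs⟩ := eq_smul_one_of_commute ρ (f := ρ k) fun l => by
    rw [Commute, SemiconjBy, ← map_mul, ← map_mul]
    congr 1
    exact Subtype.ext (Units.ext (IsExpOf.commute ε hk (hK l)).eq)
  obtain ⟨_, ⟨v, hv, rfl⟩, hne⟩ := (Submodule.ne_bot_iff _).1 h
  rw [projector_eq] at hne
  have h1 := LinearMap.congr_fun
    (isotypicProjection_mul_of_scalar ρ (stateRepresentation K) hs) v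
  rw [Module.End.mul_apply, stateRepresentation_apply, IsExpOf.apply_sector ε hk hv, map_smul,
    LinearMap.smul_apply] at h1
  rw [hs, ← smul_left_injective ℂ hne h1]
  rfl

end Action

/-! ### The twisted character operator as a product of commuting exponentials. -/

section TwistedOperator

variable {c : ℕ} {L : Submodule ℤ (ChargeSpace c)} [IsIntegralLattice L] [DiscreteTopology L]

theorem commute_opExp {X A : Operator L} (hX : X ∈ gradedOperators L)
    (hA : A ∈ gradedOperators L) (h : Commute X A) : Commute X (opExp A) :=
  opExp_semiconj hX hA hA h

omit [IsIntegralLattice L] [DiscreteTopology L] in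
theorem commute_energyShift {A : Operator L} (hA : A ∈ gradedOperators L) (t : ℂ) :
    Commute (energy L - t • (1 : Operator L)) A := by
  refine LinearMap.ext fun v => ?_
  have h := LinearMap.congr_fun (commute_energy hA).eq v
  simp only [Module.End.mul_apply, LinearMap.sub_apply, LinearMap.smul_apply,
    Module.End.one_apply, map_sub, map_smul] at h ⊢
  rw [h]

theorem opExp_add_smul_one {A : Operator L} (hA : A ∈ gradedOperators L) (t : ℂ) :
    opExp (A + t • (1 : Operator L)) = Complex.exp t • opExp A := by
  have h : Commute A (t • (1 : Operator L)) := by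
    rw [Commute, SemiconjBy, mul_smul_comm, smul_mul_assoc, mul_one, one_mul]
  rw [opExp_add hA (Subalgebra.smul_mem _ (Subalgebra.one_mem _) _) h, opExp_smul_one,
    mul_smul_comm, mul_one]

omit [IsIntegralLattice L] [DiscreteTopology L] in
theorem smul_commute_smul {A B : Operator L} (h : Commute A B) (s t : ℂ) :
    Commute (s • A) (t • B) := by
  rw [Commute, SemiconjBy, smul_mul_smul_comm, smul_mul_smul_comm, h.eq, mul_comm s t]

variable (ε : Cocycle L)

omit [DiscreteTopology L] in
theorem smul_toOperator_mem (t : ℂ) (x : Currents L) :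
    t • toOperator ε x ∈ gradedOperators L :=
  Subalgebra.smul_mem _ (toOperator_mem ε x) _

theorem isExp_energy_add (x : Currents L) (s t : ℂ) :
    IsExp (s • energy L + toOperator ε x + t • 1)
      (opExp (s • energy L + toOperator ε x + t • 1)) :=
  isExp_opExp (Subalgebra.add_mem _ (Subalgebra.add_mem _ (Subalgebra.smul_mem _ energy_mem _)
    (toOperator_mem ε x)) (Subalgebra.smul_mem _ (Subalgebra.one_mem _) _))

variable {ε} {Q : ChargeSpace c} {β : Currents L}

/-- The operator `q^{L₀ - c/24} e^{-2πiτβ} e^{2πiζQ}`. -/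
def untwistedOperator (ε : Cocycle L) (Q : ChargeSpace c) (β : Currents L) (τ ζ : ℂ) :
    Operator L :=
  opExp ((2 * Real.pi * Complex.I * τ) • (energy L - ((c : ℂ) / 24) • (1 : Operator L))) *
    opExp ((-(2 * Real.pi * Complex.I * τ)) • toOperator ε β) *
    opExp ((2 * Real.pi * Complex.I * ζ) • toOperator ε (ofReal L Q))

theorem untwistedOperator_mem (τ ζ : ℂ) : untwistedOperator ε Q β τ ζ ∈ gradedOperators L :=
  Subalgebra.mul_mem _ (Subalgebra.mul_mem _ (opExp_mem (energyShift_mem _ _))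
    (opExp_mem (smul_toOperator_mem ε _ _))) (opExp_mem (smul_toOperator_mem ε _ _))

/-- The constants `½(β|β)` and `(Q|β)` come out as scalars, and `q^{L₀ - β}` splits because the zero
mode `β` conserves energy. -/
theorem twistedCharacterOperator_eq (τ ζ : ℂ) : twistedCharacterOperator ε Q β τ ζ
    = (Complex.exp (2 * Real.pi * Complex.I * τ * (form ε β β / 2)) *
        Complex.exp (-(2 * Real.pi * Complex.I * ζ * form ε (ofReal L Q) β))) •
      untwistedOperator ε Q β τ ζ := by
  have h1 : (2 * Real.pi * Complex.I * τ) • (twistedEnergy ε β - ((c : ℂ) / 24) • 1)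
      = (2 * Real.pi * Complex.I * τ) • (energy L - ((c : ℂ) / 24) • (1 : Operator L))
        + (-(2 * Real.pi * Complex.I * τ)) • toOperator ε β
        + (2 * Real.pi * Complex.I * τ * (form ε β β / 2)) • (1 : Operator L) := by
    rw [twistedEnergy]
    refine LinearMap.ext fun v => ?_
    simp only [LinearMap.smul_apply, LinearMap.add_apply, LinearMap.sub_apply]
    module
  have h2 : (2 * Real.pi * Complex.I * ζ) • twistedCharge ε Q β
      = (2 * Real.pi * Complex.I * ζ) • toOperator ε (ofReal L Q)
        + (-(2 * Real.pi * Complex.I * ζ * form ε (ofReal L Q) β)) • (1 : Operator L) := by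
    rw [twistedCharge]
    refine LinearMap.ext fun v => ?_
    simp only [LinearMap.smul_apply, LinearMap.add_apply, LinearMap.sub_apply]
    module
  have h3 := energyShift_mem (L := L) (2 * Real.pi * Complex.I * τ) ((c : ℂ) / 24)
  have h4 := smul_toOperator_mem ε (-(2 * Real.pi * Complex.I * τ)) β
  have h5 : Commute
      ((2 * Real.pi * Complex.I * τ) • (energy L - ((c : ℂ) / 24) • (1 : Operator L)))
      ((-(2 * Real.pi * Complex.I * τ)) • toOperator ε β) :=
    smul_commute_smul (commute_energyShift (toOperator_mem ε β) _) _ _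
  rw [twistedCharacterOperator, h1, h2, opExp_add_smul_one (Subalgebra.add_mem _ h3 h4),
    opExp_add_smul_one (smul_toOperator_mem ε _ _), opExp_add h3 h4 h5, smul_mul_smul_comm]
  rfl

theorem commute_untwistedOperator {h : Operator L} (hh : h ∈ gradedOperators L)
    (hβ : Commute h (toOperator ε β)) (hQ : Commute h (toOperator ε (ofReal L Q))) (τ ζ : ℂ) :
    Commute h (untwistedOperator ε Q β τ ζ) := by
  have h1 : ∀ {A : Operator L} (t : ℂ), Commute h A → Commute h (t • A) := fun t hA => by
    have := smul_commute_smul hA 1 t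
    rwa [one_smul] at this
  exact ((commute_opExp hh (energyShift_mem _ _) (h1 _ (commute_energyShift hh _).symm)).mul_right
    (commute_opExp hh (smul_toOperator_mem ε _ _) (h1 _ hβ))).mul_right
    (commute_opExp hh (smul_toOperator_mem ε _ _) (h1 _ hQ))

/-- Since `α`, `β` and `Q` commute pairwise, their exponentials merge into that of `ζQ + α - τβ`.
This is how inserting `h` in the trace yields an ordinary lattice character. -/
theorem mul_untwistedOperator {h : (Operator L)ˣ} {α : Currents L} (hα : IsExpOf ε h α)
    (hαβ : Commute (toOperator ε α) (toOperator ε β))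
    (hαQ : Commute (toOperator ε α) (toOperator ε (ofReal L Q)))
    (hβQ : Commute (toOperator ε β) (toOperator ε (ofReal L Q))) (τ ζ : ℂ) :
    (h : Operator L) * untwistedOperator ε Q β τ ζ
      = characterOperator ε τ (ζ • ofReal L Q + α - τ • β) := by
  have h1 : (2 * Real.pi * Complex.I) • toOperator ε (ζ • ofReal L Q + α - τ • β)
      = ((-(2 * Real.pi * Complex.I * τ)) • toOperator ε β
        + (2 * Real.pi * Complex.I * ζ) • toOperator ε (ofReal L Q))
        + (2 * Real.pi * Complex.I) • toOperator ε α := by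
    have h2 : toOperator ε (ζ • ofReal L Q + α - τ • β) + τ • toOperator ε β
        = ζ • toOperator ε (ofReal L Q) + toOperator ε α := by
      rw [← toOperator_smul, ← toOperator_smul, ← toOperator_add, ← toOperator_add,
        sub_add_cancel]
    have h3 : toOperator ε (ζ • ofReal L Q + α - τ • β)
        = ζ • toOperator ε (ofReal L Q) + toOperator ε α + (-τ) • toOperator ε β := by
      rw [← h2, add_assoc, ← add_smul, add_neg_cancel, zero_smul, add_zero]
    rw [h3]
    refine LinearMap.ext fun v => ?_
    simp only [LinearMap.smul_apply, LinearMap.add_apply]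
    module
  have hB := smul_toOperator_mem ε (-(2 * Real.pi * Complex.I * τ)) β
  have hC := smul_toOperator_mem ε (2 * Real.pi * Complex.I * ζ) (ofReal L Q)
  have hA := smul_toOperator_mem ε (2 * Real.pi * Complex.I) α
  have hAB := smul_commute_smul hαβ (2 * Real.pi * Complex.I) (-(2 * Real.pi * Complex.I * τ))
  have hAC := smul_commute_smul hαQ (2 * Real.pi * Complex.I) (2 * Real.pi * Complex.I * ζ)
  have hh : (h : Operator L) = opExp ((2 * Real.pi * Complex.I) • toOperator ε α) :=
    (IsExp.opExp_eq hα).symm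
  have hhm : (h : Operator L) ∈ gradedOperators L := IsExp.mem_gradedOperators hA hα
  have h2 : Commute (h : Operator L) (untwistedOperator ε Q β τ ζ) := by
    have h3 : ∀ {A : Operator L}, A ∈ gradedOperators L → Commute (toOperator ε α) A →
        Commute (h : Operator L) A := fun hA' hc => by
      rw [hh]
      have h4 := smul_commute_smul hc.symm 1 (2 * Real.pi * Complex.I)
      rw [one_smul] at h4
      exact (commute_opExp hA' hA h4).symm
    exact commute_untwistedOperator hhm (h3 (toOperator_mem ε β) hαβ)
      (h3 (toOperator_mem ε _) hαQ) τ ζ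
  rw [h2.eq, characterOperator, h1, opExp_add (Subalgebra.add_mem _ hB hC) hA
    ((hAB.symm).add_left hAC.symm), opExp_add hB hC (smul_commute_smul hβQ _ _),
    untwistedOperator, hh]
  simp only [mul_assoc]

end TwistedOperator

/-! ### Summing the group averages over the energies. -/

section TwistedTrace

variable {c : ℕ} {L : Submodule ℤ (ChargeSpace c)} [IsIntegralLattice L] [DiscreteTopology L]
  {ε : Cocycle L} {K : Subgroup (Operator L)ˣ} [Fintype K] {V : Type*} [AddCommGroup V]
  [Module ℂ V] [FiniteDimensional ℂ V] (ρ : Representation ℂ K V)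

omit [IsIntegralLattice L] [DiscreteTopology L] in
-- At each energy the trace is a finite average over the group; a finite combination of convergent
-- sums over energies may be formed term by term.
theorem hasTrace_multiplicitySpace {lam : dualLattice L} {T : Operator L}
    (hK : ∀ h : K, (h.1 : Operator L) ∈ gradedOperators L) (hT : T ∈ gradedOperators L)
    (hTK : ∀ h : K, Commute T h.1) {t : K → ℂ}
    (ht : ∀ h : K, HasTrace (fun w => sector L lam ⊓ energySpace L w) (h.1 * T) (t h)) :
    HasTrace (M := V →ₗ[ℂ] StateSpace L) (multiplicitySpace ρ lam) (postcompose V T)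
      ((Nat.card K : ℂ)⁻¹ * ∑ h, ρ.character h⁻¹ * t h) := by
  have hfd : ∀ w, FiniteDimensional ℂ (sector L lam ⊓ energySpace L w : Submodule ℂ _) :=
    fun w => ((ht 1).1 w).1
  have hN : ∀ w, ∀ k, ∀ v ∈ sector L lam ⊓ energySpace L w,
      stateRepresentation K k v ∈ sector L lam ⊓ energySpace L w :=
    fun w k v hv => apply_mem_sector_inf_energySpace (hK k) v hv
  have hTN : ∀ w, ∀ v ∈ sector L lam ⊓ energySpace L w, T v ∈ sector L lam ⊓ energySpace L w :=
    fun w => apply_mem_sector_inf_energySpace hT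
  have he : ∀ w, multiplicitySpace ρ lam w
      = equivariantMaps ρ (stateRepresentation K) (sector L lam ⊓ energySpace L w) := fun _ => rfl
  refine ⟨fun w => ⟨?_, fun f hf => ?_⟩, ?_⟩
  · rw [he]
    exact finiteDimensional_equivariantMaps ρ (hN w)
  · rw [he] at hf ⊢
    exact compRight_mem_equivariantMaps ρ (π := stateRepresentation K) (hTN w) hTK hf
  · refine ((hasSum_sum fun h _ => (ht h).2.mul_left (ρ.character h⁻¹)).mul_left
      (Nat.card K : ℂ)⁻¹).congr_fun fun w => ?_
    exact traceOn_equivariantMaps ρ (hN w) (hTN w) hTK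

omit [IsIntegralLattice L] [DiscreteTopology L] in
theorem hasTrace_projectedModule [ρ.IsIrreducible] {lam : dualLattice L} {T : Operator L}
    (hK : ∀ h : K, (h.1 : Operator L) ∈ gradedOperators L) (hT : T ∈ gradedOperators L)
    (hTK : ∀ h : K, Commute T h.1) {t : K → ℂ}
    (ht : ∀ h : K, HasTrace (fun w => sector L lam ⊓ energySpace L w) (h.1 * T) (t h)) :
    HasTrace (fun w => projectedModule ρ lam ⊓ energySpace L w) T
      (ρ.character 1 * ((Nat.card K : ℂ)⁻¹ * ∑ h, ρ.character h⁻¹ * t h)) := by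
  have hfd : ∀ w, FiniteDimensional ℂ (sector L lam ⊓ energySpace L w : Submodule ℂ _) :=
    fun w => ((ht 1).1 w).1
  have hN : ∀ w, ∀ k, ∀ v ∈ sector L lam ⊓ energySpace L w,
      stateRepresentation K k v ∈ sector L lam ⊓ energySpace L w :=
    fun w k v hv => apply_mem_sector_inf_energySpace (hK k) v hv
  have hTN : ∀ w, ∀ v ∈ sector L lam ⊓ energySpace L w, T v ∈ sector L lam ⊓ energySpace L w :=
    fun w => apply_mem_sector_inf_energySpace hT
  simp only [projectedModule_inf_energySpace ρ hK]
  refine ⟨fun w => ⟨inferInstance, ?_⟩, ?_⟩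
  · rintro _ ⟨v, hv, rfl⟩
    exact ⟨T v, hTN w v hv, (LinearMap.congr_fun
      (commute_isotypicProjection ρ (π := stateRepresentation K) hTK).eq v).symm⟩
  · refine (((hasSum_sum fun h _ => (ht h).2.mul_left (ρ.character h⁻¹)).mul_left
      (Nat.card K : ℂ)⁻¹).mul_left (ρ.character 1)).congr_fun fun w => ?_
    exact traceOn_map_isotypicProjection ρ (hN w) (hTN w) hTK

omit [IsIntegralLattice L] [DiscreteTopology L] in
theorem HasTrace.smul {W : ℝ → Submodule ℂ (StateSpace L)} {A : Operator L} {t : ℂ}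
    (h : HasTrace W A t) (s : ℂ) : HasTrace W (s • A) (s * t) := by
  refine ⟨fun w => ⟨(h.1 w).1, fun x hx => (W w).smul_mem _ ((h.1 w).2 x hx)⟩, ?_⟩
  refine (h.2.mul_left s).congr_fun fun w => ?_
  obtain ⟨φ, hφ⟩ := exists_traceOn_eq (W w)
  rw [hφ _ (h.1 w).2, hφ _ fun x hx => (W w).smul_mem _ ((h.1 w).2 x hx), map_smul, smul_eq_mul]

end TwistedTrace

end LatticeOrbifold

end

/-! ### The character formula for the twisted projected modules. -/

open LatticeOrbifold in
theorem mainTheorem2 {c : ℕ} (L : Submodule ℤ (EuclideanSpace ℝ (Fin c)))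
    [DiscreteTopology L] [IsZLattice ℝ L] [IsIntegralLattice L] (ε : Cocycle L)
    (Q : dualLattice L)
    -- the gauge group
    (Γ : Subgroup (Operator L)ˣ) [Finite Γ] (hΓG : Γ ≤ gaugeGroup ε)
    (hΓQ : ∀ h ∈ Γ, ∀ n : ℤ,
      Commute (h : Operator L) (cartanMode L (fun i => ((Q : EuclideanSpace ℝ (Fin c)) i : ℂ)) n))
    -- the twist
    (b : (Operator L)ˣ) (hb : b ∈ Γ) (β : Currents L) (hβ : IsHermitian ε β)
    (hbβ : IsExpOf ε b β) (hcent : centralizerIn Γ (b : Operator L) = twistCentralizer ε Γ β)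
    (hβQ : Commute (toOperator ε β) (toOperator ε (ofReal L (Q : EuclideanSpace ℝ (Fin c)))))
    -- the elements of `Γ_β`, written as `h = e^{2πi α}` with `α` commuting with `β` and `Q`
    (α : twistCentralizer ε Γ β → Currents L) (hα : ∀ h, IsHermitian ε (α h))
    (hαexp : ∀ h, IsExpOf ε h.1 (α h))
    (hαβ : ∀ h, Commute (toOperator ε (α h)) (toOperator ε β))
    (hαQ : ∀ h, Commute (toOperator ε (α h))
      (toOperator ε (ofReal L (Q : EuclideanSpace ℝ (Fin c)))))
    -- the irreducible representation of `Γ_β` with character `σ`, and the charge class `λ`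
    {V : Type*} [AddCommGroup V] [Module ℂ V] [FiniteDimensional ℂ V]
    (ρ : Representation ℂ (twistCentralizer ε Γ β) V) [ρ.IsIrreducible] (lam : dualLattice L) :
    -- the operator exponentials that enter the characters exist
    (∀ (x : Currents L) (s t : ℂ),
      IsExp (s • energy L + toOperator ε x + t • 1)
        (opExp (s • energy L + toOperator ε x + t • 1))) ∧
    -- the projected module is nontrivial only if `σ` and `λ` agree on `L*/L`
    (projectedModule ρ lam ≠ ⊥ → AgreeOnCenter ε ρ lam) ∧
    ∀ τ : ℂ, 0 < τ.im →
      -- the traces on the right-hand side of the character formula converge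
      (∀ (ζ : ℂ) (h : twistCentralizer ε Γ β),
        HasTrace (fun w => sector L lam ⊓ energySpace L w)
          (characterOperator ε τ (ζ • ofReal L (Q : EuclideanSpace ℝ (Fin c)) + α h - τ • β))
          (latticeCharacter ε lam τ
            (ζ • ofReal L (Q : EuclideanSpace ℝ (Fin c)) + α h - τ • β))) ∧
      -- the character formula, on the multiplicity space of `ρ` and on the projected module
      (∀ ζ χ : ℂ,
        χ = 1 / (Nat.card (twistCentralizer ε Γ β) : ℂ) * ∑ᶠ h : twistCentralizer ε Γ β,
          Complex.exp (-(2 * Real.pi * Complex.I * ζ *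
              form ε (ofReal L (Q : EuclideanSpace ℝ (Fin c))) β)) *
            twistedCharacter ε lam (ζ • ofReal L (Q : EuclideanSpace ℝ (Fin c)) + α h) β τ *
            (starRingEnd ℂ) (ρ.character h) →
        HasTrace (M := V →ₗ[ℂ] StateSpace L) (multiplicitySpace ρ lam)
          (postcompose V (twistedCharacterOperator ε (Q : EuclideanSpace ℝ (Fin c)) β τ ζ)) χ ∧
        HasTrace (fun w => projectedModule ρ lam ⊓ energySpace L w)
          (twistedCharacterOperator ε (Q : EuclideanSpace ℝ (Fin c)) β τ ζ)
          (ρ.character 1 * χ)) ∧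
      -- the lattice characters are theta functions, on every `G`-conjugate of `ℂ ⊗ L`
      (∀ (v : Fin c → ℂ) (g : (Operator L)ˣ) (x : Currents L), g ∈ gaugeGroup ε →
        toOperator ε x = (g : Operator L) * toOperator ε (cartan L v) * ((g⁻¹ : (Operator L)ˣ) :
          Operator L) →
        HasTrace (fun w => sector L lam ⊓ energySpace L w) (characterOperator ε τ x)
          (latticeCharacter ε lam τ x) ∧
        HasSum (fun γ : L => 1 / ModularForm.eta τ ^ c *
            (Complex.exp (2 * Real.pi * Complex.I * τ *
              ((inner ℝ ((γ : EuclideanSpace ℝ (Fin c)) + lam)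
                ((γ : EuclideanSpace ℝ (Fin c)) + lam) / 2 : ℝ) : ℂ)) *
            Complex.exp (2 * Real.pi * Complex.I *
              ∑ i, (((γ : EuclideanSpace ℝ (Fin c)) + lam) i : ℂ) * v i)))
          (latticeCharacter ε lam τ x)) := by
  have hK : ∀ h : twistCentralizer ε Γ β, (h.1 : Operator L) ∈ gradedOperators L :=
    fun h => (gaugeGroup_mem ε (hΓG h.2.1)).1
  have hfin : Finite (twistCentralizer ε Γ β) :=
    Finite.of_injective (fun h => (⟨h.1, h.2.1⟩ : Γ)) fun h k hk =>
      Subtype.ext (congrArg (fun x : Γ => x.1) hk)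
  have := Fintype.ofFinite (twistCentralizer ε Γ β)
  refine ⟨isExp_energy_add ε, agreeOnCenter ρ hK ε, fun τ hτ =>
    ⟨fun ζ h => (hasSum_latticeCharacter ε hτ lam _).2, fun ζ χ hχ => ?_,
      fun v g x hg hx => ⟨(hasSum_latticeCharacter ε hτ lam x).2, ?_⟩⟩⟩
  · set Q' : ChargeSpace c := (Q : EuclideanSpace ℝ (Fin c))
    -- The scalar due to the twist; it is the same for all `h`, so the averaging only sees the
    -- untwisted operator.
    set s : ℂ := Complex.exp (2 * Real.pi * Complex.I * τ * (form ε β β / 2)) *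
      Complex.exp (-(2 * Real.pi * Complex.I * ζ * form ε (ofReal L Q') β)) with hs
    have hT : s • untwistedOperator ε Q' β τ ζ ∈ gradedOperators L :=
      Subalgebra.smul_mem _ (untwistedOperator_mem τ ζ) _
    have hQ : ∀ h : twistCentralizer ε Γ β,
        Commute (h.1 : Operator L) (toOperator ε (ofReal L Q')) := fun h => by
      rw [ofReal, toOperator_cartan]
      exact hΓQ h.1 h.2.1 0
    have hTK : ∀ h : twistCentralizer ε Γ β,
        Commute (s • untwistedOperator ε Q' β τ ζ) (h.1 : Operator L) := fun h => by
      have h1 := smul_commute_smul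
        (commute_untwistedOperator (hK h) h.2.2 (hQ h) τ ζ).symm s 1
      rwa [one_smul] at h1
    -- Each `h` is inserted through its own logarithm `α h`; different `α h` are not required to
    -- commute with one another.
    have ht : ∀ h : twistCentralizer ε Γ β,
        HasTrace (fun w => sector L lam ⊓ energySpace L w)
          ((h.1 : Operator L) * s • untwistedOperator ε Q' β τ ζ)
          (s * latticeCharacter ε lam τ (ζ • ofReal L Q' + α h - τ • β)) := fun h => by
      rw [mul_smul_comm, mul_untwistedOperator (hαexp h) (hαβ h) (hαQ h) hβQ]
      exact (hasSum_latticeCharacter ε hτ lam _).2.smul s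
    -- The conjugate character values of the formula become values at inverses, the form produced by
    -- averaging.
    have hχ' : χ = (Nat.card (twistCentralizer ε Γ β) : ℂ)⁻¹ *
        ∑ h, ρ.character h⁻¹ *
          (s * latticeCharacter ε lam τ (ζ • ofReal L Q' + α h - τ • β)) := by
      rw [hχ, one_div, finsum_eq_sum_of_fintype]
      congr 1
      refine Finset.sum_congr rfl fun h _ => ?_
      rw [star_character, twistedCharacter, hs]
      ring
    rw [twistedCharacterOperator_eq, hχ']
    exact ⟨hasTrace_multiplicitySpace ρ hK hT hTK ht, hasTrace_projectedModule ρ hK hT hTK ht⟩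
  · rw [latticeCharacter_conj ε lam τ x _ hg hx]
    exact latticeCharacter_cartan ε hτ lam v
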